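/- Let $k$ be an algebraically closed field and let $\mathcal E$ be an idempotent complete $k$-linear Frobenius category (an exact category in the sense of Quillen with enough projectives and enough injectives, in which projectives and injectives coincide). Let $P$ be an object such that the projective objects of $\mathcal E$ are exactly the objects of $\mathrm{add}(P)$, i.e. the direct summands of finite direct sums of copies of $P$. Let $F=P\oplus F'$, where $F'$ has no non-zero projective direct summand. Put $A=\mathrm{End}_{\mathcal E}(F)$, let $e\in A$ be the idempotent given by the projection of $F$ onto $P$, and consider right $A$-modules. Write $\mathcal C=\mathrm{add}(F)$, let $J_{\mathcal C}$ be its Jacobson radical and $D=\mathrm{Hom}_k(-,k)$. Assume that $\mathcal C$ has $d$-almost split sequences: $\mathcal C$ is Krull--Schmidt, and every non-projective indecomposable $X\in\mathcal C$ is the right end, and every non-injective indecomposable $Y\in\mathcal C$ is the left end, of a $d$-almost split sequence, i.e. an exact sequence $$0\to Y\xrightarrow{f_d}C_{d-1}\xrightarrow{f_{d-1}}\cdots\to C_0\xrightarrow{f_0}X\to 0$$ in $\mathcal E$ with all terms in $\mathcal C$ and all $f_j$ in $J_{\mathcal C}$, such that the sequences of functors on $\mathcal C$ $$0\to(?,Y)\to(?,C_{d-1})\to\cdots\to(?,C_0)\to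 J_{\mathcal C}(?,X)\to0,$$ $$0\to(X,?)\to(C_0,?)\to\cdots\to(C_{d-1},?)\to J_{\mathcal C}(Y,?)\to0$$ are exact. In this case write $\tau_d(X)=Y$. Assume moreover that $A/AeA$ is finite-dimensional over $k$. Let $F_1,\dots,F_r$ be representatives of the isomorphism classes of non-projective indecomposable objects of $\mathrm{add}(F)$, and let $S_i$ be the top of the $A$-module $\mathrm{Hom}_{\mathcal E}(F,F_i)$. Let $\mathcal D_{fd,A/AeA}(A)$ be the full subcategory of the derived category $\mathcal D(\mathrm{Mod}\text{-}A)$ of complexes whose total cohomology is finite-dimensional over $k$ and whose cohomology modules are $A/AeA$-modules. Then $S_1,\dots,S_r$ are, up to isomorphism and without repetition, all the simple $A/AeA$-modules, and the following hold. (a) Every finite-dimensional $A/AeA$-module has finite projective dimension over $A$. (b) $\mathcal D_{fd,A/AeA}(A)$ admits a Serre functor: it is Hom-finite, and there is a $k$-linear auto-equivalence $\nu$ with isomorphisms $D\,\mathrm{Hom}(X,Y)\cong\mathrm{Hom}(Y,\nu X)$ that are natural in $X$ and $Y$. (c) For each $i$ there is a smallest positive integer $n_i$ with $\tau_d^{n_i}(F_i)\cong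 F_i$, and $S_i$ is fractionally $\frac{(d+1)n_i}{n_i}$-Calabi--Yau: $S_i$, as a complex concentrated in degree $0$, belongs to $\mathcal D_{fd,A/AeA}(A)$, and $\nu^{n_i}(S_i)\cong S_i[(d+1)n_i]$ for every Serre functor $\nu$ of this category. (d) There is a permutation $\pi$ of the set of isomorphism classes of simple $A/AeA$-modules such that for all simple $A/AeA$-modules $S,S'$ and all $l\in\mathbb Z$ there is an isomorphism of $k$-vector spaces $$D\,\mathrm{Ext}^l_A(S,S')\cong\mathrm{Ext}^{d+1-l}_A(S',\pi(S)).$$ -/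

import Mathlib

open CategoryTheory CategoryTheory.Limits
open scoped ModuleCat

universe w v u t

namespace FracCY

/-! ### Exact categories in the sense of Quillen, and Frobenius categories -/

section Exact

variable {E : Type u} [Category.{v} E] [Preadditive E]

/-- `f` is the first map of a short complex in the given class. -/
def IsInflation (P : ObjectProperty (ShortComplex E)) {X Y : E} (f : X ⟶ Y) : Prop :=
  ∃ (Z : E) (g : Y ⟶ Z) (w : f ≫ g = 0), P (ShortComplex.mk f g w)

/-- `g` is the second map of a short complex in the given class. -/
def IsDeflation (P : ObjectProperty (ShortComplex E)) {Y Z : E} (g : Y ⟶ Z) : Prop :=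
  ∃ (X : E) (f : X ⟶ Y) (w : f ≫ g = 0), P (ShortComplex.mk f g w)

variable (E) in
/-- An exact structure (Quillen): an isomorphism-closed class of kernel-cokernel pairs, called
conflations (or short exact sequences), satisfying the usual axioms. -/
structure ExactStructure where
  /-- the short exact sequences -/
  conflation : ObjectProperty (ShortComplex E)
  of_iso : ∀ {S T : ShortComplex E}, (S ≅ T) → conflation S → conflation T
  isKernel : ∀ S : ShortComplex E, conflation S →
    Nonempty (IsLimit (KernelFork.ofι S.f S.zero))
  isCokernel : ∀ S : ShortComplex E, conflation S →
    Nonempty (IsColimit (CokernelCofork.ofπ S.g S.zero))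
  inflation_id : ∀ X : E, IsInflation conflation (𝟙 X)
  deflation_id : ∀ X : E, IsDeflation conflation (𝟙 X)
  inflation_comp : ∀ {X Y Z : E} (f : X ⟶ Y) (g : Y ⟶ Z),
    IsInflation conflation f → IsInflation conflation g → IsInflation conflation (f ≫ g)
  deflation_comp : ∀ {X Y Z : E} (f : X ⟶ Y) (g : Y ⟶ Z),
    IsDeflation conflation f → IsDeflation conflation g → IsDeflation conflation (f ≫ g)
  inflation_pushout : ∀ {X Y X' : E} (i : X ⟶ Y) (f : X ⟶ X'), IsInflation conflation i →
    ∃ (Y' : E) (f' : Y ⟶ Y') (i' : X' ⟶ Y'), IsPushout i f f' i' ∧ IsInflation conflation i'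
  deflation_pullback : ∀ {Y Z Z' : E} (p : Y ⟶ Z) (f : Z' ⟶ Z), IsDeflation conflation p →
    ∃ (Y' : E) (f' : Y' ⟶ Y) (p' : Y' ⟶ Z'), IsPullback f' p' p f ∧ IsDeflation conflation p'

namespace ExactStructure

variable (𝓔 : ExactStructure E)

/-- Projective objects relative to the exact structure. -/
def IsProjective (P : E) : Prop :=
  ∀ ⦃Y Z : E⦄ (g : Y ⟶ Z), IsDeflation 𝓔.conflation g → ∀ h : P ⟶ Z, ∃ h' : P ⟶ Y, h' ≫ g = h

/-- Injective objects relative to the exact structure. -/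
def IsInjective (I : E) : Prop :=
  ∀ ⦃X Y : E⦄ (f : X ⟶ Y), IsInflation 𝓔.conflation f → ∀ h : X ⟶ I, ∃ h' : Y ⟶ I, f ≫ h' = h

/-- A Frobenius category: enough projectives, enough injectives, and these classes coincide. -/
structure IsFrobenius : Prop where
  enough_projectives : ∀ X : E, ∃ (P : E) (p : P ⟶ X),
    𝓔.IsProjective P ∧ IsDeflation 𝓔.conflation p
  enough_injectives : ∀ X : E, ∃ (I : E) (i : X ⟶ I),
    𝓔.IsInjective I ∧ IsInflation 𝓔.conflation i
  projective_iff_injective : ∀ X : E, 𝓔.IsProjective X ↔ 𝓔.IsInjective X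

/-- Exactness of a complex `⋯ ⟶ K₂ ⟶ K₁ ⟶ K₀ ⟶ 0` in an exact category: it is spliced from
conflations `Z (j+1) ⟶ K (j+1) ⟶ Z j`, where `Z 0 ⟶ K 0` is an isomorphism. -/
def IsExactComplex (K : ChainComplex E ℕ) : Prop :=
  ∃ (Z : ℕ → E) (i : ∀ j, Z j ⟶ K.X j) (p : ∀ j, K.X (j + 1) ⟶ Z j)
    (w : ∀ j, i (j + 1) ≫ p j = 0),
    IsIso (i 0) ∧ (∀ j, p j ≫ i j = K.d (j + 1) j) ∧
      ∀ j, 𝓔.conflation (ShortComplex.mk (i (j + 1)) (p j) (w j))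

end ExactStructure

end Exact

/-! ### Krull-Schmidt categories, the radical, and `d`-almost split sequences -/

section AlmostSplit

variable {E : Type u} [Category.{v} E] [Preadditive E]

/-- The Jacobson radical of an additive category. -/
def InRadical {X Y : E} (f : X ⟶ Y) : Prop :=
  ∀ g : Y ⟶ X, IsIso (𝟙 X - f ≫ g)

variable [HasFiniteBiproducts E] [HasBinaryBiproducts E]

/-- `add F`: the direct summands of finite direct sums of copies of `F`. -/
def addOf (F : E) : ObjectProperty E := fun X =>
  ∃ n : ℕ, Nonempty (Retract X (⨁ fun _ : Fin n => F))

/-- A full subcategory is Krull-Schmidt if each of its objects is a finite direct sum of objects of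
the subcategory with local endomorphism rings. -/
def IsKrullSchmidt (C : ObjectProperty E) : Prop :=
  ∀ X, C X → ∃ (n : ℕ) (G : Fin n → E),
    (∀ i, C (G i) ∧ IsLocalRing (End (G i))) ∧ Nonempty (X ≅ ⨁ G)

/-- A `d`-almost split sequence
`0 ⟶ K (d+1) ⟶ K d ⟶ ⋯ ⟶ K 1 ⟶ K 0 ⟶ 0` in the full subcategory `C`, so the right-hand end is
`K 0` and the left-hand end is `K (d+1)`. -/
structure IsAlmostSplit (𝓔 : ExactStructure E) (C : ObjectProperty E) (d : ℕ)
    (K : ChainComplex E ℕ) : Prop where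
  mem : ∀ j, C (K.X j)
  isZero : ∀ j, d + 1 < j → IsZero (K.X j)
  exact : 𝓔.IsExactComplex K
  radical : ∀ j, j ≤ d → InRadical (K.d (j + 1) j)
  /-- exactness of `0 ⟶ (W, K (d+1)) ⟶ ⋯ ⟶ (W, K 1) ⟶ (W, K 0)` away from `(W, K 0)` -/
  exact_left : ∀ W, C W → ∀ (j : ℕ) (g : W ⟶ K.X (j + 1)), g ≫ K.d (j + 1) j = 0 →
    ∃ h : W ⟶ K.X (j + 2), h ≫ K.d (j + 2) (j + 1) = g
  /-- the image of `(W, K 1) ⟶ (W, K 0)` is the radical -/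
  sink : ∀ W, C W → ∀ g : W ⟶ K.X 0, InRadical g ↔ ∃ h : W ⟶ K.X 1, h ≫ K.d 1 0 = g
  /-- injectivity of `(K 0, W) ⟶ (K 1, W)` -/
  mono_right : ∀ W, C W → ∀ g : K.X 0 ⟶ W, K.d 1 0 ≫ g = 0 → g = 0
  /-- exactness of `(K 0, W) ⟶ (K 1, W) ⟶ ⋯ ⟶ (K (d+1), W)` at `(K 1, W), …, (K d, W)` -/
  exact_right : ∀ W, C W → ∀ j, j + 1 ≤ d → ∀ g : K.X (j + 1) ⟶ W,
    K.d (j + 2) (j + 1) ≫ g = 0 → ∃ h : K.X j ⟶ W, K.d (j + 1) j ≫ h = g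
  /-- the image of `(K d, W) ⟶ (K (d+1), W)` is the radical -/
  source : ∀ W, C W → ∀ g : K.X (d + 1) ⟶ W,
    InRadical g ↔ ∃ h : K.X d ⟶ W, K.d (d + 1) d ≫ h = g

/-- The full subcategory `C` has `d`-almost split sequences. -/
structure HasAlmostSplitSequences (𝓔 : ExactStructure E) (C : ObjectProperty E) (d : ℕ) :
    Prop where
  krullSchmidt : IsKrullSchmidt C
  exists_right : ∀ X, C X → Indecomposable X → ¬ 𝓔.IsProjective X →
    ∃ K : ChainComplex E ℕ, IsAlmostSplit 𝓔 C d K ∧ Nonempty (K.X 0 ≅ X)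
  exists_left : ∀ Y, C Y → Indecomposable Y → ¬ 𝓔.IsInjective Y →
    ∃ K : ChainComplex E ℕ, IsAlmostSplit 𝓔 C d K ∧ Nonempty (K.X (d + 1) ≅ Y)

/-- `Y ≅ τ_d X`: there is a `d`-almost split sequence `0 ⟶ Y ⟶ ⋯ ⟶ X ⟶ 0`. -/
def IsTau (𝓔 : ExactStructure E) (C : ObjectProperty E) (d : ℕ) (X Y : E) : Prop :=
  ∃ K : ChainComplex E ℕ, IsAlmostSplit 𝓔 C d K ∧ Nonempty (K.X 0 ≅ X) ∧
    Nonempty (K.X (d + 1) ≅ Y)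

/-- `Y ≅ τ_d ^ n X`. -/
def IsTauIter (𝓔 : ExactStructure E) (C : ObjectProperty E) (d : ℕ) : ℕ → E → E → Prop
  | 0, X, Y => Nonempty (X ≅ Y)
  | n + 1, X, Y => ∃ Z, IsTau 𝓔 C d X Z ∧ IsTauIter 𝓔 C d n Z Y

end AlmostSplit

/-! ### Serre functors -/

section Serre

variable (k : Type t) [Field k] {T : Type u} [Category.{v} T] [Preadditive T] [Linear k T]

/-- `ν` is a Serre functor on the `k`-linear category `T`: the category is Hom-finite, `ν` is a
`k`-linear auto-equivalence, and there are isomorphisms `D Hom(X, Y) ≅ Hom(Y, ν X)` of `k`-vector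
spaces which are natural in both variables. -/
structure IsSerreFunctor (ν : T ⥤ T) : Prop where
  homFinite : ∀ X Y : T, Module.Finite k (X ⟶ Y)
  isEquivalence : ν.IsEquivalence
  additive : ν.Additive
  linear : ν.Linear k
  duality : ∃ η : ∀ X Y : T, Module.Dual k (X ⟶ Y) ≃ₗ[k] (Y ⟶ ν.obj X),
    (∀ (X : T) {Y Y' : T} (f : Y ⟶ Y') (φ : Module.Dual k (X ⟶ Y')),
      η X Y (φ ∘ₗ Linear.rightComp k X f) = f ≫ η X Y' φ) ∧
    (∀ {X X' : T} (Y : T) (g : X ⟶ X') (φ : Module.Dual k (X ⟶ Y)),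
      η X' Y (φ ∘ₗ Linear.leftComp k Y g) = η X Y φ ≫ ν.map g)

end Serre

/-! ### Right modules over an algebra `A`, an element `e`, and the quotient `A / AeA`

Right `A`-modules are modules over the opposite ring. -/

section Modules

variable {A : Type v} [Ring A]

/-- The quotient ring `A / AeA`. -/
abbrev QuotAeA (e : A) : Type v := (TwoSidedIdeal.span {e}).ringCon.Quotient

/-- A right `A`-module is an `A / AeA`-module if it is annihilated by the ideal `AeA`. -/
def IsQuotModule (e : A) (M : ModuleCat.{v} Aᵐᵒᵖ) : Prop :=
  ∀ a ∈ TwoSidedIdeal.span {e}, ∀ m : M, MulOpposite.op a • m = 0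

/-- The simple `A / AeA`-modules, as a full subcategory of the right `A`-modules. -/
def simpleQuotModules (e : A) : ObjectProperty (ModuleCat.{v} Aᵐᵒᵖ) := fun M =>
  IsQuotModule e M ∧ IsSimpleModule Aᵐᵒᵖ M

/-- Isomorphism classes of simple `A / AeA`-modules. -/
abbrev SimpleIsoClasses (e : A) : Type (v + 1) :=
  Quotient (isIsomorphicSetoid (simpleQuotModules e).FullSubcategory)

variable [HasDerivedCategory.{w} (ModuleCat.{v} Aᵐᵒᵖ)]

/-- A module as a complex concentrated in degree `0`, in the derived category. -/
noncomputable abbrev stalk (M : ModuleCat.{v} Aᵐᵒᵖ) : DerivedCategory (ModuleCat.{v} Aᵐᵒᵖ) :=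
  (DerivedCategory.singleFunctor (ModuleCat.{v} Aᵐᵒᵖ) 0).obj M

/-- `Ext_A^l(M, N)` for an integer `l`. -/
abbrev ExtInt (M N : ModuleCat.{v} Aᵐᵒᵖ) (l : ℤ) : Type w :=
  stalk M ⟶ (stalk N)⟦l⟧

variable (k : Type t) [Field k] [Algebra k A]

/-- The objects of `D(A)` with finite-dimensional total cohomology, whose cohomology modules are
`A / AeA`-modules. -/
def DfdProp (e : A) : ObjectProperty (DerivedCategory (ModuleCat.{v} Aᵐᵒᵖ)) := fun X =>
  (∀ n : ℤ, Module.Finite k ((DerivedCategory.homologyFunctor (ModuleCat.{v} Aᵐᵒᵖ) n).obj X)) ∧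
  {n : ℤ | ¬ IsZero ((DerivedCategory.homologyFunctor (ModuleCat.{v} Aᵐᵒᵖ) n).obj X)}.Finite ∧
  ∀ n : ℤ, IsQuotModule e ((DerivedCategory.homologyFunctor (ModuleCat.{v} Aᵐᵒᵖ) n).obj X)

/-- The category `D_{fd, A/AeA}(A)`. -/
abbrev Dfd (e : A) := (DfdProp k e).FullSubcategory

end Modules

section Top

variable {E : Type u} [Category.{v} E] [Preadditive E]

/-- The top `Hom(F, G) / rad Hom(F, G)` of the right `End F`-module `Hom(F, G)`. -/
noncomputable abbrev topHom (F G : E) : ModuleCat.{v} (End F)ᵐᵒᵖ :=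
  ModuleCat.of (End F)ᵐᵒᵖ ((F ⟶ G) ⧸ Module.jacobson (End F)ᵐᵒᵖ (F ⟶ G))

/-- The idempotent of `End (P ⊕ F')` which is the projection onto `P`. -/
noncomputable def idemP [HasBinaryBiproducts E] (P F' : E) : End (P ⊞ F') :=
  (biprod.fst : P ⊞ F' ⟶ P) ≫ (biprod.inl : P ⟶ P ⊞ F')

end Top

end FracCY

open FracCY

/-!
Let `S` be the top of `Hom(F, X)`, where `X` is a non-projective indecomposable summand of `F`, and
let `0 → K_{d+1} → ⋯ → K_0 → 0` be the almost split sequence ending at `K_0 = X`. Applying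
`Hom(F, -)` gives a resolution of `S` of length `d + 1` by finitely generated projective
`A`-modules. Hence `S` has projective dimension at most `d + 1`, and (a) follows by induction along
short exact sequences (`quotModule_induction`).

For the other assertions, call `(X, Y)` a Serre pair on a subcategory `Q` if `Y` represents `D
Hom(X, -)` on `Q` through a functional on `Hom(X, Y)` (`IsSerrePair`). Serre pairs are stable under
shifts and, by a five lemma argument, under cones (`IsSerrePair.exists_cone`). A finitely generated
projective module `M` forms a Serre pair on the bounded derived category of *all* `A`-modules with
its Nakayama dual `D Hom(M, A)`, which is injective (`exists_isSerrePair_of_dualBasis`); the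
isomorphisms `Hom(W, D Hom(M, A)) ≅ D Hom(M, W)` need no finiteness of `A` or `W`. By the
resolution, `S` therefore has a Serre dual `Y`. Testing `Y` against the modules `Hom(F, G)` with `G`
in `add F` amounts to computing `Ext(S, Hom(F, G))`, which the exactness of `Hom(-, G)` on the
almost split sequence concentrates in degree `d + 1`, where it is the top of `Hom(K_{d+1}, G)`. So
`Y` is the top of `Hom(F, K_{d+1})` shifted by `d + 1` (`IsAlmostSplit.isSerrePair_stalk_topHom`).
The object `K_{d+1}` has a local endomorphism ring, because endomorphisms of the two ends of the
sequence lift to endomorphisms of the whole sequence, and it is not injective, because maps from it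
to injective objects extend along the first map of the sequence and so are radical.

Thus the Serre dual of `S_i` is `S_{τ i}[d + 1]`, where `τ` describes `τ_d`. As a Serre dual
determines the original object when the Hom spaces are finite-dimensional, `τ` is injective, hence
a permutation of `{1, …, r}`. The `S_i` generate `D_{fd, A/AeA}(A)` (`dfdProp_le`), so every object
of this category has a Serre dual and is one, which yields the Serre functor of (b)
(`exists_isSerreFunctor_of_generators`). Uniqueness of Serre duals gives (c), with `n_i` the length
of the cycle of `τ` through `i`, and the Serre pairs themselves are the isomorphisms of (d).
-/

namespace FracCY

/-! ### Trace pairings in a linear category -/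

section LinearAlgebra

variable {k : Type*} [Field k]

lemma exists_dual_comp_eq {V W : Type*} [AddCommGroup V] [Module k V] [AddCommGroup W]
    [Module k W] (g : V →ₗ[k] W) (φ : Module.Dual k V) (h : ∀ x, g x = 0 → φ x = 0) :
    ∃ θ : Module.Dual k W, ∀ x, θ (g x) = φ x := by
  have : φ ∈ LinearMap.range g.dualMap := by
    rw [LinearMap.range_dualMap_eq_dualAnnihilator_ker, Submodule.mem_dualAnnihilator]
    exact fun x hx => h x hx
  obtain ⟨θ, rfl⟩ := this
  exact ⟨θ, fun _ => rfl⟩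

/-- Two functionals on the sources of `a` and `b` come from one functional on the common target as
soon as they agree on the fibre product. -/
lemma exists_dual_of_compatible {V₁ V₂ W : Type*} [AddCommGroup V₁] [Module k V₁]
    [AddCommGroup V₂] [Module k V₂] [AddCommGroup W] [Module k W]
    (a : V₁ →ₗ[k] W) (b : V₂ →ₗ[k] W) (α : Module.Dual k V₁) (β : Module.Dual k V₂)
    (h : ∀ x y, a x = b y → α x = β y) :
    ∃ θ : Module.Dual k W, (∀ x, θ (a x) = α x) ∧ ∀ y, θ (b y) = β y := by
  obtain ⟨θ, hθ⟩ := exists_dual_comp_eq (a.coprod b) (LinearMap.coprod α β) (by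
    rintro ⟨x, y⟩ hxy
    have := h x (-y) (by
      simp only [LinearMap.coprod_apply] at hxy
      rw [map_neg]
      exact eq_neg_of_add_eq_zero_left hxy)
    simp [LinearMap.coprod_apply, this])
  exact ⟨θ, fun x => by simpa using hθ (x, 0), fun y => by simpa using hθ (0, y)⟩

lemma dualMap_exact {V₁ V₂ V₃ : Type*} [AddCommGroup V₁] [Module k V₁]
    [AddCommGroup V₂] [Module k V₂] [AddCommGroup V₃] [Module k V₃]
    {f : V₁ →ₗ[k] V₂} {g : V₂ →ₗ[k] V₃} (h : Function.Exact f g) :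
    Function.Exact g.dualMap f.dualMap := by
  intro φ
  constructor
  · intro hφ
    obtain ⟨θ, hθ⟩ := exists_dual_comp_eq g φ (fun x hx => by
      obtain ⟨y, rfl⟩ := (h x).1 hx
      exact LinearMap.congr_fun hφ y)
    exact ⟨θ, LinearMap.ext hθ⟩
  · rintro ⟨θ, rfl⟩
    ext x
    simp [h.apply_apply_eq_zero]

end LinearAlgebra

section Pairing

variable {k : Type t} [Field k] {T : Type u} [Category.{v} T] [Preadditive T] [Linear k T]

/-- The pairing `Hom(W, Y) × Hom(X, W) → k` defined by a functional `t` on `Hom(X, Y)`. -/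
def tracePairing {X Y : T} (t : (X ⟶ Y) →ₗ[k] k) (W : T) :
    (W ⟶ Y) →ₗ[k] Module.Dual k (X ⟶ W) where
  toFun f := t ∘ₗ Linear.rightComp k X f
  map_add' f g := by ext; simp
  map_smul' c f := by ext; simp

@[simp]
lemma tracePairing_apply {X Y W : T} (t : (X ⟶ Y) →ₗ[k] k) (f : W ⟶ Y) (h : X ⟶ W) :
    tracePairing t W f h = t (h ≫ f) := rfl

lemma tracePairing_bijective_of_iso {X Y W W' : T} (t : (X ⟶ Y) →ₗ[k] k) (e : W ≅ W')
    (h : Function.Bijective (tracePairing t W)) : Function.Bijective (tracePairing t W') := by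
  constructor
  · rw [injective_iff_map_eq_zero]
    intro f hf
    have : e.hom ≫ f = 0 := (injective_iff_map_eq_zero _).1 h.1 _ (by
      ext x
      simpa using LinearMap.congr_fun hf (x ≫ e.hom))
    simpa using e.inv ≫= this
  · intro φ
    obtain ⟨f, hf⟩ := h.2 (φ ∘ₗ Linear.rightComp k X e.hom)
    refine ⟨e.inv ≫ f, ?_⟩
    ext x
    simpa using LinearMap.congr_fun hf (x ≫ e.inv)

lemma tracePairing_bijective_of_isZero {X Y W : T} (t : (X ⟶ Y) →ₗ[k] k) (hW : IsZero W) :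
    Function.Bijective (tracePairing t W) := by
  constructor
  · intro f g _
    exact hW.eq_of_src _ _
  · intro φ
    refine ⟨0, ?_⟩
    ext x
    rw [hW.eq_of_tgt x 0]
    simp

variable (k) in
/-- `Y` represents the functor `D Hom(X, -)` on the objects of `Q`: some functional on
`Hom(X, Y)` induces bijections `Hom(W, Y) ≃ D Hom(X, W)` for all `W` in `Q`. -/
def IsSerrePair (Q : ObjectProperty T) (X Y : T) : Prop :=
  ∃ t : (X ⟶ Y) →ₗ[k] k, ∀ W, Q W → Function.Bijective (tracePairing t W)

lemma IsSerrePair.mono {Q Q' : ObjectProperty T} (hQ : Q ≤ Q') {X Y : T}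
    (h : IsSerrePair k Q' X Y) : IsSerrePair k Q X Y :=
  let ⟨t, ht⟩ := h
  ⟨t, fun W hW => ht W (hQ W hW)⟩

lemma IsSerrePair.of_iso {Q : ObjectProperty T} {X Y X' Y' : T} (h : IsSerrePair k Q X Y)
    (e : X ≅ X') (e' : Y ≅ Y') : IsSerrePair k Q X' Y' := by
  obtain ⟨t, ht⟩ := h
  refine ⟨t ∘ₗ Linear.leftComp k Y e.hom ∘ₗ Linear.rightComp k X' e'.inv, fun W hW => ⟨?_, ?_⟩⟩
  · rw [injective_iff_map_eq_zero]
    intro f hf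
    have : f ≫ e'.inv = 0 := (injective_iff_map_eq_zero _).1 (ht W hW).1 _ (by
      ext x
      simpa using LinearMap.congr_fun hf (e.inv ≫ x))
    simpa using this =≫ e'.hom
  · intro φ
    obtain ⟨f, hf⟩ := (ht W hW).2 (φ ∘ₗ Linear.leftComp k W e.inv)
    refine ⟨f ≫ e'.hom, ?_⟩
    ext x
    simpa using LinearMap.congr_fun hf (e.hom ≫ x)

/-- The object representing `D Hom(X, -)` is unique up to isomorphism. -/
lemma IsSerrePair.iso_unique {Q : ObjectProperty T} {X Y Y' : T} (h : IsSerrePair k Q X Y)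
    (h' : IsSerrePair k Q X Y') (hY : Q Y) (hY' : Q Y') : Nonempty (Y ≅ Y') := by
  obtain ⟨t, ht⟩ := h
  obtain ⟨t', ht'⟩ := h'
  obtain ⟨a, ha⟩ := (ht' Y hY).2 t
  obtain ⟨b, hb⟩ := (ht Y' hY').2 t'
  have ha (x : X ⟶ Y) : t' (x ≫ a) = t x := LinearMap.congr_fun ha x
  have hb (x : X ⟶ Y') : t (x ≫ b) = t' x := LinearMap.congr_fun hb x
  refine ⟨⟨a, b, (ht Y hY).1 ?_, (ht' Y' hY').1 ?_⟩⟩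
  · ext x
    simp [← Category.assoc, ha, hb]
  · ext x
    simp [← Category.assoc, ha, hb]

/-- Over finite-dimensional Hom spaces, an object `X` is determined by `Y`. -/
lemma IsSerrePair.iso_unique_left {Q : ObjectProperty T} {X X' Y : T} (h : IsSerrePair k Q X Y)
    (h' : IsSerrePair k Q X' Y) (hX : Q X) (hX' : Q X') [Module.Finite k (X ⟶ X)]
    [Module.Finite k (X ⟶ X')] [Module.Finite k (X' ⟶ X)] [Module.Finite k (X' ⟶ X')] :
    Nonempty (X ≅ X') := by
  obtain ⟨t, ht⟩ := h
  obtain ⟨t', ht'⟩ := h'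
  -- every functional on the dual space `Hom(W, Y)` of `Hom(X, W)` is the evaluation at a map
  have key {Z W : T} (s : (Z ⟶ Y) →ₗ[k] k) (hs : Function.Bijective (tracePairing s W))
      [Module.Finite k (Z ⟶ W)] (ψ : (W ⟶ Y) →ₗ[k] k) :
      ∃! x : Z ⟶ W, ∀ f : W ⟶ Y, s (x ≫ f) = ψ f := by
    let e := LinearEquiv.ofBijective _ hs
    refine ⟨(Module.evalEquiv k (Z ⟶ W)).symm (ψ ∘ₗ e.symm.toLinearMap), fun f => ?_, ?_⟩
    · change e f _ = _
      rw [Module.apply_evalEquiv_symm_apply]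
      simp
    · intro x hx
      rw [LinearEquiv.eq_symm_apply]
      ext φ
      obtain ⟨f, rfl⟩ := e.surjective φ
      exact (hx f).trans (by simp [e] : ψ f = (ψ ∘ₗ e.symm.toLinearMap) (e f))
  obtain ⟨a, ha, -⟩ := key t (ht X' hX') t'
  obtain ⟨b, hb, -⟩ := key t' (ht' X hX) t
  refine ⟨⟨a, b, (key t (ht X hX) t).unique ?_ (by simp),
    (key t' (ht' X' hX') t').unique ?_ (by simp)⟩⟩
  · intro f
    rw [Category.assoc, ha, hb]
  · intro f
    rw [Category.assoc, hb, ha]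

end Pairing

section Shift

variable {k : Type t} [Field k] {T : Type u} [Category.{v} T] [Preadditive T] [Linear k T]
  [HasShift T ℤ] [∀ n : ℤ, (shiftFunctor T n).Additive] [∀ n : ℤ, (shiftFunctor T n).Linear k]

/-- The functional on `Hom(X⟦n⟧, Y⟦n⟧)` induced by a functional on `Hom(X, Y)`. -/
noncomputable def shiftTrace {X Y : T} (t : (X ⟶ Y) →ₗ[k] k) (n : ℤ) :
    (X⟦n⟧ ⟶ Y⟦n⟧) →ₗ[k] k :=
  t ∘ₗ (LinearEquiv.ofBijective ((shiftFunctor T n).mapLinearMap k (X := X) (Y := Y))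
    ⟨(shiftFunctor T n).map_injective, (shiftFunctor T n).map_surjective⟩).symm.toLinearMap

@[simp]
lemma shiftTrace_map {X Y : T} (t : (X ⟶ Y) →ₗ[k] k) (n : ℤ) (f : X ⟶ Y) :
    shiftTrace t n (f⟦n⟧') = t f := by
  simp only [shiftTrace, LinearMap.comp_apply]
  congr 1
  exact LinearEquiv.ofBijective_symm_apply_apply _ f

lemma tracePairing_shiftTrace_bijective {X Y W : T} (t : (X ⟶ Y) →ₗ[k] k) (n : ℤ)
    (h : Function.Bijective (tracePairing t W)) :
    Function.Bijective (tracePairing (shiftTrace t n) (W⟦n⟧)) := by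
  constructor
  · rw [injective_iff_map_eq_zero]
    intro f hf
    obtain ⟨f, rfl⟩ := (shiftFunctor T n).map_surjective f
    have : f = 0 := (injective_iff_map_eq_zero _).1 h.1 f (by
      ext x
      have := LinearMap.congr_fun hf (x⟦n⟧')
      simpa [← Functor.map_comp] using this)
    simp [this]
  · intro φ
    obtain ⟨f, hf⟩ := h.2 (φ ∘ₗ (shiftFunctor T n).mapLinearMap k)
    refine ⟨f⟦n⟧', ?_⟩
    ext x
    obtain ⟨x, rfl⟩ := (shiftFunctor T n).map_surjective x
    have := LinearMap.congr_fun hf x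
    simpa [← Functor.map_comp] using this

lemma tracePairing_shiftTrace_bijective' {Q : ObjectProperty T} [Q.IsStableUnderShift ℤ]
    {X Y : T} (t : (X ⟶ Y) →ₗ[k] k) (n : ℤ)
    (h : ∀ W, Q W → Function.Bijective (tracePairing t W)) (W : T) (hW : Q W) :
    Function.Bijective (tracePairing (shiftTrace t n) W) :=
  tracePairing_bijective_of_iso _ ((shiftEquiv T n).counitIso.app W)
    (tracePairing_shiftTrace_bijective t n (h _ (Q.le_shift (-n) _ hW)))

lemma IsSerrePair.shift {Q : ObjectProperty T} [Q.IsStableUnderShift ℤ] {X Y : T}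
    (h : IsSerrePair k Q X Y) (n : ℤ) : IsSerrePair k Q (X⟦n⟧) (Y⟦n⟧) :=
  let ⟨t, ht⟩ := h
  ⟨shiftTrace t n, tracePairing_shiftTrace_bijective' t n ht⟩

end Shift

section Triangulated

open Pretriangulated

variable {k : Type t} [Field k] {T : Type u} [Category.{v} T] [Preadditive T] [Linear k T]
  [HasZeroObject T] [HasShift T ℤ] [∀ n : ℤ, (shiftFunctor T n).Additive] [Pretriangulated T]

lemma rightComp_exact₂ (X : T) {S : Triangle T} (hS : S ∈ distTriang T) :
    Function.Exact (Linear.rightComp k X S.mor₁) (Linear.rightComp k X S.mor₂) := by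
  intro f
  constructor
  · intro hf
    obtain ⟨g, rfl⟩ := Triangle.coyoneda_exact₂ S hS f hf
    exact ⟨g, rfl⟩
  · rintro ⟨g, rfl⟩
    simp [comp_distTriang_mor_zero₁₂ S hS]

lemma leftComp_exact₂ (X : T) {S : Triangle T} (hS : S ∈ distTriang T) :
    Function.Exact (Linear.leftComp k X S.mor₂) (Linear.leftComp k X S.mor₁) := by
  intro f
  constructor
  · intro hf
    obtain ⟨g, rfl⟩ := Triangle.yoneda_exact₂ S hS f hf
    exact ⟨g, rfl⟩
  · rintro ⟨g, rfl⟩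
    simp [← Category.assoc, comp_distTriang_mor_zero₁₂ S hS]

/-- Perfectness of the trace pairing is inherited by the middle term of a triangle. -/
lemma tracePairing_bijective_of_distTriang {X Y : T} (t : (X ⟶ Y) →ₗ[k] k) {S : Triangle T}
    (hS : S ∈ distTriang T)
    (h₀ : Function.Bijective (tracePairing t (S.obj₃⟦(-1 : ℤ)⟧)))
    (h₁ : Function.Bijective (tracePairing t S.obj₁))
    (h₃ : Function.Bijective (tracePairing t S.obj₃))
    (h₄ : Function.Bijective (tracePairing t (S.obj₁⟦(1 : ℤ)⟧))) :
    Function.Bijective (tracePairing t S.obj₂) := by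
  have hr := rot_of_distTriang _ hS
  have hi := inv_rot_of_distTriang _ hS
  refine LinearMap.bijective_of_surjective_of_bijective_of_bijective_of_injective
    (Linear.leftComp k Y S.mor₃) (Linear.leftComp k Y S.mor₂) (Linear.leftComp k Y S.mor₁)
    (Linear.leftComp k Y S.invRotate.mor₁)
    (Linear.rightComp k X S.mor₃).dualMap (Linear.rightComp k X S.mor₂).dualMap
    (Linear.rightComp k X S.mor₁).dualMap (Linear.rightComp k X S.invRotate.mor₁).dualMap
    (tracePairing t (S.obj₁⟦(1 : ℤ)⟧)) (tracePairing t S.obj₃) (tracePairing t S.obj₂)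
    (tracePairing t S.obj₁) (tracePairing t (S.obj₃⟦(-1 : ℤ)⟧))
    ?_ ?_ ?_ ?_ (leftComp_exact₂ Y hr) (leftComp_exact₂ Y hS) (leftComp_exact₂ Y hi)
    (dualMap_exact (rightComp_exact₂ X hr)) (dualMap_exact (rightComp_exact₂ X hS))
    (dualMap_exact (rightComp_exact₂ X hi)) h₄.2 h₃ h₁ h₀.1
  all_goals
    ext f x
    exact congrArg t (Category.assoc _ _ _)

/-- The objects all of whose shifts pair perfectly form a triangulated subcategory. -/
def perfectAt {X Y : T} (t : (X ⟶ Y) →ₗ[k] k) : ObjectProperty T := fun W =>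
  ∀ n : ℤ, Function.Bijective (tracePairing t (W⟦n⟧))

instance {X Y : T} (t : (X ⟶ Y) →ₗ[k] k) : (perfectAt t).IsClosedUnderIsomorphisms where
  of_iso e h n := tracePairing_bijective_of_iso t ((shiftFunctor T n).mapIso e) (h n)

instance {X Y : T} (t : (X ⟶ Y) →ₗ[k] k) : (perfectAt t).IsTriangulated where
  exists_zero := ⟨_, isZero_zero T, fun n => tracePairing_bijective_of_isZero t
    ((shiftFunctor T n).map_isZero (isZero_zero T))⟩
  isStableUnderShiftBy a := ⟨fun W hW n =>
    tracePairing_bijective_of_iso t ((shiftFunctorAdd T a n).app W) (hW (a + n))⟩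
  ext₂' S hS h₁ h₃ := ObjectProperty.le_isoClosure _ _ fun n => by
    refine tracePairing_bijective_of_distTriang t (Triangle.shift_distinguished S hS n) ?_
      (h₁ n) (h₃ n) ?_
    · exact tracePairing_bijective_of_iso t ((shiftFunctorAdd T n (-1)).app _) (h₃ _)
    · exact tracePairing_bijective_of_iso t ((shiftFunctorAdd T n 1).app _) (h₁ _)

variable [∀ n : ℤ, (shiftFunctor T n).Linear k]

/-- The cone of a morphism `i`, and the cone of the morphism `u` of representing objects which is
adjoint to `i`, form a Serre pair again. The functional on `Hom(cone i, cone u)` extends the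
functionals prescribed on the images of `Hom(cone i, Y)` and of `Hom(X'⟦1⟧, cone u)`; these agree
on the intersection by the axiom on morphisms of triangles. -/
lemma isSerrePair_of_distTriang {Q : ObjectProperty T} [Q.IsStableUnderShift ℤ]
    {X' X X'' Y' Y Y'' : T} {i : X' ⟶ X} {p : X ⟶ X''} {δ : X'' ⟶ X'⟦(1 : ℤ)⟧}
    (hX : Triangle.mk i p δ ∈ distTriang T)
    {u : Y' ⟶ Y} {c : Y ⟶ Y''} {ε : Y'' ⟶ Y'⟦(1 : ℤ)⟧} (hY : Triangle.mk u c ε ∈ distTriang T)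
    (t' : (X' ⟶ Y') →ₗ[k] k) (t : (X ⟶ Y) →ₗ[k] k)
    (ht' : ∀ W, Q W → Function.Bijective (tracePairing t' W))
    (ht : ∀ W, Q W → Function.Bijective (tracePairing t W))
    (hu : ∀ h : X ⟶ Y', t (h ≫ u) = t' (i ≫ h)) :
    IsSerrePair k Q X'' Y'' := by
  -- the signs match the sign of `i⟦1⟧'` in the rotated triangle
  let s' := -shiftTrace t' 1
  let s := -shiftTrace t 1
  have hs' : ∀ W, Q W → Function.Bijective (tracePairing s' W) := fun W hW => by
    have := tracePairing_shiftTrace_bijective' t' 1 ht' W hW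
    have e : tracePairing s' W = -tracePairing (shiftTrace t' 1) W := by ext; simp [s']
    rw [e]
    exact (LinearEquiv.neg k).bijective.comp this
  have hs : ∀ W, Q W → Function.Bijective (tracePairing s W) := fun W hW => by
    have := tracePairing_shiftTrace_bijective' t 1 ht W hW
    have e : tracePairing s W = -tracePairing (shiftTrace t 1) W := by ext; simp [s]
    rw [e]
    exact (LinearEquiv.neg k).bijective.comp this
  have hsu (h : X⟦(1 : ℤ)⟧ ⟶ Y'⟦(1 : ℤ)⟧) : s (h ≫ u⟦1⟧') = s' (i⟦1⟧' ≫ h) := by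
    obtain ⟨h, rfl⟩ := (shiftFunctor T (1 : ℤ)).map_surjective h
    simp [s, s', ← Functor.map_comp, hu]
  have hrX := rot_of_distTriang _ hX
  obtain ⟨θ, hθ₁, hθ₂⟩ := exists_dual_of_compatible (Linear.rightComp k X'' c)
    (Linear.leftComp k Y'' δ) (t ∘ₗ Linear.leftComp k Y p) (s' ∘ₗ Linear.rightComp k _ ε) (by
      intro f g hfg
      obtain ⟨h, hh₁, hh₂⟩ : ∃ h : X ⟶ Y', p ≫ f = h ≫ u ∧ (-i⟦1⟧') ≫ h⟦1⟧' = g ≫ ε :=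
        complete_distinguished_triangle_morphism₁ _ _ hrX hY f g hfg.symm
      rw [Preadditive.neg_comp, ← Functor.map_comp] at hh₂
      change t (p ≫ f) = s' (g ≫ ε)
      rw [hh₁, ← hh₂]
      simp only [s', LinearMap.neg_apply, map_neg, shiftTrace_map, neg_neg]
      exact hu h)
  have hθ₁ (f : X'' ⟶ Y) : θ (f ≫ c) = t (p ≫ f) := hθ₁ f
  have hθ₂ (g : X'⟦(1 : ℤ)⟧ ⟶ Y'') : θ (δ ≫ g) = s' (g ≫ ε) := hθ₂ g
  refine ⟨θ, fun W hW => ?_⟩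
  have hrY := rot_of_distTriang _ hY
  have ex₁ (W : T) : Function.Exact (Linear.rightComp k W ε) (Linear.rightComp k W (u⟦1⟧')) := by
    intro f
    constructor
    · intro hf
      obtain ⟨g, rfl⟩ := Triangle.coyoneda_exact₁ _ hY f hf
      exact ⟨g, rfl⟩
    · rintro ⟨g, rfl⟩
      have := comp_distTriang_mor_zero₃₁ _ hY
      exact (Category.assoc _ _ _).trans ((g ≫= this).trans comp_zero)
  have ex₂ (W : T) : Function.Exact (Linear.leftComp k W (i⟦1⟧')) (Linear.leftComp k W δ) := by
    intro f
    constructor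
    · intro hf
      obtain ⟨g, rfl⟩ := Triangle.yoneda_exact₃ _ hrX f hf
      exact ⟨-g, (Preadditive.comp_neg _ _).trans (Preadditive.neg_comp _ _).symm⟩
    · rintro ⟨g, rfl⟩
      have := comp_distTriang_mor_zero₃₁ _ hX
      exact (Category.assoc _ _ _).symm.trans ((this =≫ g).trans zero_comp)
  refine LinearMap.bijective_of_surjective_of_bijective_of_bijective_of_injective
    (Linear.rightComp k W u) (Linear.rightComp k W c) (Linear.rightComp k W ε)
    (Linear.rightComp k W (u⟦1⟧'))
    (Linear.leftComp k W i).dualMap (Linear.leftComp k W p).dualMap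
    (Linear.leftComp k W δ).dualMap (Linear.leftComp k W (i⟦1⟧')).dualMap
    (tracePairing t' W) (tracePairing t W) (tracePairing θ W)
    (tracePairing s' W) (tracePairing s W)
    ?_ ?_ ?_ ?_ (rightComp_exact₂ W hY) (rightComp_exact₂ W hrY) (ex₁ W)
    (dualMap_exact (leftComp_exact₂ W hX)) (dualMap_exact (leftComp_exact₂ W hrX))
    (dualMap_exact (ex₂ W)) (ht' W hW).2 (ht W hW) (hs' W hW) (hs W hW).1
  · ext f x
    simpa using (hu (x ≫ f)).symm
  · ext f x
    simpa using (hθ₁ (x ≫ f)).symm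
  · ext f x
    simpa using hθ₂ (x ≫ f)
  · ext f x
    simpa using (hsu (x ≫ f)).symm

/-- The objects `X` for which `D Hom(X, -)` is representable by an object of `Q` are closed under
cones. -/
lemma IsSerrePair.exists_cone {Q : ObjectProperty T} [Q.IsTriangulated]
    [Q.IsClosedUnderIsomorphisms]
    {X' X X'' Y' Y : T} {i : X' ⟶ X} {p : X ⟶ X''} {δ : X'' ⟶ X'⟦(1 : ℤ)⟧}
    (hX : Triangle.mk i p δ ∈ distTriang T) (h' : IsSerrePair k Q X' Y')
    (h : IsSerrePair k Q X Y) (hY' : Q Y') (hY : Q Y) :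
    ∃ Y'', Q Y'' ∧ IsSerrePair k Q X'' Y'' := by
  obtain ⟨t', ht'⟩ := h'
  obtain ⟨t, ht⟩ := h
  obtain ⟨u, hu⟩ := (ht Y' hY').2 (t' ∘ₗ Linear.leftComp k Y' i)
  obtain ⟨Y'', hY'', c, ε, hT⟩ := Q.distinguished_cocone_triangle u hY' hY
  exact ⟨Y'', hY'', isSerrePair_of_distTriang hX hT t' t ht' ht
    (fun h => LinearMap.congr_fun hu h)⟩

/-- The dual statement: cones of objects `Y` which represent some `D Hom(X, -)` do so as well. -/
lemma IsSerrePair.exists_cone_right {Q : ObjectProperty T} [Q.IsTriangulated]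
    [Q.IsClosedUnderIsomorphisms]
    {X' X Y' Y Y'' : T} {u : Y' ⟶ Y} {c : Y ⟶ Y''} {ε : Y'' ⟶ Y'⟦(1 : ℤ)⟧}
    (hY : Triangle.mk u c ε ∈ distTriang T) (h' : IsSerrePair k Q X' Y')
    (h : IsSerrePair k Q X Y) (hX' : Q X') (hX : Q X) [Module.Finite k (X' ⟶ X)] :
    ∃ X'', Q X'' ∧ IsSerrePair k Q X'' Y'' := by
  obtain ⟨t', ht'⟩ := h'
  obtain ⟨t, ht⟩ := h
  let e := LinearEquiv.ofBijective _ (ht' X hX)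
  obtain ⟨i, hi⟩ : ∃ i : X' ⟶ X, ∀ h : X ⟶ Y', t (h ≫ u) = t' (i ≫ h) := by
    let ψ : (X ⟶ Y') →ₗ[k] k := t ∘ₗ Linear.rightComp k X u
    refine ⟨(Module.evalEquiv k (X' ⟶ X)).symm (ψ ∘ₗ e.symm.toLinearMap), fun h => ?_⟩
    change _ = e h _
    rw [Module.apply_evalEquiv_symm_apply]
    simp [ψ]
  obtain ⟨X'', hX'', p, δ, hT⟩ := Q.distinguished_cocone_triangle i hX' hX
  exact ⟨X'', hX'', isSerrePair_of_distTriang hT hY t' t ht' ht hi⟩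

end Triangulated

/-! ### Serre functors from Serre pairs -/

section SerreFunctor

variable {k : Type t} [Field k] {T : Type u} [Category.{v} T] [Preadditive T] [Linear k T]

lemma IsSerreFunctor.isSerrePair {ν : T ⥤ T} (hν : IsSerreFunctor k ν) (X : T) :
    IsSerrePair k ⊤ X (ν.obj X) := by
  obtain ⟨η, h₁, -⟩ := hν.duality
  let t : (X ⟶ ν.obj X) →ₗ[k] k := (η X (ν.obj X)).symm (𝟙 _)
  have key (W : T) (f : W ⟶ ν.obj X) : η X W (tracePairing t W f) = f := by
    have := h₁ X f t
    rw [LinearEquiv.apply_symm_apply, Category.comp_id] at this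
    exact this
  refine ⟨t, fun W _ => ⟨fun f g hfg => ?_, fun φ => ⟨η X W φ, (η X W).injective (key W _)⟩⟩⟩
  rw [← key W f, ← key W g, hfg]

section

variable {N : T → T} (tr : ∀ X, (X ⟶ N X) →ₗ[k] k)
  (h : ∀ X W, Function.Bijective (tracePairing (tr X) W))

/-- The morphism `N X ⟶ N X'` adjoint to `f` when `N X` represents `D Hom(X, -)` for all `X`. -/
noncomputable def serreMap {X X' : T} (f : X ⟶ X') : N X ⟶ N X' :=
  ((h X' (N X)).2 (tr X ∘ₗ Linear.leftComp k (N X) f)).choose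

lemma trace_comp_serreMap {X X' : T} (f : X ⟶ X') (x : X' ⟶ N X) :
    tr X' (x ≫ serreMap tr h f) = tr X (f ≫ x) :=
  LinearMap.congr_fun ((h X' (N X)).2 (tr X ∘ₗ Linear.leftComp k (N X) f)).choose_spec x

lemma serreMap_eq {X X' : T} {f : X ⟶ X'} {u : N X ⟶ N X'}
    (hu : ∀ x : X' ⟶ N X, tr X' (x ≫ u) = tr X (f ≫ x)) : serreMap tr h f = u :=
  (h X' _).1 (by
    ext x
    exact (trace_comp_serreMap tr h f x).trans (hu x).symm)

lemma serreMap_injective {X X' : T} : Function.Injective (serreMap tr h (X := X) (X' := X')) := by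
  intro f g hfg
  rw [← sub_eq_zero, ← Module.forall_dual_apply_eq_zero_iff k]
  intro φ
  obtain ⟨x, rfl⟩ := (h X X').2 φ
  have hf := trace_comp_serreMap tr h f x
  have hg := trace_comp_serreMap tr h g x
  rw [hfg] at hf
  simp [← hf, ← hg]

lemma serreMap_surjective {X X' : T} [Module.Finite k (X ⟶ X')] :
    Function.Surjective (serreMap tr h (X := X) (X' := X')) := by
  intro u
  let e := LinearEquiv.ofBijective _ (h X X')
  let ψ : (X' ⟶ N X) →ₗ[k] k := tr X' ∘ₗ Linear.rightComp k X' u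
  refine ⟨(Module.evalEquiv k (X ⟶ X')).symm (ψ ∘ₗ e.symm.toLinearMap),
    serreMap_eq tr h fun x => ?_⟩
  change _ = e x _
  rw [Module.apply_evalEquiv_symm_apply]
  simp [ψ]

lemma serreMap_add {X X' : T} (f g : X ⟶ X') :
    serreMap tr h (f + g) = serreMap tr h f + serreMap tr h g :=
  serreMap_eq tr h fun x => by simp [trace_comp_serreMap]

lemma serreMap_smul {X X' : T} (r : k) (f : X ⟶ X') :
    serreMap tr h (r • f) = r • serreMap tr h f :=
  serreMap_eq tr h fun x => by simp [trace_comp_serreMap]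

/-- The functor sending `X` to the object `N X` representing `D Hom(X, -)`. -/
noncomputable def serreFunctor : T ⥤ T where
  obj := N
  map f := serreMap tr h f
  map_id X := serreMap_eq tr h fun x => by simp
  map_comp f g := serreMap_eq tr h fun x => by
    rw [← Category.assoc, trace_comp_serreMap, ← Category.assoc, trace_comp_serreMap,
      Category.assoc]

lemma isSerreFunctor_serreFunctor [∀ X Y : T, Module.Finite k (X ⟶ Y)]
    (hN : ∀ Y, ∃ X, Nonempty (N X ≅ Y)) : IsSerreFunctor k (serreFunctor tr h) where
  homFinite := inferInstance
  isEquivalence :=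
    { faithful := ⟨fun hfg => serreMap_injective tr h hfg⟩
      full := ⟨fun u => serreMap_surjective tr h u⟩
      essSurj := ⟨hN⟩ }
  additive := ⟨serreMap_add tr h _ _⟩
  linear := ⟨fun f r => serreMap_smul tr h r f⟩
  duality := by
    let η (X Y : T) : Module.Dual k (X ⟶ Y) ≃ₗ[k] (Y ⟶ N X) :=
      (LinearEquiv.ofBijective _ (h X Y)).symm
    have hη (X Y : T) (φ : Module.Dual k (X ⟶ Y)) (x : X ⟶ Y) : tr X (x ≫ η X Y φ) = φ x :=
      LinearMap.congr_fun ((LinearEquiv.ofBijective _ (h X Y)).apply_symm_apply φ) x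
    refine ⟨η, fun X Y Y' f φ => (h X Y).1 ?_, fun {X X'} Y g φ => (h X' Y).1 ?_⟩
    · ext x
      change tr X (x ≫ η X Y _) = tr X (x ≫ f ≫ η X Y' φ)
      rw [hη, ← Category.assoc, hη]
      rfl
    · ext x
      change tr X' (x ≫ η X' Y _) = tr X' (x ≫ η X Y φ ≫ serreMap tr h g)
      rw [hη, ← Category.assoc, trace_comp_serreMap, ← Category.assoc, hη]
      rfl

end

/-- A Hom-finite category has a Serre functor as soon as all functors `D Hom(X, -)` are
representable and every object represents one of them. -/
theorem exists_isSerreFunctor [∀ X Y : T, Module.Finite k (X ⟶ Y)]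
    (h : ∀ X : T, ∃ Y, IsSerrePair k ⊤ X Y) (h' : ∀ Y : T, ∃ X, IsSerrePair k ⊤ X Y) :
    ∃ ν : T ⥤ T, IsSerreFunctor k ν := by
  choose N tr hN using h
  refine ⟨_, isSerreFunctor_serreFunctor tr (fun X W => hN X W trivial) fun Y => ?_⟩
  obtain ⟨X, hX⟩ := h' Y
  exact ⟨X, IsSerrePair.iso_unique (Q := ⊤) ⟨tr X, hN X⟩ hX trivial trivial⟩

end SerreFunctor

section FullSubcategory

variable {k : Type t} [Field k] {T : Type u} [Category.{v} T] [Preadditive T] [Linear k T]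

variable (k) in
/-- Morphisms in a full subcategory, linearly. -/
def fullSubcategoryHomEquiv {Q : ObjectProperty T} (X Y : Q.FullSubcategory) :
    (X ⟶ Y) ≃ₗ[k] (X.obj ⟶ Y.obj) where
  toFun f := f.hom
  invFun f := ObjectProperty.homMk f
  map_add' _ _ := rfl
  map_smul' _ _ := rfl
  left_inv _ := rfl
  right_inv _ := rfl

lemma IsSerrePair.fullSubcategory {Q : ObjectProperty T} {X Y : Q.FullSubcategory}
    (h : IsSerrePair k Q X.obj Y.obj) : IsSerrePair k ⊤ X Y := by
  obtain ⟨t, ht⟩ := h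
  refine ⟨t ∘ₗ (fullSubcategoryHomEquiv k X Y).toLinearMap, fun W _ => ?_⟩
  have := ((fullSubcategoryHomEquiv k X W).dualMap.bijective.comp
    ((ht W.obj W.property).comp (fullSubcategoryHomEquiv k W Y).bijective))
  exact this

end FullSubcategory

/-! ### Bounded objects of the derived category -/

section Devissage

open Pretriangulated DerivedCategory Triangulated

variable {C : Type u} [Category.{v} C] [Abelian C] [HasDerivedCategory.{w} C]

variable (C) in
/-- The objects of the derived category with bounded cohomology. -/
abbrev boundedObjects : ObjectProperty (DerivedCategory C) :=
  (DerivedCategory.TStructure.t (C := C)).bounded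

lemma isIso_homologyFunctor_map_mor₁ (S : Triangle (DerivedCategory C)) (hS : S ∈ distTriang _)
    (n m : ℤ) (hm : m + 1 = n) (h : IsZero ((homologyFunctor C m).obj S.obj₃))
    (h' : IsZero ((homologyFunctor C n).obj S.obj₃)) :
    IsIso ((homologyFunctor C n).map S.mor₁) := by
  have := (HomologySequence.mono_homologyMap_mor₁_iff S hS m n hm).2 (h.eq_of_src _ _)
  have := (HomologySequence.epi_homologyMap_mor₁_iff S hS n).2 (h'.eq_of_tgt _ _)
  exact isIso_of_mono_of_epi _

lemma isIso_homologyFunctor_map_mor₂ (S : Triangle (DerivedCategory C)) (hS : S ∈ distTriang _)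
    (n m : ℤ) (hm : n + 1 = m) (h : IsZero ((homologyFunctor C n).obj S.obj₁))
    (h' : IsZero ((homologyFunctor C m).obj S.obj₁)) :
    IsIso ((homologyFunctor C n).map S.mor₂) := by
  have := (HomologySequence.mono_homologyMap_mor₂_iff S hS n).2 (h.eq_of_src _ _)
  have := (HomologySequence.epi_homologyMap_mor₂_iff S hS n m hm).2 (h'.eq_of_tgt _ _)
  exact isIso_of_mono_of_epi _

/-- A triangulated subcategory contains a bounded object as soon as it contains its cohomology
objects. -/
lemma prop_of_homology (Q : ObjectProperty (DerivedCategory C)) [Q.IsTriangulated]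
    [Q.IsClosedUnderIsomorphisms] (X : DerivedCategory C) (a b : ℤ) (hX : X.IsGE a)
    (hX' : X.IsLE b)
    (hQ : ∀ n, Q ((singleFunctor C 0).obj ((homologyFunctor C n).obj X))) : Q X := by
  obtain ⟨m, hm⟩ : ∃ m : ℕ, b - a < m := ⟨(b - a + 1).toNat, by omega⟩
  induction m generalizing X b with
  | zero =>
    obtain ⟨Z, hZ, hZ'⟩ := Q.exists_prop_of_containsZero
    exact Q.prop_of_iso (hZ.iso
      (DerivedCategory.TStructure.t.isZero X b a (by push_cast at hm; omega))) hZ'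
  | succ m ih =>
    obtain ⟨X', X'', hX'₁, hX''₁, f, g, δ, hT⟩ :=
      DerivedCategory.TStructure.t.exists_triangle X (b - 1) b (by omega)
    have hX'₁ : X'.IsLE (b - 1) := ⟨hX'₁⟩
    have hX''₁ : X''.IsGE b := ⟨hX''₁⟩
    have e₁ (n : ℤ) (hn : n < b) :
        Nonempty ((homologyFunctor C n).obj X' ≅ (homologyFunctor C n).obj X) := by
      have : IsIso ((homologyFunctor C n).map f) :=
        isIso_homologyFunctor_map_mor₁ _ hT n (n - 1) (by omega)
        (isZero_of_isGE X'' b (n - 1) (by omega)) (isZero_of_isGE X'' b n hn)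
      exact ⟨asIso ((homologyFunctor C n).map f)⟩
    have e₂ (n : ℤ) (hn : b ≤ n) :
        Nonempty ((homologyFunctor C n).obj X ≅ (homologyFunctor C n).obj X'') := by
      have : IsIso ((homologyFunctor C n).map g) :=
        isIso_homologyFunctor_map_mor₂ _ hT n (n + 1) (by omega)
        (isZero_of_isLE X' (b - 1) n (by omega)) (isZero_of_isLE X' (b - 1) (n + 1) (by omega))
      exact ⟨asIso ((homologyFunctor C n).map g)⟩
    refine Q.ext_of_isTriangulatedClosed₂ _ hT
      (ih X' (b - 1) ?_ hX'₁ ?_ (by push_cast at hm; omega)) ?_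
    · rw [isGE_iff]
      intro i hi
      by_cases hib : i < b
      · exact (isZero_of_isGE X a i hi).of_iso (e₁ i hib).some
      · exact isZero_of_isLE X' (b - 1) i (by omega)
    · intro n
      by_cases hn : n < b
      · exact Q.prop_of_iso ((singleFunctor C 0).mapIso (e₁ n hn).some.symm) (hQ n)
      · obtain ⟨Z, hZ, hZ'⟩ := Q.exists_prop_of_containsZero
        exact Q.prop_of_iso (hZ.iso ((singleFunctor C 0).map_isZero
          (isZero_of_isLE X' (b - 1) n (by omega)))) hZ'
    · have : X''.IsLE b := by
        rw [isLE_iff]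
        intro i hi
        exact (isZero_of_isLE X b i hi).of_iso (e₂ i hi.le).some.symm
      obtain ⟨M, ⟨e⟩⟩ := exists_iso_singleFunctor_obj_of_isGE_of_isLE X'' b
      let e' : M ≅ (homologyFunctor C b).obj X :=
        ((singleFunctorCompHomologyFunctorIso C b).app M).symm ≪≫
          (homologyFunctor C b).mapIso e.symm ≪≫ (e₂ b le_rfl).some.symm
      have h₀ := Q.prop_of_iso ((singleFunctor C 0).mapIso e'.symm) (hQ b)
      refine Q.prop_of_iso (Iso.symm ?_) (Q.le_shift (-b) _ h₀)
      exact e ≪≫ (((singleFunctors C).shiftIso (-b) b 0 (by omega)).app M).symm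

/-- The derived category objects with bounded cohomology are generated by the objects of `C`. -/
lemma bounded_le (Q : ObjectProperty (DerivedCategory C)) [Q.IsTriangulated]
    [Q.IsClosedUnderIsomorphisms] (hQ : ∀ M, Q ((singleFunctor C 0).obj M)) :
    boundedObjects C ≤ Q := by
  rintro X ⟨⟨a, ha⟩, ⟨b, hb⟩⟩
  exact prop_of_homology Q X a b ha hb fun n => hQ _

lemma bounded_singleFunctor_obj (M : C) (n : ℤ) :
    boundedObjects C ((singleFunctor C n).obj M) :=
  ⟨⟨n, inferInstance⟩, ⟨n, inferInstance⟩⟩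

lemma hom_shift_eq_zero_of_neg (M N : C) (n : ℤ) (hn : n < 0)
    (f : (singleFunctor C 0).obj M ⟶ ((singleFunctor C 0).obj N)⟦n⟧) : f = 0 := by
  have := (DerivedCategory.TStructure.t (C := C)).isGE_shift
    ((singleFunctor C 0).obj N) 0 n (-n) (by omega)
  exact DerivedCategory.TStructure.t.zero f 0 (-n) (by omega)

lemma hom_shift_eq_zero_of_projective (P N : C) [Projective P] (n : ℤ) (hn : n ≠ 0)
    (f : (singleFunctor C 0).obj P ⟶ ((singleFunctor C 0).obj N)⟦n⟧) : f = 0 := by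
  obtain hn | hn := hn.lt_or_gt
  · exact hom_shift_eq_zero_of_neg P N n hn f
  · obtain ⟨m, rfl⟩ : ∃ m : ℕ, n = (m + 1 : ℕ) := ⟨(n - 1).toNat, by push_cast; omega⟩
    have := HasExt.standard C
    obtain ⟨x, rfl⟩ := (Abelian.Ext.homEquiv (X := P) (Y := N) (n := m + 1)).surjective f
    rw [Abelian.Ext.eq_zero_of_projective x]
    exact Abelian.Ext.zero_hom _ _ _

lemma hom_shift_eq_zero_of_injective (M I : C) [Injective I] (n : ℤ) (hn : n ≠ 0)
    (f : (singleFunctor C 0).obj M ⟶ ((singleFunctor C 0).obj I)⟦n⟧) : f = 0 := by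
  obtain hn | hn := hn.lt_or_gt
  · exact hom_shift_eq_zero_of_neg M I n hn f
  · obtain ⟨m, rfl⟩ : ∃ m : ℕ, n = (m + 1 : ℕ) := ⟨(n - 1).toNat, by push_cast; omega⟩
    have := HasExt.standard C
    obtain ⟨x, rfl⟩ := (Abelian.Ext.homEquiv (X := M) (Y := I) (n := m + 1)).surjective f
    rw [Abelian.Ext.eq_zero_of_injective x]
    exact Abelian.Ext.zero_hom _ _ _

/-- A morphism `W⟦n⟧ ⟶ Y` vanishes if all morphisms `W ⟶ Y⟦-n⟧` do. -/
lemma shift_hom_eq_zero {T : Type*} [Category* T] [Preadditive T] [HasShift T ℤ]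
    [∀ n : ℤ, (shiftFunctor T n).Additive] {W Y : T} (n : ℤ) (h : ∀ f : W ⟶ Y⟦-n⟧, f = 0)
    (f : W⟦n⟧ ⟶ Y) : f = 0 := by
  apply (shiftFunctor T (-n)).map_injective
  rw [Functor.map_zero]
  exact (cancel_epi ((shiftEquiv T n).unitIso.hom.app W)).1 ((h _).trans comp_zero.symm)

variable {k : Type t} [Field k] [Linear k C]

/-- A perfect pairing between a projective and an injective object of `C` stays perfect in the
derived category. -/
lemma isSerrePair_of_projective_injective {P I : C} [Projective P] [Injective I]
    (t : (P ⟶ I) →ₗ[k] k) (ht : ∀ M : C, Function.Bijective (tracePairing t M)) :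
    IsSerrePair k (boundedObjects C)
      ((singleFunctor C 0).obj P) ((singleFunctor C 0).obj I) := by
  let e (M N : C) : (M ⟶ N) ≃ₗ[k] ((singleFunctor C 0).obj M ⟶ (singleFunctor C 0).obj N) :=
    LinearEquiv.ofBijective ((singleFunctor C 0).mapLinearMap k)
      ⟨(singleFunctor C 0).map_injective, (singleFunctor C 0).map_surjective⟩
  let s := t ∘ₗ (e P I).symm.toLinearMap
  have hs (f : P ⟶ I) : s ((singleFunctor C 0).map f) = t f :=
    congrArg t ((e P I).symm_apply_apply f)
  suffices h : boundedObjects C ≤ perfectAt s from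
    ⟨s, fun W hW => tracePairing_bijective_of_iso s ((shiftFunctorZero _ ℤ).app W) (h W hW 0)⟩
  refine bounded_le _ fun M n => ?_
  by_cases hn : n = 0
  · subst hn
    refine tracePairing_bijective_of_iso s (W := (DerivedCategory.singleFunctor C 0).obj M)
      ((shiftFunctorZero _ ℤ).symm.app _) ?_
    have h₁ : (tracePairing s ((singleFunctor C 0).obj M)) =
        ((e P M).symm.dualMap.toLinearMap ∘ₗ tracePairing t M) ∘ₗ (e M I).symm.toLinearMap := by
      ext f x
      obtain ⟨f, rfl⟩ := (e M I).surjective f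
      obtain ⟨x, rfl⟩ := (e P M).surjective x
      simp only [LinearMap.comp_apply, LinearEquiv.coe_coe, LinearEquiv.symm_apply_apply,
        LinearEquiv.dualMap_apply, tracePairing_apply]
      rw [← hs, Functor.map_comp]
      rfl
    rw [h₁]
    exact ((e P M).symm.dualMap.bijective.comp (ht M)).comp (e M I).symm.bijective
  · have h₁ (f : ((singleFunctor C 0).obj M)⟦n⟧ ⟶ (singleFunctor C 0).obj I) : f = 0 :=
      shift_hom_eq_zero n (hom_shift_eq_zero_of_injective M I (-n) (by omega)) f
    have h₂ := hom_shift_eq_zero_of_projective P M n hn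
    constructor
    · intro f g _
      rw [h₁ f, h₁ g]
    · intro φ
      refine ⟨0, ?_⟩
      ext x
      rw [h₂ x, map_zero, map_zero]

/-- Cohomology classes are represented by morphisms from projective objects. -/
lemma exists_hom_ne_zero_of_projective {P : C} [Projective P] (Y : DerivedCategory C) (n : ℤ)
    (f : P ⟶ (homologyFunctor C n).obj Y) (hf : f ≠ 0) :
    ∃ g : (singleFunctor C n).obj P ⟶ Y, g ≠ 0 := by
  let K := Q.objPreimage Y
  let e : (homologyFunctor C n).obj Y ≅ K.homology n :=
    (homologyFunctor C n).mapIso (Q.objObjPreimageIso Y).symm ≪≫ (homologyFunctorFactors C n).app K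
  let c : P ⟶ K.cycles n := Projective.factorThru (f ≫ e.hom) (K.homologyπ n)
  have hc : c ≫ K.homologyπ n = f ≫ e.hom := Projective.factorThru_comp _ _
  let φ : (HomologicalComplex.single C (ComplexShape.up ℤ) n).obj P ⟶ K :=
    HomologicalComplex.mkHomFromSingle (c ≫ K.iCycles n) (fun i _ => by simp)
  have hφ : (HomologicalComplex.singleObjHomologySelfIso _ n P).inv ≫
      HomologicalComplex.homologyMap φ n = f ≫ e.hom := by
    rw [← hc, ← HomologicalComplex.singleObjCyclesSelfIso_inv_homologyπ, Category.assoc,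
      HomologicalComplex.homologyπ_naturality, ← Category.assoc]
    congr 1
    rw [← cancel_mono (K.iCycles n), Category.assoc, HomologicalComplex.cyclesMap_i,
      HomologicalComplex.singleObjCyclesSelfIso_inv_iCycles_assoc,
      HomologicalComplex.mkHomFromSingle_f, Iso.inv_hom_id_assoc]
  refine ⟨((singleFunctorIsoCompQ C n).app P).hom ≫ Q.map φ ≫ (Q.objObjPreimageIso Y).hom, ?_⟩
  intro h
  have hQ : Q.map φ = 0 := by
    have h₁ := (cancel_epi ((singleFunctorIsoCompQ C n).app P).hom).1 (h.trans comp_zero.symm)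
    exact (cancel_mono (Q.objObjPreimageIso Y).hom).1 (h₁.trans zero_comp.symm)
  have h0 : HomologicalComplex.homologyMap φ n = 0 := by
    have := homologyFunctorFactors_hom_naturality φ n
    rw [hQ, Functor.map_zero, zero_comp] at this
    exact (cancel_epi ((homologyFunctorFactors C n).hom.app _)).1 (this.symm.trans comp_zero.symm)
  rw [h0, comp_zero] at hφ
  exact hf (by rw [← cancel_mono e.hom, ← hφ, zero_comp])

end Devissage

/-! ### The Nakayama dual of a finitely generated projective module -/

section Nakayama

variable (k : Type t) [Field k] {R : Type v} [Ring R] [Algebra k R]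
  (P : Type v) [AddCommGroup P] [Module R P] (K : Type v) [AddCommGroup K] [Module k K]

/-- The Nakayama dual `Hom_k(Hom_R(P, R), K)` of an `R`-module `P`. Here `K` is a copy of `k` in
the universe of `R`. -/
def NakayamaDual : Type v := (P →ₗ[R] R) →ₗ[k] K

instance : AddCommGroup (NakayamaDual k (R := R) P K) :=
  inferInstanceAs (AddCommGroup ((P →ₗ[R] R) →ₗ[k] K))

instance : FunLike (NakayamaDual k (R := R) P K) (P →ₗ[R] R) K :=
  inferInstanceAs (FunLike ((P →ₗ[R] R) →ₗ[k] K) (P →ₗ[R] R) K)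

variable {k P K}

@[ext]
lemma NakayamaDual.ext {φ ψ : NakayamaDual k (R := R) P K} (h : ∀ f, φ f = ψ f) : φ = ψ :=
  LinearMap.ext h

/-- The right multiplication of a form on `P` by an element of `R`. -/
def formMul (f : P →ₗ[R] R) (r : R) : P →ₗ[R] R := LinearMap.toSpanSingleton R R r ∘ₗ f

@[simp]
lemma formMul_apply (f : P →ₗ[R] R) (r : R) (x : P) : formMul f r x = f x * r := rfl

instance : Module R (NakayamaDual k (R := R) P K) where
  smul r φ :=
    { toFun := fun f => φ (formMul f r)
      map_add' := fun f g => by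
        refine Eq.trans (congrArg φ ?_) (LinearMap.map_add φ _ _)
        ext
        simp [add_mul]
      map_smul' := fun c f => by
        refine Eq.trans (congrArg φ ?_) (LinearMap.map_smul φ _ _)
        ext
        simp }
  one_smul φ := LinearMap.ext fun f => congrArg φ (by ext; simp)
  mul_smul r s φ := LinearMap.ext fun f => congrArg φ (by ext; simp [mul_assoc])
  smul_zero r := rfl
  smul_add r φ ψ := rfl
  add_smul r s φ := LinearMap.ext fun f => by
    refine Eq.trans (congrArg φ ?_) (LinearMap.map_add φ _ _)
    ext
    simp [mul_add]
  zero_smul φ := LinearMap.ext fun f => by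
    refine Eq.trans (congrArg φ ?_) (LinearMap.map_zero φ)
    ext
    simp

end Nakayama

section NakayamaDuality

variable {k : Type t} [Field k] {R : Type v} [Ring R] [Algebra k R] {P : ModuleCat.{v} R}
  {K : Type v} [AddCommGroup K] [Module k K] (e : K ≃ₗ[k] k)
  {n : ℕ} (p : Fin n → P) (f : Fin n → (P →ₗ[R] R))

/-- The trace `Hom_R(P, νP) → k` computed with a dual basis of `P`. -/
def nakayamaTrace : (P ⟶ ModuleCat.of R (NakayamaDual k (R := R) P K)) →ₗ[k] k where
  toFun h := e (∑ i, (h.hom (p i) : NakayamaDual k (R := R) P K) (f i))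
  map_add' h h' := by
    rw [← map_add, ← Finset.sum_add_distrib]
    rfl
  map_smul' c h := by
    rw [RingHom.id_apply, ← map_smul, Finset.smul_sum]
    congr 1
    refine Finset.sum_congr rfl fun i _ => ?_
    let ψ : NakayamaDual k (R := R) P K := h.hom (p i)
    refine Eq.trans (congrArg ψ ?_) (LinearMap.map_smul ψ c (f i))
    ext x
    simp [Algebra.smul_def, Algebra.commutes c (f i x)]

variable {p f} (hpf : ∀ x, ∑ i, f i x • p i = x)

include hpf in
/-- For a finitely generated projective module `P`, the trace induces a perfect pairing between
`Hom(M, νP)` and `Hom(P, M)`. -/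
lemma tracePairing_nakayamaTrace_bijective (M : ModuleCat.{v} R) :
    Function.Bijective (tracePairing (nakayamaTrace e p f) M) := by
  -- the rank one map `x ↦ g x • m`
  let rk (g : P →ₗ[R] R) (m : M) : P ⟶ M := ModuleCat.ofHom (LinearMap.toSpanSingleton R M m ∘ₗ g)
  have hrk (g : P →ₗ[R] R) (m : M) (x : P) : (rk g m).hom x = g x • m := rfl
  have key (u : M ⟶ ModuleCat.of R (NakayamaDual k (R := R) P K)) (g : P →ₗ[R] R) (m : M) :
      nakayamaTrace e p f (rk g m ≫ u) = e ((u.hom m : NakayamaDual k (R := R) P K) g) := by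
    change e (∑ i, (u.hom (g (p i) • m) : NakayamaDual k (R := R) P K) (f i)) = _
    congr 1
    simp only [map_smul]
    let ψ : NakayamaDual k (R := R) P K := u.hom m
    refine (map_sum (show (P →ₗ[R] R) →ₗ[k] K from ψ) _ _).symm.trans (congrArg ψ ?_)
    ext x
    simp only [LinearMap.sum_apply, formMul_apply]
    conv_rhs => rw [← hpf x]
    simp
  constructor
  · rw [injective_iff_map_eq_zero]
    intro u hu
    ext m g
    refine e.injective ?_
    rw [← key u g m]
    exact (LinearMap.congr_fun hu (rk g m)).trans (map_zero e).symm
  · intro θ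
    let u (m : M) : NakayamaDual k (R := R) P K :=
      { toFun := fun g => e.symm (θ (rk g m))
        map_add' := fun g g' => by
          rw [← map_add, ← map_add]
          congr 2
          ext x
          simp [hrk, add_smul]
        map_smul' := fun c g => by
          rw [RingHom.id_apply, ← map_smul, ← map_smul]
          congr 2
          ext x
          change (c • g x) • m = algebraMap k R c • (g x • m)
          rw [smul_smul, Algebra.smul_def] }
    refine ⟨ModuleCat.ofHom
      { toFun := u
        map_add' := fun m m' => NakayamaDual.ext fun g => ?_
        map_smul' := fun r m => NakayamaDual.ext fun g => ?_ }, ?_⟩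
    · change e.symm (θ (rk g (m + m'))) = e.symm (θ (rk g m)) + e.symm (θ (rk g m'))
      rw [← map_add, ← map_add]
      congr 2
      ext x
      simp [hrk]
    · change e.symm (θ (rk g (r • m))) = e.symm (θ (rk (formMul g r) m))
      congr 2
      ext x
      simp [hrk, mul_smul]
    · ext g
      change e (∑ i, e.symm (θ (rk (f i) (g.hom (p i))))) = θ g
      rw [map_sum]
      simp only [LinearEquiv.apply_symm_apply]
      rw [← map_sum]
      congr 1
      ext x
      rw [ModuleCat.hom_sum, LinearMap.sum_apply]
      simp only [hrk]
      conv_rhs => rw [← hpf x]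
      simp

/-- If `Hom(-, I)` is the dual of a functor `Hom(P, -)`, then `I` is injective. -/
lemma injective_of_tracePairing_bijective {P I : ModuleCat.{v} R} (s : (P ⟶ I) →ₗ[k] k)
    (hs : ∀ M : ModuleCat.{v} R, Function.Bijective (tracePairing s M)) : Injective I where
  factors {M N} u i hi := by
    obtain ⟨θ, hθ⟩ := exists_dual_comp_eq (Linear.rightComp k P i) (tracePairing s M u)
      (fun x hx => by
        have : x = 0 := by rwa [← cancel_mono i, zero_comp]
        rw [this, map_zero])
    obtain ⟨v, hv⟩ := (hs N).2 θ
    refine ⟨v, (hs M).1 ?_⟩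
    ext x
    have h₁ := hθ x
    rw [← hv] at h₁
    simpa using h₁

include hpf in
lemma projective_of_dualBasis : Projective P := by
  have : Module.Projective R P :=
    Module.Projective.of_split (LinearMap.pi f) (Fintype.linearCombination R p) (by
      ext x
      simpa [Fintype.linearCombination_apply] using hpf x)
  infer_instance

include hpf in
/-- A finitely generated projective module over a nonzero algebra has a Serre dual in the bounded
derived category. -/
lemma exists_isSerrePair_of_dualBasis [Nontrivial R] [HasDerivedCategory.{w} (ModuleCat.{v} R)] :
    ∃ Y, boundedObjects (ModuleCat.{v} R) Y ∧ IsSerrePair k (boundedObjects (ModuleCat.{v} R))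
      ((DerivedCategory.singleFunctor (ModuleCat.{v} R) 0).obj P) Y := by
  have : Small.{v} k := small_of_injective (algebraMap k R).injective
  let e : Shrink.{v} k ≃ₗ[k] k := Shrink.linearEquiv k k
  have hb := tracePairing_nakayamaTrace_bijective e hpf
  have : Injective (ModuleCat.of R (NakayamaDual k (R := R) P (Shrink.{v} k))) :=
    injective_of_tracePairing_bijective (nakayamaTrace e p f) hb
  have : Projective P := projective_of_dualBasis hpf
  exact ⟨_, bounded_singleFunctor_obj _ 0, isSerrePair_of_projective_injective _ hb⟩

end NakayamaDuality

/-! ### The radical and local endomorphism rings -/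

section Radical

variable {E : Type u} [Category.{v} E] [Preadditive E]

lemma isIso_id_sub_comp_swap {X Y : E} (a : X ⟶ Y) (b : Y ⟶ X) (h : IsIso (𝟙 X - a ≫ b)) :
    IsIso (𝟙 Y - b ≫ a) := by
  obtain ⟨c, hc₁, hc₂⟩ := h.out
  rw [Preadditive.sub_comp, Category.id_comp, sub_eq_iff_eq_add, Category.assoc] at hc₁
  rw [Preadditive.comp_sub, Category.comp_id, sub_eq_iff_eq_add] at hc₂
  refine ⟨𝟙 Y + b ≫ c ≫ a, ?_, ?_⟩
  · have : b ≫ c ≫ a = b ≫ a + b ≫ a ≫ b ≫ c ≫ a := by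
      conv_lhs => rw [hc₁]
      simp
    simp only [Preadditive.sub_comp, Preadditive.comp_add, Category.id_comp, Category.comp_id,
      Category.assoc]
    rw [sub_eq_of_eq_add this, sub_add_cancel]
  · have : b ≫ c ≫ a = b ≫ a + b ≫ c ≫ a ≫ b ≫ a := by
      conv_lhs => rw [hc₂]
      simp
    simp only [Preadditive.comp_sub, Preadditive.add_comp, Category.id_comp, Category.comp_id,
      Category.assoc]
    rw [sub_eq_iff_eq_add, ← this]

lemma inRadical_iff_left {X Y : E} (f : X ⟶ Y) :
    InRadical f ↔ ∀ g : Y ⟶ X, IsIso (𝟙 Y - g ≫ f) :=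
  ⟨fun h g => isIso_id_sub_comp_swap _ _ (h g), fun h g => isIso_id_sub_comp_swap _ _ (h g)⟩

lemma InRadical.comp_right {X Y Z : E} {f : X ⟶ Y} (hf : InRadical f) (g : Y ⟶ Z) :
    InRadical (f ≫ g) := fun h => by
  rw [Category.assoc]
  exact hf _

lemma InRadical.comp_left {X Y Z : E} {g : Y ⟶ Z} (hg : InRadical g) (f : X ⟶ Y) :
    InRadical (f ≫ g) := by
  rw [inRadical_iff_left] at hg ⊢
  intro h
  rw [← Category.assoc]
  exact hg _

lemma inRadical_zero (X Y : E) : InRadical (0 : X ⟶ Y) := fun g => by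
  rw [zero_comp, sub_zero]
  infer_instance

lemma InRadical.add {X Y : E} {f g : X ⟶ Y} (hf : InRadical f) (hg : InRadical g) :
    InRadical (f + g) := fun h => by
  have := hf h
  have h₂ : IsIso (𝟙 X - (inv (𝟙 X - f ≫ h) ≫ g) ≫ h) := (hg.comp_left _) h
  have : 𝟙 X - (f + g) ≫ h =
      (𝟙 X - f ≫ h) ≫ (𝟙 X - (inv (𝟙 X - f ≫ h) ≫ g) ≫ h) := by
    rw [Preadditive.comp_sub, Category.comp_id, Category.assoc, IsIso.hom_inv_id_assoc,
      Preadditive.add_comp, sub_sub]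
  rw [this]
  infer_instance

lemma InRadical.neg {X Y : E} {f : X ⟶ Y} (hf : InRadical f) : InRadical (-f) := by
  have := hf.comp_right (-𝟙 Y)
  rwa [Preadditive.comp_neg, Category.comp_id] at this

lemma InRadical.sum {X Y : E} {ι : Type*} (s : Finset ι) {f : ι → (X ⟶ Y)}
    (h : ∀ i ∈ s, InRadical (f i)) : InRadical (∑ i ∈ s, f i) :=
  Finset.sum_induction f InRadical (fun _ _ => InRadical.add) (inRadical_zero X Y) h

lemma InRadical.isZero {X : E} (h : InRadical (𝟙 X)) : IsZero X := by
  have := h (𝟙 X)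
  rw [Category.comp_id, sub_self] at this
  rw [IsZero.iff_id_eq_zero, ← IsIso.hom_inv_id (0 : X ⟶ X), zero_comp]

lemma InRadical.isIso_id_add {X : E} {f : X ⟶ X} (h : InRadical f) : IsIso (𝟙 X + f) := by
  have := h (-𝟙 X)
  rwa [Preadditive.comp_neg, Category.comp_id, sub_neg_eq_add] at this

lemma not_isZero_of_isLocalRing {X : E} [IsLocalRing (End X)] : ¬ IsZero X := fun h =>
  zero_ne_one (α := End X) (h.eq_of_src _ _)

lemma isIso_or_isIso_id_sub {X : E} [IsLocalRing (End X)] (f : X ⟶ X) :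
    IsIso f ∨ IsIso (𝟙 X - f) := by
  have h : f + (𝟙 X - f) = 𝟙 X := add_sub_cancel f (𝟙 X)
  rw [← isUnit_iff_isIso, ← isUnit_iff_isIso]
  exact IsLocalRing.isUnit_or_isUnit_of_add_one (R := End X) h

lemma isLocalRing_of_isIso_or {X : E} (hX : ¬ IsZero X)
    (h : ∀ f : X ⟶ X, IsIso f ∨ IsIso (𝟙 X - f)) : IsLocalRing (End X) where
  exists_pair_ne := ⟨0, 1, fun h => hX ((IsZero.iff_id_eq_zero X).2 h.symm)⟩
  isUnit_or_isUnit_of_add_one {a b} hab := by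
    have key (f g : X ⟶ X) (hfg : f + g = 𝟙 X) : IsIso f ∨ IsIso g := by
      rw [eq_sub_of_add_eq' hfg]
      exact h f
    rw [isUnit_iff_isIso, isUnit_iff_isIso]
    exact key a b hab

/-- A morphism out of an object with local endomorphism ring is outside of the radical if and only
if it is a split monomorphism. -/
lemma not_inRadical_iff {X Y : E} [IsLocalRing (End X)] (f : X ⟶ Y) :
    ¬ InRadical f ↔ ∃ g : Y ⟶ X, f ≫ g = 𝟙 X := by
  constructor
  · intro h
    rw [InRadical, not_forall] at h
    obtain ⟨g, hg⟩ := h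
    have := (isIso_or_isIso_id_sub (f ≫ g)).resolve_right hg
    exact ⟨g ≫ inv (f ≫ g), by rw [← Category.assoc, IsIso.hom_inv_id]⟩
  · rintro ⟨g, hg⟩ h
    have := h.comp_right g
    rw [hg] at this
    exact not_isZero_of_isLocalRing this.isZero

/-- A morphism into an object with local endomorphism ring is outside of the radical if and only
if it is a split epimorphism. -/
lemma not_inRadical_iff' {X Y : E} [IsLocalRing (End Y)] (f : X ⟶ Y) :
    ¬ InRadical f ↔ ∃ g : Y ⟶ X, g ≫ f = 𝟙 Y := by
  constructor
  · intro h
    rw [inRadical_iff_left, not_forall] at h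
    obtain ⟨g, hg⟩ := h
    have := (isIso_or_isIso_id_sub (g ≫ f)).resolve_right hg
    exact ⟨inv (g ≫ f) ≫ g, by rw [Category.assoc, IsIso.inv_hom_id]⟩
  · rintro ⟨g, hg⟩ h
    have := h.comp_left g
    rw [hg] at this
    exact not_isZero_of_isLocalRing this.isZero

lemma isLocalRing_of_iso {X Y : E} (e : X ≅ Y) [IsLocalRing (End X)] : IsLocalRing (End Y) := by
  refine isLocalRing_of_isIso_or (fun h => not_isZero_of_isLocalRing (h.of_iso e)) fun f => ?_
  have e₁ : f = e.inv ≫ (e.hom ≫ f ≫ e.inv) ≫ e.hom := by simp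
  have e₂ : 𝟙 Y - f = e.inv ≫ (𝟙 X - e.hom ≫ f ≫ e.inv) ≫ e.hom := by simp
  refine (isIso_or_isIso_id_sub (e.hom ≫ f ≫ e.inv)).imp (fun h => ?_) (fun h => ?_)
  · rw [e₁]
    exact IsIso.comp_isIso' inferInstance (IsIso.comp_isIso' h inferInstance)
  · rw [e₂]
    exact IsIso.comp_isIso' inferInstance (IsIso.comp_isIso' h inferInstance)

/-- A retract between objects with local endomorphism rings is an isomorphism. -/
lemma isIso_of_comp_eq_id {X Y : E} [IsLocalRing (End Y)] (i : X ⟶ Y) (r : Y ⟶ X)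
    (h : i ≫ r = 𝟙 X) (hX : ¬ IsZero X) : IsIso i := by
  refine ⟨r, h, ?_⟩
  obtain hri | hri := isIso_or_isIso_id_sub (r ≫ i)
  · rw [← cancel_epi (r ≫ i), Category.assoc, ← Category.assoc i, h]
    simp
  · exfalso
    have h0 : (𝟙 Y - r ≫ i) ≫ r = 0 := by simp [h]
    have : r = 0 := by rwa [← cancel_epi (𝟙 Y - r ≫ i), comp_zero]
    exact hX ((IsZero.iff_id_eq_zero X).2 (by rw [← h, this, comp_zero]))

section

variable [HasFiniteBiproducts E]

lemma exists_sum_eq_id_of_addOf {F X : E} (h : addOf F X) :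
    ∃ (n : ℕ) (a : Fin n → (X ⟶ F)) (b : Fin n → (F ⟶ X)), ∑ l, a l ≫ b l = 𝟙 X := by
  obtain ⟨n, ⟨ρ⟩⟩ := h
  refine ⟨n, fun l => ρ.i ≫ biproduct.π (fun _ => F) l,
    fun l => biproduct.ι (fun _ => F) l ≫ ρ.r, ?_⟩
  have := ρ.i ≫= (biproduct.total (f := fun _ : Fin n => F)) =≫ ρ.r
  simp only [Preadditive.comp_sum, Preadditive.sum_comp] at this
  simpa using this

lemma addOf_of_retract {F X Y : E} (h : addOf F Y) (ρ : Retract X Y) : addOf F X :=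
  let ⟨n, ⟨ρ'⟩⟩ := h
  ⟨n, ⟨ρ.trans ρ'⟩⟩

lemma addOf_self (F : E) : addOf F F :=
  ⟨1, ⟨{ i := biproduct.ι (fun _ : Fin 1 => F) 0, r := biproduct.π (fun _ : Fin 1 => F) 0 }⟩⟩

end

section

variable [HasBinaryBiproducts E]

lemma indecomposable_of_isLocalRing {X : E} [IsLocalRing (End X)] : Indecomposable X := by
  refine ⟨not_isZero_of_isLocalRing, fun Y Z e => ?_⟩
  by_contra! h
  have := isIso_of_comp_eq_id (biprod.inl ≫ e.inv) (e.hom ≫ biprod.fst) (by simp) h.1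
  have h0 : (biprod.inr ≫ e.inv) ≫ e.hom ≫ (biprod.fst : Y ⊞ Z ⟶ Y) = 0 := by simp
  have h1 : e.hom ≫ (biprod.fst : Y ⊞ Z ⟶ Y) = inv (biprod.inl ≫ e.inv) := by
    rw [← cancel_epi (biprod.inl ≫ e.inv)]
    simp
  rw [h1] at h0
  have h2 : (biprod.inr : Z ⟶ Y ⊞ Z) = 0 := by
    rw [← cancel_mono e.inv, zero_comp, ← cancel_mono (inv (biprod.inl ≫ e.inv)), h0, zero_comp]
  exact h.2 ((IsZero.iff_id_eq_zero Z).2 (by rw [← biprod.inr_snd (X := Y), h2, zero_comp]))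

/-- In an idempotent complete category, a nonzero retract of an indecomposable object is the whole
object. -/
lemma iso_of_retract_of_indecomposable [IsIdempotentComplete E] {X Y : E} (hX : Indecomposable X)
    (i : Y ⟶ X) (r : X ⟶ Y) (h : i ≫ r = 𝟙 Y) (hY : ¬ IsZero Y) : Nonempty (X ≅ Y) := by
  obtain ⟨Z, j, s, hj, hs⟩ := IsIdempotentComplete.idempotents_split X (𝟙 X - r ≫ i) (by
    simp only [Preadditive.comp_sub, Preadditive.sub_comp, Category.id_comp, Category.comp_id,
      Category.assoc]
    rw [← Category.assoc i, h]
    simp)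
  have hir : j ≫ r = 0 := by
    have : (s ≫ j) ≫ r = 0 := by rw [hs]; simp [h]
    have := j ≫= this
    rwa [Category.assoc, ← Category.assoc, hj, Category.id_comp, comp_zero] at this
  have his : i ≫ s = 0 := by
    have : i ≫ (s ≫ j) = 0 := by rw [hs]; simp [← Category.assoc, h]
    have := this =≫ s
    rwa [Category.assoc, Category.assoc, hj, Category.comp_id, zero_comp] at this
  let e : X ≅ Y ⊞ Z :=
    { hom := biprod.lift r s
      inv := biprod.desc i j
      hom_inv_id := by rw [biprod.lift_desc, hs]; abel
      inv_hom_id := by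
        apply biprod.hom_ext' <;> apply biprod.hom_ext <;> simp [h, hj, hir, his] }
  have hZ := (hX.2 Y Z e).resolve_left hY
  have hsj : r ≫ i = 𝟙 X := by
    have : s ≫ j = 0 := by rw [hZ.eq_of_tgt s 0, zero_comp]
    rw [hs, sub_eq_zero] at this
    exact this.symm
  exact ⟨⟨r, i, hsj, h⟩⟩

variable [HasFiniteBiproducts E]

/-- An indecomposable object of a Krull-Schmidt subcategory has a local endomorphism ring. -/
lemma isLocalRing_of_indecomposable [IsIdempotentComplete E] {C : ObjectProperty E}
    (hC : IsKrullSchmidt C) {X : E} (hX : C X) (hX' : Indecomposable X) :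
    IsLocalRing (End X) := by
  obtain ⟨n, G, hG, ⟨e⟩⟩ := hC X hX
  cases n with
  | zero =>
    exfalso
    refine hX'.1 ((IsZero.iff_id_eq_zero X).2 ?_)
    rw [← e.hom_inv_id, ← Category.id_comp e.inv, ← biproduct.total]
    simp
  | succ n =>
    have := (hG 0).2
    obtain ⟨e'⟩ := iso_of_retract_of_indecomposable hX' (biproduct.ι G 0 ≫ e.inv)
      (e.hom ≫ biproduct.π G 0) (by simp) not_isZero_of_isLocalRing
    exact isLocalRing_of_iso e'.symm

end

end Radical

/-! ### The left end of an almost split sequence -/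

section AlmostSplit

variable {E : Type u} [Category.{v} E] [Preadditive E] {𝓔 : ExactStructure E}
  {C : ObjectProperty E} {d : ℕ} {K : ChainComplex E ℕ}

namespace IsAlmostSplit

variable (hK : IsAlmostSplit 𝓔 C d K)

include hK

/-- A family of morphisms commuting with the nonzero differentials is a chain map. -/
lemma exists_hom (f : ∀ i, K.X i ⟶ K.X i)
    (hf : ∀ i, i ≤ d → f (i + 1) ≫ K.d (i + 1) i = K.d (i + 1) i ≫ f i) :
    ∃ φ : K ⟶ K, ∀ i, φ.f i = f i :=
  ⟨{ f := f
     comm' := by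
      rintro i j rfl
      by_cases hj : j ≤ d
      · exact hf j hj
      · exact (hK.isZero (j + 1) (by omega)).eq_of_src _ _ }, fun _ => rfl⟩

/-- Endomorphisms of the right end lift to the sequence: the first step uses that radical morphisms
to the right end factor through the last map, the others the exactness of `Hom(C, -)`. -/
lemma exists_hom_of_left (ψ : K.X 0 ⟶ K.X 0) : ∃ φ : K ⟶ K, φ.f 0 = ψ := by
  have key (m : ℕ) : ∃ f : ∀ i, K.X i ⟶ K.X i, f 0 = ψ ∧
      ∀ i, i < m → f (i + 1) ≫ K.d (i + 1) i = K.d (i + 1) i ≫ f i := by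
    induction m with
    | zero => exact ⟨Function.update (fun _ => 0) 0 ψ, by simp, by simp⟩
    | succ m ih =>
      obtain ⟨f, hf₀, hf⟩ := ih
      obtain ⟨g, hg⟩ : ∃ g : K.X (m + 1) ⟶ K.X (m + 1),
          g ≫ K.d (m + 1) m = K.d (m + 1) m ≫ f m := by
        cases m with
        | zero =>
          exact (hK.sink _ (hK.mem 1) _).1 ((hK.radical 0 (Nat.zero_le d)).comp_right _)
        | succ m =>
          refine hK.exact_left _ (hK.mem _) m (K.d (m + 2) (m + 1) ≫ f (m + 1)) ?_
          rw [Category.assoc, hf m (by omega), K.d_comp_d_assoc, zero_comp]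
      refine ⟨Function.update f (m + 1) g, by simpa using hf₀, fun i hi => ?_⟩
      obtain rfl | hi := (Nat.lt_succ_iff.1 hi).eq_or_lt
      · simpa using hg
      · rw [Function.update_of_ne (by omega), Function.update_of_ne (by omega)]
        exact hf i hi
  obtain ⟨f, hf₀, hf⟩ := key (d + 1)
  obtain ⟨φ, hφ⟩ := hK.exists_hom f (fun i hi => hf i (by omega))
  exact ⟨φ, by rw [hφ, hf₀]⟩

/-- Endomorphisms of the left end extend to the sequence. -/
lemma exists_hom_of_right (ψ : K.X (d + 1) ⟶ K.X (d + 1)) : ∃ φ : K ⟶ K, φ.f (d + 1) = ψ := by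
  have key (m : ℕ) : ∀ j, j + m = d + 1 → ∃ f : ∀ i, K.X i ⟶ K.X i, f (d + 1) = ψ ∧
      ∀ i, j ≤ i → i ≤ d → f (i + 1) ≫ K.d (i + 1) i = K.d (i + 1) i ≫ f i := by
    induction m with
    | zero =>
      rintro j hj
      exact ⟨Function.update (fun _ => 0) (d + 1) ψ, by simp, fun i hi hi' => by omega⟩
    | succ m ih =>
      intro j hj
      obtain ⟨f, hf₀, hf⟩ := ih (j + 1) (by omega)
      obtain ⟨g, hg⟩ : ∃ g : K.X j ⟶ K.X j, K.d (j + 1) j ≫ g = f (j + 1) ≫ K.d (j + 1) j := by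
        obtain rfl | hjd := (show j ≤ d by omega).eq_or_lt
        · exact (hK.source _ (hK.mem j) _).1 ((hK.radical j le_rfl).comp_left _)
        · refine hK.exact_right _ (hK.mem j) j hjd _ ?_
          rw [← Category.assoc, ← hf (j + 1) le_rfl hjd, Category.assoc, K.d_comp_d, comp_zero]
      refine ⟨Function.update f j g, ?_, fun i hi hi' => ?_⟩
      · rw [Function.update_of_ne (by omega), hf₀]
      · obtain rfl | hi := hi.eq_or_lt
        · rw [Function.update_self, Function.update_of_ne (by omega), hg]
        · rw [Function.update_of_ne (by omega), Function.update_of_ne (by omega)]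
          exact hf i hi hi'
  obtain ⟨f, hf₀, hf⟩ := key (d + 1) 0 (by omega)
  obtain ⟨φ, hφ⟩ := hK.exists_hom f (fun i hi => hf i (Nat.zero_le i) hi)
  exact ⟨φ, by rw [hφ, hf₀]⟩

/-- A chain map which vanishes at the right end is null-homotopic away from the left end, hence is
radical at the left end. -/
lemma inRadical_of_zero_left (φ : K ⟶ K) (h : φ.f 0 = 0) : InRadical (φ.f (d + 1)) := by
  have key (j : ℕ) : ∃ s : K.X j ⟶ K.X (j + 1),
      (φ.f (j + 1) - K.d (j + 1) j ≫ s) ≫ K.d (j + 1) j = 0 := by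
    induction j with
    | zero => exact ⟨0, by simp [h]⟩
    | succ j ih =>
      obtain ⟨s, hs⟩ := ih
      obtain ⟨s', hs'⟩ := hK.exact_left _ (hK.mem _) j _ hs
      exact ⟨s', by simp [hs']⟩
  obtain ⟨s, hs⟩ := key d
  obtain ⟨s', hs'⟩ := hK.exact_left _ (hK.mem _) d _ hs
  rw [(hK.isZero (d + 2) (by omega)).eq_of_tgt s' 0, zero_comp, eq_comm, sub_eq_zero] at hs'
  rw [hs']
  exact (hK.radical d le_rfl).comp_right _

/-- A chain map which vanishes at the left end is radical at the right end. -/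
lemma inRadical_of_zero_right (φ : K ⟶ K) (h : φ.f (d + 1) = 0) : InRadical (φ.f 0) := by
  have key (m : ℕ) : ∀ j, j + m = d → ∃ s : K.X j ⟶ K.X (j + 1),
      K.d (j + 1) j ≫ (φ.f j - s ≫ K.d (j + 1) j) = 0 := by
    induction m with
    | zero =>
      rintro j rfl
      refine ⟨0, ?_⟩
      rw [zero_comp, sub_zero, ← φ.comm, h, zero_comp]
    | succ m ih =>
      intro j hj
      obtain ⟨s, hs⟩ := ih (j + 1) (by omega)
      obtain ⟨s', hs'⟩ := hK.exact_right _ (hK.mem _) j (by omega) _ hs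
      refine ⟨s', ?_⟩
      rw [Preadditive.comp_sub, ← Category.assoc, hs', Preadditive.sub_comp, Category.assoc,
        K.d_comp_d, comp_zero, sub_zero, φ.comm, sub_self]
  obtain ⟨s, hs⟩ := key d 0 (by omega)
  have := hK.mono_right _ (hK.mem 0) _ hs
  rw [sub_eq_zero] at this
  rw [this]
  exact (hK.radical 0 (Nat.zero_le d)).comp_left _

/-- Lifts of mutually inverse endomorphisms of the right end are, at the left end, mutually inverse
up to radical endomorphisms. -/
lemma isIso_f_of_isIso_f_zero (φ : K ⟶ K) (h : IsIso (φ.f 0)) : IsIso (φ.f (d + 1)) := by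
  obtain ⟨ψ, hψ⟩ := hK.exists_hom_of_left (inv (φ.f 0))
  have h₁ := hK.inRadical_of_zero_left (φ ≫ ψ - 𝟙 K) (by simp [hψ])
  have h₂ := hK.inRadical_of_zero_left (ψ ≫ φ - 𝟙 K) (by simp [hψ])
  have h₁ : IsIso (φ.f (d + 1) ≫ ψ.f (d + 1)) := by
    have := h₁.isIso_id_add
    simpa using this
  have h₂ : IsIso (ψ.f (d + 1) ≫ φ.f (d + 1)) := by
    have := h₂.isIso_id_add
    simpa using this
  have : IsSplitMono (φ.f (d + 1)) :=
    ⟨⟨ψ.f (d + 1) ≫ inv (φ.f (d + 1) ≫ ψ.f (d + 1)), by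
      rw [← Category.assoc, IsIso.hom_inv_id]⟩⟩
  have : Epi (φ.f (d + 1)) := epi_of_epi (ψ.f (d + 1)) _
  exact isIso_of_epi_of_isSplitMono _

/-- If the right end of an almost split sequence has a local endomorphism ring, then so does the
left end. -/
lemma isLocalRing_left [IsLocalRing (End (K.X 0))] : IsLocalRing (End (K.X (d + 1))) := by
  refine isLocalRing_of_isIso_or (fun h => ?_) fun f => ?_
  · exact not_isZero_of_isLocalRing
      (hK.inRadical_of_zero_right (𝟙 K) (h.eq_of_src _ _)).isZero
  · obtain ⟨φ, rfl⟩ := hK.exists_hom_of_right f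
    refine (isIso_or_isIso_id_sub (φ.f 0)).imp (hK.isIso_f_of_isIso_f_zero φ) fun h => ?_
    exact hK.isIso_f_of_isIso_f_zero (𝟙 K - φ) (by simpa using h)

/-- Morphisms from the left end to an injective object extend along the first map. -/
lemma exists_extension {I : E} (hI : 𝓔.IsInjective I) (h : K.X (d + 1) ⟶ I) :
    ∃ h' : K.X d ⟶ I, K.d (d + 1) d ≫ h' = h := by
  obtain ⟨Z, i, p, w, hi, hpi, hc⟩ := hK.exact
  have hZ : IsZero (Z (d + 1)) := by
    obtain ⟨hl⟩ := 𝓔.isCokernel _ (hc (d + 1))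
    have : Epi (p (d + 1)) := epi_of_isColimit_cofork hl
    exact IsZero.of_epi (p (d + 1)) (hK.isZero (d + 2) (by omega))
  obtain ⟨q, hq⟩ : ∃ q : Z d ⟶ I, p d ≫ q = h := by
    obtain ⟨hl⟩ := 𝓔.isCokernel _ (hc d)
    exact ⟨hl.desc (CokernelCofork.ofπ h (hZ.eq_of_src _ _)),
      hl.fac _ WalkingParallelPair.one⟩
  obtain ⟨h', hh'⟩ : ∃ h' : K.X d ⟶ I, i d ≫ h' = q := by
    cases d with
    | zero => exact ⟨inv (i 0) ≫ q, by simp⟩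
    | succ d => exact hI (i (d + 1)) ⟨_, _, _, hc d⟩ q
  exact ⟨h', by rw [← hpi, Category.assoc, hh', hq]⟩

lemma inRadical_of_isInjective {I : E} (hI : 𝓔.IsInjective I) (hI' : C I)
    (h : K.X (d + 1) ⟶ I) : InRadical h :=
  (hK.source I hI' h).2 (hK.exists_extension hI h)

end IsAlmostSplit

end AlmostSplit

/-! ### The modules `Hom(F, G)` -/

section HomModule

variable {E : Type u} [Category.{v} E] [Preadditive E]

/-- The right `End F`-module `Hom(F, G)`. -/
abbrev homModule (F G : E) : ModuleCat.{v} (End F)ᵐᵒᵖ := ModuleCat.of (End F)ᵐᵒᵖ (F ⟶ G)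

/-- The morphism `Hom(F, G) ⟶ Hom(F, G')` given by the composition with `g : G ⟶ G'`. -/
def homModuleMap (F : E) {G G' : E} (g : G ⟶ G') : homModule F G ⟶ homModule F G' :=
  ModuleCat.ofHom
    { toFun := fun x : F ⟶ G => x ≫ g
      map_add' := fun _ _ => Preadditive.add_comp _ _ _ _ _ _
      map_smul' := fun _ _ => Category.assoc _ _ _ }

lemma homModuleMap_comp (F : E) {G G' G'' : E} (g : G ⟶ G') (g' : G' ⟶ G'') :
    homModuleMap F (g ≫ g') = homModuleMap F g ≫ homModuleMap F g' := by
  ext x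
  exact (Category.assoc _ _ _).symm

lemma homModuleMap_zero (F G G' : E) : homModuleMap F (0 : G ⟶ G') = 0 := by
  ext x
  exact comp_zero

/-- The morphism `Hom(F, G) ⟶ N` which sends `x` to `(x ≫ q) • m`. -/
def evalMap {F G : E} (q : G ⟶ F) {N : ModuleCat.{v} (End F)ᵐᵒᵖ} (m : N) : homModule F G ⟶ N :=
  ModuleCat.ofHom
    { toFun := fun x : F ⟶ G => MulOpposite.op (show End F from x ≫ q) • m
      map_add' := fun x y => by
        rw [← add_smul]
        exact congrArg (· • m) (congrArg MulOpposite.op (Preadditive.add_comp _ _ _ x y q))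
      map_smul' := fun r x => by
        rw [RingHom.id_apply, smul_smul]
        exact congrArg (· • m) (congrArg MulOpposite.op (Category.assoc r.unop x q)) }

lemma evalMap_hom_apply {F G : E} (q : G ⟶ F) {N : ModuleCat.{v} (End F)ᵐᵒᵖ} (m : N) (x : F ⟶ G) :
    (evalMap q m).hom x = MulOpposite.op (show End F from x ≫ q) • m := rfl

lemma op_smul_hom {F G : E} (a : F ⟶ F) (x : F ⟶ G) :
    MulOpposite.op (show End F from a) • x = a ≫ x := rfl

/-- The linear form on `Hom(F, G)` defined by a morphism `a : G ⟶ F`. -/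
def homForm {F G : E} (a : G ⟶ F) : (F ⟶ G) →ₗ[(End F)ᵐᵒᵖ] (End F)ᵐᵒᵖ where
  toFun x := MulOpposite.op (show End F from x ≫ a)
  map_add' x y := congrArg MulOpposite.op (Preadditive.add_comp _ _ _ x y a)
  map_smul' r x := congrArg MulOpposite.op (Category.assoc r.unop x a)

section

variable {F G : E} {n : ℕ} {a : Fin n → (G ⟶ F)} {b : Fin n → (F ⟶ G)}
  (hab : ∑ l, a l ≫ b l = 𝟙 G)

include hab

/-- A factorization of `𝟙 G` through a power of `F` is a dual basis of `Hom(F, G)`. -/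
lemma sum_homForm_smul (x : F ⟶ G) : ∑ l, homForm (a l) x • b l = x := by
  have := x ≫= hab
  rw [Preadditive.comp_sum, Category.comp_id] at this
  conv_rhs => rw [← this]
  exact Finset.sum_congr rfl fun l _ => Category.assoc _ _ _

lemma hom_apply_eq_sum {N : ModuleCat.{v} (End F)ᵐᵒᵖ} (T : homModule F G ⟶ N) (x : F ⟶ G) :
    T.hom x = ∑ l, homForm (a l) x • T.hom (b l) := by
  conv_lhs => rw [← sum_homForm_smul hab x]
  rw [map_sum]
  exact Finset.sum_congr rfl fun l _ => map_smul _ _ _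

end

section

variable [HasFiniteBiproducts E]

lemma projective_homModule {F G : E} (hG : addOf F G) : Projective (homModule F G) := by
  obtain ⟨n, a, b, hab⟩ := exists_sum_eq_id_of_addOf hG
  exact projective_of_dualBasis (p := b) (f := fun l => homForm (a l)) (sum_homForm_smul hab)

/-- The functor `Hom(F, -)` is full on `add F`. -/
lemma exists_homModuleMap_eq {F G G' : E} (hG : addOf F G) (T : homModule F G ⟶ homModule F G') :
    ∃ g : G ⟶ G', homModuleMap F g = T := by
  obtain ⟨n, a, b, hab⟩ := exists_sum_eq_id_of_addOf hG
  let y (l : Fin n) : F ⟶ G' := T.hom (b l)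
  refine ⟨∑ l, a l ≫ y l, ?_⟩
  ext x
  refine Eq.trans ?_ (hom_apply_eq_sum hab T x).symm
  change (x : F ⟶ G) ≫ _ = _
  rw [Preadditive.comp_sum]
  exact Finset.sum_congr rfl fun l _ => (Category.assoc _ _ _).symm

/-- The functor `Hom(F, -)` is faithful on `add F`. -/
lemma eq_zero_of_homModuleMap {F G G' : E} (hG : addOf F G) {g : G ⟶ G'}
    (h : homModuleMap F g = 0) : g = 0 := by
  obtain ⟨n, a, b, hab⟩ := exists_sum_eq_id_of_addOf hG
  have := hab =≫ g
  rw [Category.id_comp, Preadditive.sum_comp] at this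
  rw [← this]
  refine Finset.sum_eq_zero fun l _ => ?_
  have h' : b l ≫ g = 0 := congrArg (fun T => ModuleCat.Hom.hom T (b l)) h
  rw [Category.assoc, h', comp_zero]

end

end HomModule

/-! ### The tops of the modules `Hom(F, G)` -/

section TopModule

variable {E : Type u} [Category.{v} E] [Preadditive E]

/-- The submodule of radical morphisms. -/
def radicalSubmodule (F G : E) : Submodule (End F)ᵐᵒᵖ (F ⟶ G) where
  carrier := {x | InRadical x}
  add_mem' := InRadical.add
  zero_mem' := inRadical_zero F G
  smul_mem' a _ hx := hx.comp_left a.unop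

lemma mem_radicalSubmodule {F G : E} {x : F ⟶ G} : x ∈ radicalSubmodule F G ↔ InRadical x :=
  Iff.rfl

lemma le_radicalSubmodule {F G : E} [IsLocalRing (End G)] (N : Submodule (End F)ᵐᵒᵖ (F ⟶ G))
    (hN : N ≠ ⊤) : N ≤ radicalSubmodule F G := by
  intro x hx
  by_contra h
  obtain ⟨s, hs⟩ := (not_inRadical_iff' x).1 h
  refine hN (eq_top_iff.2 fun y _ => ?_)
  have := N.smul_mem (MulOpposite.op (show End F from y ≫ s)) hx
  rw [op_smul_hom] at this
  change (y ≫ s) ≫ x ∈ N at this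
  rwa [Category.assoc, hs, Category.comp_id] at this

/-- The projection of `Hom(F, G)` onto its top. -/
noncomputable def toTop (F G : E) : homModule F G ⟶ topHom F G :=
  ModuleCat.ofHom (Submodule.mkQ _)

lemma toTop_surjective (F G : E) : Function.Surjective (toTop F G).hom :=
  Submodule.mkQ_surjective _

instance (F G : E) : Epi (toTop F G) :=
  (ModuleCat.epi_iff_surjective _).2 (toTop_surjective F G)

lemma sum_evalMap_apply {F : E} {n : ℕ} {G : Fin n → E} {p : ∀ l, F ⟶ G l} {q : ∀ l, G l ⟶ F}
    (h : ∑ l, p l ≫ q l = 𝟙 F) {N : ModuleCat.{v} (End F)ᵐᵒᵖ} (m : N) :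
    ∑ l, (evalMap (q l) m).hom (p l) = m := by
  change ∑ l, MulOpposite.op (show End F from p l ≫ q l) • m = m
  rw [← Finset.sum_smul, ← Finset.op_sum]
  refine Eq.trans (congrArg (fun z : F ⟶ F => MulOpposite.op (show End F from z) • m) h) ?_
  exact one_smul _ m

variable [HasFiniteBiproducts E]

lemma exists_not_inRadical {F G : E} (hG : addOf F G) [IsLocalRing (End G)] :
    ∃ x : F ⟶ G, ¬ InRadical x := by
  by_contra! h
  obtain ⟨n, a, b, hab⟩ := exists_sum_eq_id_of_addOf hG
  have := InRadical.sum Finset.univ fun l _ => (h (b l)).comp_left (a l)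
  rw [hab] at this
  exact not_isZero_of_isLocalRing this.isZero

lemma isCoatom_radicalSubmodule {F G : E} (hG : addOf F G) [IsLocalRing (End G)] :
    IsCoatom (radicalSubmodule F G) := by
  obtain ⟨x, hx⟩ := exists_not_inRadical hG
  refine ⟨fun h => hx (mem_radicalSubmodule.1 (h ▸ Submodule.mem_top)), fun N hN => ?_⟩
  by_contra h
  exact hN.not_ge (le_radicalSubmodule N h)

lemma jacobson_eq {F G : E} (hG : addOf F G) [IsLocalRing (End G)] :
    Module.jacobson (End F)ᵐᵒᵖ (F ⟶ G) = radicalSubmodule F G := by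
  refine le_antisymm (sInf_le (isCoatom_radicalSubmodule hG)) (le_sInf fun N hN => ?_)
  exact ((hN.le_iff_eq (isCoatom_radicalSubmodule hG).1).1 (le_radicalSubmodule N hN.1)).le

lemma toTop_hom_apply_eq_zero_iff {F G : E} (hG : addOf F G) [IsLocalRing (End G)] (x : F ⟶ G) :
    (toTop F G).hom x = 0 ↔ InRadical x := by
  rw [← mem_radicalSubmodule, ← jacobson_eq hG]
  exact Submodule.Quotient.mk_eq_zero _

lemma isSimpleModule_topHom {F G : E} (hG : addOf F G) [IsLocalRing (End G)] :
    IsSimpleModule (End F)ᵐᵒᵖ (topHom F G) := by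
  have := isCoatom_radicalSubmodule hG
  rw [← jacobson_eq hG] at this
  exact isSimpleModule_iff_isCoatom.2 this

/-- A simple quotient of `Hom(F, G)` is its top. -/
lemma iso_topHom_of_ne_zero {F G : E} (hG : addOf F G) [IsLocalRing (End G)]
    {N : ModuleCat.{v} (End F)ᵐᵒᵖ} [IsSimpleModule (End F)ᵐᵒᵖ N] (T : homModule F G ⟶ N)
    (hT : T ≠ 0) : Nonempty (N ≅ topHom F G) := by
  have hT' : T.hom ≠ 0 := fun h => hT (ModuleCat.hom_ext h)
  have hs := LinearMap.surjective_of_ne_zero hT'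
  have hk : LinearMap.ker T.hom = Module.jacobson (End F)ᵐᵒᵖ (F ⟶ G) := by
    rw [jacobson_eq hG]
    have h₁ : IsCoatom (LinearMap.ker T.hom) := LinearMap.isCoatom_ker_of_surjective hs
    exact ((h₁.le_iff_eq (isCoatom_radicalSubmodule hG).1).1
      (le_radicalSubmodule (LinearMap.ker T.hom) h₁.1)).symm
  exact ⟨((Submodule.quotEquivOfEq _ _ hk).symm.trans
    (T.hom.quotKerEquivOfSurjective hs)).symm.toModuleIso⟩

/-- The top of `Hom(F, G)` determines `G`. -/
lemma iso_of_topHom_iso {F G G' : E} (hG : addOf F G) (hG' : addOf F G') [IsLocalRing (End G)]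
    [IsLocalRing (End G')] (e : topHom F G ≅ topHom F G') : Nonempty (G ≅ G') := by
  have := projective_homModule hG
  obtain ⟨g, hg⟩ := exists_homModuleMap_eq hG
    (Projective.factorThru (toTop F G ≫ e.hom) (toTop F G'))
  have hg' : homModuleMap F g ≫ toTop F G' = toTop F G ≫ e.hom := by
    rw [hg, Projective.factorThru_comp]
  have : ¬ InRadical g := by
    intro h
    obtain ⟨x, hx⟩ := exists_not_inRadical hG
    refine hx ((toTop_hom_apply_eq_zero_iff hG x).1 ?_)
    have h₁ : (toTop F G').hom (x ≫ g) = e.hom.hom ((toTop F G).hom x) :=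
      congrArg (fun T => ModuleCat.Hom.hom T x) hg'
    rw [(toTop_hom_apply_eq_zero_iff hG' _).2 (h.comp_left x)] at h₁
    have h₂ := congrArg e.inv.hom h₁
    rw [map_zero] at h₂
    refine h₂.trans ?_ |>.symm
    exact congrArg (fun T => ModuleCat.Hom.hom T ((toTop F G).hom x)) e.hom_inv_id
  obtain ⟨h, hh⟩ := (not_inRadical_iff g).1 this
  have := isIso_of_comp_eq_id g h hh not_isZero_of_isLocalRing
  exact ⟨asIso g⟩

/-- A decomposition of `F` into objects with local endomorphism rings. -/
lemma exists_sum_eq_id_of_isKrullSchmidt {F : E} (h : IsKrullSchmidt (addOf F)) :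
    ∃ (n : ℕ) (G : Fin n → E) (p : ∀ l, F ⟶ G l) (q : ∀ l, G l ⟶ F),
      (∀ l, addOf F (G l) ∧ IsLocalRing (End (G l))) ∧ ∑ l, p l ≫ q l = 𝟙 F := by
  obtain ⟨n, G, hG, ⟨e⟩⟩ := h F (addOf_self F)
  refine ⟨n, G, fun l => e.hom ≫ biproduct.π G l, fun l => biproduct.ι G l ≫ e.inv, hG, ?_⟩
  have := e.hom ≫= (biproduct.total (f := G)) =≫ e.inv
  simp only [Preadditive.comp_sum, Preadditive.sum_comp] at this
  simpa using this

/-- Every nonzero element is moved to a nonzero element by a map from the module defined by an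
indecomposable summand of `F`. -/
lemma exists_evalMap_ne_zero {F : E} (h : IsKrullSchmidt (addOf F))
    {N : ModuleCat.{v} (End F)ᵐᵒᵖ} (m : N) (hm : m ≠ 0) :
    ∃ (G : E) (q : G ⟶ F), addOf F G ∧ IsLocalRing (End G) ∧ evalMap q m ≠ 0 := by
  obtain ⟨n, G, p, q, hG, hpq⟩ := exists_sum_eq_id_of_isKrullSchmidt h
  by_contra! h'
  refine hm ?_
  rw [← sum_evalMap_apply hpq m]
  exact Finset.sum_eq_zero fun l _ => by rw [h' (G l) (q l) (hG l).1 (hG l).2]; rfl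

variable (k : Type t) [Field k] [Linear k E]

/-- A module `N` is the top of `Hom(F, G₀)` if `Hom(Hom(F, G), N)` vanishes for the
indecomposable summands `G ≇ G₀` and is spanned by any of its nonzero elements for `G = G₀`. -/
lemma iso_topHom_of_hom {F : E} (h : IsKrullSchmidt (addOf F)) {N : ModuleCat.{v} (End F)ᵐᵒᵖ}
    [Nontrivial N] {G₀ : E} (hG₀ : addOf F G₀) [IsLocalRing (End G₀)]
    (h0 : ∀ G : E, addOf F G → IsLocalRing (End G) → IsEmpty (G ≅ G₀) →
      ∀ T : homModule F G ⟶ N, T = 0)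
    (h1 : ∀ T T' : homModule F G₀ ⟶ N, T ≠ 0 → ∃ c : k, T' = c • T) :
    Nonempty (N ≅ topHom F G₀) := by
  -- a nonzero map from any summand yields one from `G₀` with the same range
  have key (m : N) (hm : m ≠ 0) : ∃ T : homModule F G₀ ⟶ N, T ≠ 0 ∧
      LinearMap.range T.hom ≤ Submodule.span _ {m} := by
    obtain ⟨G, q, hG, hG', hT⟩ := exists_evalMap_ne_zero h m hm
    obtain ⟨e⟩ : Nonempty (G ≅ G₀) := by
      by_contra h'
      exact hT (h0 G hG hG' (not_nonempty_iff.1 h') _)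
    refine ⟨evalMap (e.inv ≫ q) m, fun h' => hT ?_, ?_⟩
    · ext x
      have : (evalMap (e.inv ≫ q) m).hom (x ≫ e.hom) = 0 := by rw [h']; rfl
      rw [evalMap_hom_apply] at this
      change MulOpposite.op (show End F from (x : F ⟶ G) ≫ q) • m = 0
      rw [← this]
      simp
    · rintro _ ⟨x, rfl⟩
      exact Submodule.smul_mem _ _ (Submodule.mem_span_singleton_self m)
  obtain ⟨m₀, hm₀⟩ := exists_ne (0 : N)
  obtain ⟨T, hT, -⟩ := key m₀ hm₀
  have hle (T' : homModule F G₀ ⟶ N) (hT' : T' ≠ 0) (T'' : homModule F G₀ ⟶ N) :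
      LinearMap.range T''.hom ≤ LinearMap.range T'.hom := by
    obtain ⟨c, rfl⟩ := h1 T' T'' hT'
    rintro _ ⟨x, rfl⟩
    exact ⟨(algebraMap k (End F)ᵐᵒᵖ c) • x, map_smul _ _ _⟩
  have htop : LinearMap.range T.hom = ⊤ := by
    refine eq_top_iff.2 fun m _ => ?_
    obtain ⟨n, G, p, q, hG, hpq⟩ := exists_sum_eq_id_of_isKrullSchmidt h
    rw [← sum_evalMap_apply hpq m]
    refine Submodule.sum_mem _ fun l _ => ?_
    by_cases hl : Nonempty (G l ≅ G₀)
    · obtain ⟨e⟩ := hl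
      refine hle T hT (homModuleMap F e.inv ≫ evalMap (q l) m) ⟨p l ≫ e.hom, ?_⟩
      change (evalMap (q l) m).hom ((p l ≫ e.hom) ≫ e.inv) = _
      simp
    · rw [h0 (G l) (hG l).1 (hG l).2 (not_nonempty_iff.1 hl) (evalMap (q l) m)]
      exact Submodule.zero_mem _
  have : IsSimpleModule (End F)ᵐᵒᵖ N := by
    rw [isSimpleModule_iff_toSpanSingleton_surjective]
    refine ⟨inferInstance, fun m hm => ?_⟩
    obtain ⟨T', hT', hr⟩ := key m hm
    have := (htop.symm.le.trans (hle T' hT' T)).trans hr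
    intro y
    obtain ⟨r, hr⟩ := Submodule.mem_span_singleton.1 (this (Submodule.mem_top (x := y)))
    exact ⟨r, hr⟩
  exact iso_topHom_of_ne_zero hG₀ T hT

end TopModule

/-! ### Modules over `A / AeA` -/

lemma finite_of_function_exact {k V₁ V₂ V₃ : Type*} [Field k] [AddCommGroup V₁] [Module k V₁]
    [AddCommGroup V₂] [Module k V₂] [AddCommGroup V₃] [Module k V₃] {f : V₁ →ₗ[k] V₂}
    {g : V₂ →ₗ[k] V₃} (h : Function.Exact f g) (h₁ : Module.Finite k V₁)
    (h₃ : Module.Finite k V₃) : Module.Finite k V₂ := by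
  have : Module.Finite k (V₂ ⧸ LinearMap.ker g) := Module.Finite.equiv g.quotKerEquivRange.symm
  have : Module.Finite k (LinearMap.ker g) := by
    rw [h.linearMap_ker_eq]
    infer_instance
  exact Module.Finite.of_submodule_quotient (LinearMap.ker g)

section QuotModule

variable {A : Type v} [Ring A] {e : A}

lemma isQuotModule_of_smul_eq_zero {M : ModuleCat.{v} Aᵐᵒᵖ}
    (h : ∀ m : M, MulOpposite.op e • m = 0) : IsQuotModule e M := by
  intro a ha
  induction ha using TwoSidedIdeal.span_induction with
  | mem x hx => rwa [Set.mem_singleton_iff.1 hx]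
  | zero => simp
  | add x y _ _ hx hy => intro m; rw [MulOpposite.op_add, add_smul, hx, hy, add_zero]
  | neg x _ hx => intro m; rw [MulOpposite.op_neg, neg_smul, hx, neg_zero]
  | left_absorb a x _ hx => intro m; rw [MulOpposite.op_mul, mul_smul, hx]
  | right_absorb b x _ hx => intro m; rw [MulOpposite.op_mul, mul_smul, hx, smul_zero]

lemma IsQuotModule.of_injective {M N : ModuleCat.{v} Aᵐᵒᵖ} (hN : IsQuotModule e N) (f : M ⟶ N)
    (hf : Function.Injective f.hom) : IsQuotModule e M := fun a ha m =>
  hf (by rw [map_smul, hN a ha, map_zero])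

lemma IsQuotModule.of_surjective {M N : ModuleCat.{v} Aᵐᵒᵖ} (hM : IsQuotModule e M) (f : M ⟶ N)
    (hf : Function.Surjective f.hom) : IsQuotModule e N := fun a ha n => by
  obtain ⟨m, rfl⟩ := hf n
  rw [← map_smul, hM a ha, map_zero]

lemma IsQuotModule.of_iso {M N : ModuleCat.{v} Aᵐᵒᵖ} (hM : IsQuotModule e M) (f : M ≅ N) :
    IsQuotModule e N :=
  hM.of_surjective f.hom f.toLinearEquiv.surjective

/-- Since `e` is idempotent, the `A / AeA`-modules are closed under extensions. -/
lemma IsQuotModule.of_exact (he : IsIdempotentElem e) {S : ShortComplex (ModuleCat.{v} Aᵐᵒᵖ)}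
    (hS : S.Exact) (h₁ : IsQuotModule e S.X₁) (h₃ : IsQuotModule e S.X₃) :
    IsQuotModule e S.X₂ := by
  have hmem : e ∈ TwoSidedIdeal.span {e} := TwoSidedIdeal.subset_span rfl
  refine isQuotModule_of_smul_eq_zero fun m => ?_
  obtain ⟨x, hx⟩ := (ShortComplex.ShortExact.moduleCat_exact_iff_function_exact S).1 hS
    (MulOpposite.op e • m) |>.1 (by rw [map_smul, h₃ e hmem])
  have : MulOpposite.op e • MulOpposite.op e • m = MulOpposite.op e • m := by
    rw [smul_smul, ← MulOpposite.op_mul, he.eq]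
  rw [← this, ← hx, ← map_smul, h₁ e hmem, map_zero]

variable (k : Type t) [Field k] [Algebra k A]

lemma module_finite_of_surjective {M N : ModuleCat.{v} Aᵐᵒᵖ} [Module.Finite k M] (f : M ⟶ N)
    (hf : Function.Surjective f.hom) : Module.Finite k N :=
  Module.Finite.of_surjective (f.hom.restrictScalars k) hf

lemma module_finite_of_exact {S : ShortComplex (ModuleCat.{v} Aᵐᵒᵖ)} (hS : S.Exact)
    [Module.Finite k S.X₁] [Module.Finite k S.X₃] : Module.Finite k S.X₂ := by
  have h := (ShortComplex.ShortExact.moduleCat_exact_iff_function_exact S).1 hS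
  exact finite_of_function_exact (f := S.f.hom.restrictScalars k) (g := S.g.hom.restrictScalars k)
    h inferInstance inferInstance

/-- Simple modules over a finite-dimensional algebra are finite-dimensional. -/
lemma module_finite_of_isSimpleModule [Module.Finite k (QuotAeA e)] {M : ModuleCat.{v} Aᵐᵒᵖ}
    (hM : IsQuotModule e M) [IsSimpleModule Aᵐᵒᵖ M] : Module.Finite k M := by
  have := IsSimpleModule.nontrivial Aᵐᵒᵖ M
  obtain ⟨m, hm⟩ := exists_ne (0 : M)
  let q : A →ₗ[k] QuotAeA e :=
    { toFun := fun a => (TwoSidedIdeal.span {e}).ringCon.mk' a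
      map_add' := fun _ _ => rfl
      map_smul' := fun _ _ => rfl }
  have hq : Function.Surjective q := Quotient.mk_surjective
  obtain ⟨s, hs⟩ := q.exists_rightInverse_of_surjective (LinearMap.range_eq_top.2 hq)
  let ev : A →ₗ[k] M :=
    { toFun := fun a => MulOpposite.op a • m
      map_add' := fun a b => by rw [MulOpposite.op_add, add_smul]
      map_smul' := fun c a => by rw [MulOpposite.op_smul, smul_assoc]; rfl }
  refine Module.Finite.of_surjective (ev ∘ₗ s) fun y => ?_
  obtain ⟨a, ha⟩ := IsSimpleModule.toSpanSingleton_surjective Aᵐᵒᵖ hm y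
  refine ⟨q a.unop, ?_⟩
  have hsa : q (s (q a.unop)) = q a.unop := LinearMap.congr_fun hs _
  have hmem : s (q a.unop) - a.unop ∈ TwoSidedIdeal.span {e} := by
    rw [← TwoSidedIdeal.rel_iff]
    exact Quotient.exact hsa
  have := hM _ hmem m
  rw [MulOpposite.op_sub, sub_smul, sub_eq_zero] at this
  exact this.trans ha

end QuotModule

section Summands

variable {E : Type u} [Category.{v} E] [Preadditive E]

section

variable [HasBinaryBiproducts E] {P F' : E}

lemma isIdempotentElem_idemP : IsIdempotentElem (idemP P F') := by
  change ((biprod.fst : P ⊞ F' ⟶ P) ≫ (biprod.inl : P ⟶ P ⊞ F')) ≫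
    ((biprod.fst : P ⊞ F' ⟶ P) ≫ (biprod.inl : P ⟶ P ⊞ F')) = biprod.fst ≫ biprod.inl
  simp

lemma comp_mem_span_idemP (a : P ⊞ F' ⟶ P) (b : P ⟶ P ⊞ F') :
    (show End (P ⊞ F') from a ≫ b) ∈ TwoSidedIdeal.span {idemP P F'} := by
  have h := TwoSidedIdeal.mul_mem_left _ (show End (P ⊞ F') from biprod.fst ≫ b) _
    (TwoSidedIdeal.mul_mem_right _ _ (show End (P ⊞ F') from a ≫ biprod.inl)
      (TwoSidedIdeal.subset_span (s := {idemP P F'}) rfl))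
  convert! h using 1
  change a ≫ b = ((a ≫ (biprod.inl : P ⟶ P ⊞ F')) ≫ (biprod.fst : P ⊞ F' ⟶ P) ≫
    (biprod.inl : P ⟶ P ⊞ F')) ≫ (biprod.fst : P ⊞ F' ⟶ P) ≫ b
  simp

end

variable [HasFiniteBiproducts E]

/-- If `Hom(F, G)` has a finite-dimensional top, then the endomorphisms of `G` are scalars up to the
radical, by Schur's lemma. -/
lemma exists_inRadical_sub_smul (k : Type t) [Field k] [IsAlgClosed k] [Linear k E] {F G : E}
    (hG : addOf F G) [IsLocalRing (End G)] {S : ModuleCat.{v} (End F)ᵐᵒᵖ} [Module.Finite k S]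
    (e : S ≅ topHom F G) (φ : G ⟶ G) : ∃ c : k, InRadical (φ - c • 𝟙 G) := by
  have := isSimpleModule_topHom hG
  have : IsSimpleModule (End F)ᵐᵒᵖ S := IsSimpleModule.congr e.toLinearEquiv
  let ψ : topHom F G ⟶ topHom F G := ModuleCat.ofHom (Submodule.mapQ _ _ (homModuleMap F φ).hom
    (Module.le_comap_jacobson _))
  let π : homModule F G ⟶ S := toTop F G ≫ e.inv
  have hπ (x : F ⟶ G) : π.hom x = 0 ↔ InRadical x := by
    rw [← toTop_hom_apply_eq_zero_iff hG]
    exact e.symm.toLinearEquiv.map_eq_zero_iff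
  obtain ⟨c, hc⟩ := (IsSimpleModule.algebraMap_end_bijective_of_isAlgClosed (A := (End F)ᵐᵒᵖ)
    (V := S) k).2 (e.hom ≫ ψ ≫ e.inv).hom
  refine ⟨c, ?_⟩
  have key (x : F ⟶ G) : InRadical (x ≫ (φ - c • 𝟙 G)) := by
    rw [← hπ]
    have h₁ : c • π.hom x = π.hom (x ≫ φ) := by
      refine (LinearMap.congr_fun hc (π.hom x)).trans ?_
      exact congrArg (fun y => e.inv.hom (ψ.hom y)) (e.symm.toLinearEquiv.symm_apply_apply _)
    have h₂ : c • π.hom x = π.hom ((c • 𝟙 F) ≫ x) :=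
      (π.hom.map_smul (algebraMap k (End F)ᵐᵒᵖ c) x).symm
    rw [Linear.smul_comp, Category.id_comp] at h₂
    rw [Preadditive.comp_sub, Linear.comp_smul, Category.comp_id]
    refine (π.hom.map_sub (x ≫ φ) (c • x)).trans ?_
    rw [sub_eq_zero]
    exact h₁.symm.trans h₂
  obtain ⟨n, a, b, hab⟩ := exists_sum_eq_id_of_addOf hG
  have := InRadical.sum Finset.univ fun l _ => (key (b l)).comp_left (a l)
  simp only [← Category.assoc] at this
  rwa [← Preadditive.sum_comp, hab, Category.id_comp] at this

variable [HasBinaryBiproducts E] {P F' : E}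

/-- A summand `G` of `F` with local endomorphism ring which is not a summand of `P` receives only
radical morphisms from `P`, so the idempotent `e` annihilates the top of `Hom(F, G)`. -/
lemma isQuotModule_topHom {G : E} (hG : addOf (P ⊞ F') G) [IsLocalRing (End G)]
    (hG' : ¬ addOf P G) : IsQuotModule (idemP P F') (topHom (P ⊞ F') G) := by
  refine isQuotModule_of_smul_eq_zero fun m => ?_
  obtain ⟨x, rfl⟩ := toTop_surjective _ _ m
  rw [← map_smul]
  refine (toTop_hom_apply_eq_zero_iff hG _).2 ?_
  change InRadical (((biprod.fst : P ⊞ F' ⟶ P) ≫ (biprod.inl : P ⟶ P ⊞ F')) ≫ (x : P ⊞ F' ⟶ G))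
  rw [Category.assoc]
  refine InRadical.comp_left ?_ _
  by_contra h
  obtain ⟨s, hs⟩ := (not_inRadical_iff' _).1 h
  exact hG' (addOf_of_retract (addOf_self P) ⟨s, _, hs⟩)

/-- Every simple `A / AeA`-module is the top of `Hom(F, G)` for a summand `G` of `F` with local
endomorphism ring; such a `G` is not a summand of `P`, since morphisms factoring through `P` act by
elements of `AeA`. -/
lemma exists_iso_topHom (h : IsKrullSchmidt (addOf (P ⊞ F')))
    {S : ModuleCat.{v} (End (P ⊞ F'))ᵐᵒᵖ} (hS : simpleQuotModules (idemP P F') S) :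
    ∃ G : E, addOf (P ⊞ F') G ∧ IsLocalRing (End G) ∧ ¬ addOf P G ∧
      Nonempty (S ≅ topHom (P ⊞ F') G) := by
  obtain ⟨hS₁, hS₂⟩ := hS
  have := IsSimpleModule.nontrivial (End (P ⊞ F'))ᵐᵒᵖ S
  obtain ⟨m, hm⟩ := exists_ne (0 : S)
  obtain ⟨G, q, hG, hG', hT⟩ := exists_evalMap_ne_zero h m hm
  refine ⟨G, hG, hG', fun hP => hT ?_, iso_topHom_of_ne_zero hG _ hT⟩
  obtain ⟨n, a, b, hab⟩ := exists_sum_eq_id_of_addOf hP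
  ext x
  have hx : (x : P ⊞ F' ⟶ G) ≫ q = ∑ l, (x ≫ a l) ≫ b l ≫ q := by
    have := x ≫= hab =≫ q
    simp only [Preadditive.comp_sum, Preadditive.sum_comp, Category.assoc,
      Category.id_comp] at this ⊢
    exact this.symm
  have hmem : (show End (P ⊞ F') from x ≫ q) ∈ TwoSidedIdeal.span {idemP P F'} := by
    rw [hx]
    exact sum_mem fun l _ => comp_mem_span_idemP _ _
  exact hS₁ _ hmem m

end Summands

/-! ### Projective resolutions in the derived category -/

/-- The isomorphism `Hom(X, Y⟦n⟧) ≃ Hom(X⟦a⟧, Y⟦m⟧)` if `n + a = m`. -/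
noncomputable def shiftHomEquiv (k : Type t) [Field k] {T : Type u} [Category.{v} T] [Preadditive T]
    [Linear k T] [HasShift T ℤ] [∀ n : ℤ, (shiftFunctor T n).Additive]
    [∀ n : ℤ, (shiftFunctor T n).Linear k] (X Y : T) (n a m : ℤ) (h : n + a = m) :
    (X ⟶ Y⟦n⟧) ≃ₗ[k] (X⟦a⟧ ⟶ Y⟦m⟧) :=
  (LinearEquiv.ofBijective ((shiftFunctor T a).mapLinearMap k (X := X) (Y := Y⟦n⟧))
    ⟨(shiftFunctor T a).map_injective, (shiftFunctor T a).map_surjective⟩).trans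
    (Linear.homCongr k (Iso.refl _) ((shiftFunctorAdd' T n a m h).symm.app Y))

lemma comp_shiftHomEquiv {k : Type t} [Field k] {T : Type u} [Category.{v} T] [Preadditive T]
    [Linear k T] [HasShift T ℤ] [∀ n : ℤ, (shiftFunctor T n).Additive]
    [∀ n : ℤ, (shiftFunctor T n).Linear k] {X X' Y : T} (n a m : ℤ) (h : n + a = m) (f : X ⟶ X')
    (g : X' ⟶ Y⟦n⟧) :
    shiftHomEquiv k X Y n a m h (f ≫ g) = f⟦a⟧' ≫ shiftHomEquiv k X' Y n a m h g := by
  have key {Z : T} (g : Z ⟶ Y⟦n⟧) : shiftHomEquiv k Z Y n a m h g =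
      g⟦a⟧' ≫ (shiftFunctorAdd' T n a m h).inv.app Y := by
    simp [shiftHomEquiv, Linear.homCongr_apply]
    rfl
  rw [key, key, Functor.map_comp, Category.assoc]

lemma hasProjectiveDimensionLT_of_resolution {C : Type u} [Category.{v} C] [Abelian C]
    {Ω M : ℕ → C} {ι : ∀ j, Ω (j + 1) ⟶ M j} {p : ∀ j, M j ⟶ Ω j} {w : ∀ j, ι j ≫ p j = 0}
    (hS : ∀ j, (ShortComplex.mk (ι j) (p j) (w j)).ShortExact) [∀ j, Projective (M j)] (N m : ℕ)
    (h : IsZero (Ω (m + N))) :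
    HasProjectiveDimensionLT (Ω m) N := by
  induction N generalizing m with
  | zero => exact h.hasProjectiveDimensionLT_zero
  | succ N ih =>
    have : HasProjectiveDimensionLT (ShortComplex.mk (ι m) (p m) (w m)).X₁ N :=
      ih (m + 1) (by rwa [show m + 1 + N = m + (N + 1) by omega])
    have : Projective (ShortComplex.mk (ι m) (p m) (w m)).X₂ := inferInstanceAs (Projective (M m))
    exact (hS m).hasProjectiveDimensionLT_X₃ N ‹_› (hasProjectiveDimensionLT_of_ge _ 1 _ (by omega))

section Resolution

open DerivedCategory Pretriangulated

variable {C : Type u} [Category.{v} C] [Abelian C] [HasDerivedCategory.{w} C]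
  {k : Type t} [Field k] [Linear k C]

/-- The isomorphism between `Hom(M, X)` in `C` and in the derived category. -/
noncomputable def singleHomEquiv (k : Type t) [Field k] [Linear k C] (M X : C) : (M ⟶ X) ≃ₗ[k]
    ((singleFunctor C 0).obj M ⟶ ((singleFunctor C 0).obj X)⟦(0 : ℤ)⟧) :=
  (LinearEquiv.ofBijective ((singleFunctor C 0).mapLinearMap k)
    ⟨(singleFunctor C 0).map_injective, (singleFunctor C 0).map_surjective⟩).trans
  (Linear.homCongr k (Iso.refl _) ((shiftFunctorZero _ ℤ).symm.app _))

lemma singleHomEquiv_apply {M X : C} (f : M ⟶ X) : singleHomEquiv k M X f =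
    (singleFunctor C 0).map f ≫ (shiftFunctorZero _ ℤ).inv.app _ := by
  simp [singleHomEquiv, Linear.homCongr_apply]
  rfl

/-- Dimension shifting along a short exact sequence with projective middle term. -/
lemma exists_surjective_of_shortExact {S : ShortComplex C} (hS : S.ShortExact) [Projective S.X₂]
    (X : C) (n m : ℤ) (hm : m ≠ 0) (h : n + 1 = m) :
    ∃ π : ((singleFunctor C 0).obj S.X₁ ⟶ ((singleFunctor C 0).obj X)⟦n⟧) →ₗ[k]
        ((singleFunctor C 0).obj S.X₃ ⟶ ((singleFunctor C 0).obj X)⟦m⟧),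
      Function.Surjective π ∧ ∀ h, π ((singleFunctor C 0).map S.f ≫ h) = 0 := by
  have hT := hS.singleTriangle_distinguished
  refine ⟨Linear.leftComp k _ hS.singleδ ∘ₗ (shiftHomEquiv k _ _ n 1 m h).toLinearMap, ?_, ?_⟩
  · intro f
    obtain ⟨g, hg⟩ : ∃ g : ((singleFunctor C 0).obj S.X₁)⟦(1 : ℤ)⟧ ⟶
        ((singleFunctor C 0).obj X)⟦m⟧, f = hS.singleδ ≫ g :=
      Triangle.yoneda_exact₃ _ hT f (hom_shift_eq_zero_of_projective S.X₂ X m hm _)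
    obtain ⟨g, rfl⟩ := (shiftHomEquiv k _ _ n 1 m h).surjective g
    exact ⟨g, hg.symm⟩
  · intro h'
    refine (congrArg (hS.singleδ ≫ ·) (comp_shiftHomEquiv n 1 m h _ h')).trans ?_
    have h0 : hS.singleδ ≫ ((singleFunctor C 0).map S.f)⟦(1 : ℤ)⟧' = 0 :=
      comp_distTriang_mor_zero₃₁ _ hT
    refine (Category.assoc _ _ _).symm.trans ?_
    rw [h0, zero_comp]

variable {Ω M : ℕ → C} {ι : ∀ j, Ω (j + 1) ⟶ M j} {p : ∀ j, M j ⟶ Ω j}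
  {w : ∀ j, ι j ≫ p j = 0} (hS : ∀ j, (ShortComplex.mk (ι j) (p j) (w j)).ShortExact)

include hS

section

variable [∀ j, Projective (M j)]

/-- `Ext^(N+1)(Ω₀, X)` is a quotient of `Hom(Ω_{N+1}, X)` by a subspace which contains the morphisms
extending to `M_N`. -/
lemma exists_surjective_of_resolution (X : C) (N i m : ℕ) (hN : m + i = N) (n : ℤ)
    (hn : (i : ℤ) + 1 = n) :
    ∃ π : (Ω (N + 1) ⟶ X) →ₗ[k]
        ((singleFunctor C 0).obj (Ω m) ⟶ ((singleFunctor C 0).obj X)⟦n⟧),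
      Function.Surjective π ∧ ∀ h, π (ι N ≫ h) = 0 := by
  induction i generalizing m n with
  | zero =>
    subst hN
    have : Projective (ShortComplex.mk (ι m) (p m) (w m)).X₂ := inferInstanceAs (Projective (M m))
    obtain ⟨π, hπ, hπ'⟩ := exists_surjective_of_shortExact (k := k) (hS m) X 0 n (by omega)
      (by simpa using hn)
    refine ⟨π ∘ₗ (singleHomEquiv k _ _).toLinearMap, hπ.comp (singleHomEquiv k _ _).surjective,
      fun h => ?_⟩
    refine (congrArg π ?_).trans (hπ' ((singleFunctor C 0).map h ≫
      (shiftFunctorZero _ ℤ).inv.app _))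
    refine (singleHomEquiv_apply _).trans ?_
    exact (congrArg (· ≫ (shiftFunctorZero _ ℤ).inv.app ((singleFunctor C 0).obj X))
      ((singleFunctor C 0).map_comp (ι m) h)).trans (Category.assoc _ _ _)
  | succ i ih =>
    obtain ⟨π, hπ, hπ'⟩ := ih (m + 1) (by omega) (n - 1) (by push_cast at hn; omega)
    have : Projective (ShortComplex.mk (ι m) (p m) (w m)).X₂ := inferInstanceAs (Projective (M m))
    obtain ⟨π₁, hπ₁, -⟩ := exists_surjective_of_shortExact (k := k) (hS m) X (n - 1) n (by omega)
      (by omega)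
    exact ⟨π₁ ∘ₗ π, hπ₁.comp hπ, fun h => by rw [LinearMap.comp_apply, hπ', map_zero]⟩

lemma finite_hom_shift_of_resolution (X : C) [∀ j, Module.Finite k (M j ⟶ X)] (n : ℤ) :
    Module.Finite k ((singleFunctor C 0).obj (Ω 0) ⟶ ((singleFunctor C 0).obj X)⟦n⟧) := by
  have hΩ (j : ℕ) : Module.Finite k (Ω j ⟶ X) := by
    refine Module.Finite.of_injective (Linear.leftComp k X (p j)) ?_
    rw [injective_iff_map_eq_zero]
    intro f hf
    have : Epi (p j) := (hS j).epi_g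
    exact (cancel_epi (p j)).1 (hf.trans comp_zero.symm)
  obtain hn | rfl | hn := lt_trichotomy n 0
  · have : Subsingleton ((singleFunctor C 0).obj (Ω 0) ⟶ ((singleFunctor C 0).obj X)⟦n⟧) :=
      ⟨fun f g => (hom_shift_eq_zero_of_neg _ _ n hn f).trans
        (hom_shift_eq_zero_of_neg _ _ n hn g).symm⟩
    infer_instance
  · exact Module.Finite.equiv (singleHomEquiv k (Ω 0) X)
  · obtain ⟨π, hπ, -⟩ := exists_surjective_of_resolution (k := k) hS X (n - 1).toNat
      (n - 1).toNat 0 (by omega) n (by omega)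
    exact Module.Finite.of_surjective π hπ

end

/-- Serre duals pass from the terms of a finite resolution to the resolved object. -/
lemma exists_isSerrePair_of_resolution
    (hM : ∀ j, ∃ Y, boundedObjects C Y ∧ IsSerrePair k (boundedObjects C)
      ((singleFunctor C 0).obj (M j)) Y) (N m : ℕ) (h : IsZero (Ω (m + N))) :
    ∃ Y, boundedObjects C Y ∧ IsSerrePair k (boundedObjects C)
      ((singleFunctor C 0).obj (Ω m)) Y := by
  induction N generalizing m with
  | zero =>
    have h0 : IsZero ((singleFunctor C 0).obj (Ω m)) := (singleFunctor C 0).map_isZero h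
    exact ⟨_, bounded_singleFunctor_obj (Ω m) 0, 0, fun W _ => ⟨fun f g _ => h0.eq_of_tgt _ _,
      fun φ => ⟨0, by ext x; rw [h0.eq_of_src x 0, map_zero, map_zero]⟩⟩⟩
  | succ N ih =>
    obtain ⟨Y', hY', h'⟩ := ih (m + 1) (by rwa [show m + 1 + N = m + (N + 1) by omega])
    obtain ⟨Y, hY, h⟩ := hM m
    exact IsSerrePair.exists_cone (hS m).singleTriangle_distinguished h' h hY' hY

end Resolution

/-! ### The resolution defined by an almost split sequence -/

section AlmostSplitResolution

variable {E : Type u} [Category.{v} E] [Preadditive E] (F : E) (K : ChainComplex E ℕ)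

/-- The syzygies of the top of `Hom(F, K₀)`: the images of the maps
`Hom(F, K_{j+1}) ⟶ Hom(F, K_j)`. -/
noncomputable def syzygy : ℕ → ModuleCat.{v} (End F)ᵐᵒᵖ
  | 0 => topHom F (K.X 0)
  | j + 1 => ModuleCat.of _ (LinearMap.range (homModuleMap F (K.d (j + 1) j)).hom)

/-- The inclusion of a syzygy. -/
noncomputable def syzygyι (j : ℕ) : syzygy F K (j + 1) ⟶ homModule F (K.X j) :=
  ModuleCat.ofHom (Submodule.subtype _)

/-- The projective cover of a syzygy. -/
noncomputable def syzygyπ : ∀ j : ℕ, homModule F (K.X j) ⟶ syzygy F K j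
  | 0 => toTop F (K.X 0)
  | j + 1 => ModuleCat.ofHom (LinearMap.rangeRestrict (homModuleMap F (K.d (j + 1) j)).hom)

lemma syzygyπ_comp_syzygyι (j : ℕ) :
    syzygyπ F K (j + 1) ≫ syzygyι F K j = homModuleMap F (K.d (j + 1) j) := rfl

lemma syzygyι_injective (j : ℕ) : Function.Injective (syzygyι F K j).hom :=
  Subtype.val_injective

lemma syzygyπ_surjective (j : ℕ) : Function.Surjective (syzygyπ F K j).hom := by
  cases j with
  | zero => exact toTop_surjective F _
  | succ j => exact LinearMap.surjective_rangeRestrict _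

instance (j : ℕ) : Epi (syzygyπ F K j) :=
  (ModuleCat.epi_iff_surjective _).2 (syzygyπ_surjective F K j)

instance (j : ℕ) : Mono (syzygyι F K j) :=
  (ModuleCat.mono_iff_injective _).2 (syzygyι_injective F K j)

lemma syzygyι_comp_eq {F : E} {K : ChainComplex E ℕ} {G : E} {j : ℕ}
    (u : syzygy F K (j + 1) ⟶ homModule F G)
    {g : K.X (j + 1) ⟶ G} (hg : syzygyπ F K (j + 1) ≫ u = homModuleMap F g) {h : K.X j ⟶ G}
    (hh : K.d (j + 1) j ≫ h = g) : syzygyι F K j ≫ homModuleMap F h = u := by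
  rw [← cancel_epi (syzygyπ F K (j + 1)), hg, ← hh, homModuleMap_comp, ← syzygyπ_comp_syzygyι,
    Category.assoc]

variable [HasFiniteBiproducts E] {𝓔 : ExactStructure E} {d : ℕ} {F K}
  (hK : IsAlmostSplit 𝓔 (addOf F) d K)

namespace IsAlmostSplit

include hK

lemma isZero_syzygy (j : ℕ) (hj : d + 1 < j) : IsZero (syzygy F K j) := by
  obtain _ | j := j
  · omega
  · have h0 : homModuleMap F (K.d (j + 1) j) = 0 := by
      rw [(hK.isZero (j + 1) hj).eq_of_src (K.d (j + 1) j) 0, homModuleMap_zero]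
    rw [IsZero.iff_id_eq_zero, ← cancel_epi (syzygyπ F K (j + 1)),
      ← cancel_mono (syzygyι F K j), Category.comp_id, syzygyπ_comp_syzygyι, h0, comp_zero,
      zero_comp]

variable [IsLocalRing (End (K.X 0))]

/-- Exactness of the resolution. In degree zero the kernel of the projection to the top consists of
the radical morphisms, which are those factoring through the last map of the sequence. -/
lemma syzygyπ_eq_zero_iff (j : ℕ) (x : F ⟶ K.X j) :
    (syzygyπ F K j).hom x = 0 ↔ ∃ y, (syzygyι F K j).hom y = x := by
  have key : (∃ y, (syzygyι F K j).hom y = x) ↔ ∃ h : F ⟶ K.X (j + 1), h ≫ K.d (j + 1) j = x := by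
    constructor
    · rintro ⟨⟨_, h, rfl⟩, rfl⟩
      exact ⟨h, rfl⟩
    · rintro ⟨h, rfl⟩
      exact ⟨⟨_, h, rfl⟩, rfl⟩
  rw [key]
  cases j with
  | zero =>
    rw [← hK.sink F (addOf_self F)]
    exact toTop_hom_apply_eq_zero_iff (hK.mem 0) x
  | succ j =>
    have : (syzygyπ F K (j + 1)).hom x = 0 ↔ x ≫ K.d (j + 1) j = 0 :=
      (map_eq_zero_iff _ (syzygyι_injective F K j)).symm
    rw [this]
    refine ⟨hK.exact_left F (addOf_self F) j x, ?_⟩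
    rintro ⟨h, rfl⟩
    rw [Category.assoc, K.d_comp_d, comp_zero]

lemma syzygyι_comp_syzygyπ (j : ℕ) : syzygyι F K j ≫ syzygyπ F K j = 0 := by
  ext y
  exact (hK.syzygyπ_eq_zero_iff j _).2 ⟨y, rfl⟩

lemma shortExact_syzygy (j : ℕ) :
    (ShortComplex.mk (syzygyι F K j) (syzygyπ F K j) (hK.syzygyι_comp_syzygyπ j)).ShortExact where
  exact := (ShortComplex.ShortExact.moduleCat_exact_iff_function_exact _).2
    (hK.syzygyπ_eq_zero_iff j)
  mono_f := inferInstanceAs (Mono (syzygyι F K j))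
  epi_g := inferInstanceAs (Epi (syzygyπ F K j))

/-- The tops of the modules defined by the right ends have finite projective dimension. -/
lemma hasProjectiveDimensionLT_topHom : HasProjectiveDimensionLT (topHom F (K.X 0)) (d + 2) := by
  have (j : ℕ) : Projective (homModule F (K.X j)) := projective_homModule (hK.mem j)
  exact hasProjectiveDimensionLT_of_resolution hK.shortExact_syzygy (d + 2) 0
    (hK.isZero_syzygy _ (by omega))

lemma d_comp_eq_zero {G : E} {j : ℕ} (u : syzygy F K j ⟶ homModule F G) {g : K.X j ⟶ G}
    (hg : homModuleMap F g = syzygyπ F K j ≫ u) : K.d (j + 1) j ≫ g = 0 := by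
  refine eq_zero_of_homModuleMap (hK.mem (j + 1)) ?_
  rw [homModuleMap_comp, hg, ← syzygyπ_comp_syzygyι, Category.assoc,
    ← Category.assoc (syzygyι F K j), hK.syzygyι_comp_syzygyπ, zero_comp, comp_zero]

variable [HasDerivedCategory.{w} (ModuleCat.{v} (End F)ᵐᵒᵖ)]

/-- The extensions between the top of `Hom(F, K₀)` and the modules `Hom(F, G)` are concentrated in
degree `d + 1`. -/
lemma hom_stalk_topHom_eq_zero (k : Type t) [Field k] [Linear k E] {G : E}
    (hG : addOf F G) (n : ℤ) (hn : n ≠ d + 1 ∨ ∀ g : K.X (d + 1) ⟶ G, InRadical g)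
    (f : stalk (topHom F (K.X 0)) ⟶ (stalk (homModule F G))⟦n⟧) : f = 0 := by
  have (j : ℕ) : Projective (homModule F (K.X j)) := projective_homModule (hK.mem j)
  obtain hn₀ | rfl | hn₀ := lt_trichotomy n 0
  · exact hom_shift_eq_zero_of_neg _ _ n hn₀ f
  · obtain ⟨f, rfl⟩ : ∃ f' : syzygy F K 0 ⟶ homModule F G, singleHomEquiv k _ _ f' = f :=
      (singleHomEquiv k (syzygy F K 0) (homModule F G)).surjective f
    obtain ⟨g, hg⟩ := exists_homModuleMap_eq (hK.mem 0) (syzygyπ F K 0 ≫ f)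
    have hg0 : g = 0 := hK.mono_right G hG g (hK.d_comp_eq_zero f hg)
    rw [hg0, homModuleMap_zero] at hg
    have : f = 0 := (cancel_epi (syzygyπ F K 0)).1 (hg.symm.trans comp_zero.symm)
    exact (congrArg _ this).trans (map_zero (singleHomEquiv k (syzygy F K 0) (homModule F G)))
  · obtain ⟨N, rfl⟩ : ∃ N : ℕ, n = (N : ℤ) + 1 := ⟨(n - 1).toNat, by omega⟩
    obtain ⟨π, hπ, hπ'⟩ := exists_surjective_of_resolution (k := k) hK.shortExact_syzygy
      (homModule F G) N N 0 (by omega) _ rfl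
    obtain ⟨u, rfl⟩ := hπ f
    obtain ⟨g, hg⟩ := exists_homModuleMap_eq (hK.mem (N + 1)) (syzygyπ F K (N + 1) ≫ u)
    obtain hN | hN := lt_or_ge d N
    · exact (congrArg π ((hK.isZero_syzygy (N + 1) (by omega)).eq_of_src u 0)).trans (map_zero π)
    suffices ∃ h : K.X N ⟶ G, K.d (N + 1) N ≫ h = g by
      obtain ⟨h, hh⟩ := this
      rw [← syzygyι_comp_eq u hg.symm hh]
      exact hπ' _
    obtain rfl | hN := hN.eq_or_lt
    · exact (hK.source G hG g).1 (hn.resolve_left (by simp) g)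
    · exact hK.exact_right G hG N hN g (hK.d_comp_eq_zero u hg)

variable {k : Type t} [Field k] [Linear k E]

/-- The extensions of degree `d + 1` between the top of `Hom(F, K₀)` and `Hom(F, K_{d+1})` form a
vector space of dimension at most one. -/
lemma exists_span_hom_stalk_topHom
    (hc : ∀ φ : K.X (d + 1) ⟶ K.X (d + 1), ∃ c : k, InRadical (φ - c • 𝟙 _)) :
    ∃ f₀ : stalk (topHom F (K.X 0)) ⟶ (stalk (homModule F (K.X (d + 1))))⟦(d : ℤ) + 1⟧,
      ∀ f, ∃ c : k, f = c • f₀ := by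
  have (j : ℕ) : Projective (homModule F (K.X j)) := projective_homModule (hK.mem j)
  obtain ⟨π, hπ, hπ'⟩ := exists_surjective_of_resolution (k := k) hK.shortExact_syzygy
    (homModule F (K.X (d + 1))) d d 0 (by omega) _ rfl
  have : Mono (syzygyπ F K (d + 1)) :=
    (hK.shortExact_syzygy (d + 1)).exact.mono_g
      ((hK.isZero_syzygy (d + 2) (by omega)).eq_of_src _ _)
  have : IsIso (syzygyπ F K (d + 1)) := isIso_of_mono_of_epi _
  refine ⟨π (inv (syzygyπ F K (d + 1))), fun f => ?_⟩
  obtain ⟨u, rfl⟩ := hπ f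
  obtain ⟨g, hg⟩ := exists_homModuleMap_eq (hK.mem (d + 1)) (syzygyπ F K (d + 1) ≫ u)
  obtain ⟨c, hc⟩ := hc g
  refine ⟨c, ?_⟩
  obtain ⟨h, hh⟩ := (hK.source _ (hK.mem _) _).1 hc
  have : syzygyι F K d ≫ homModuleMap F h = u - c • inv (syzygyπ F K (d + 1)) := by
    refine syzygyι_comp_eq _ ?_ hh
    rw [Preadditive.comp_sub, ← hg, Linear.comp_smul, IsIso.hom_inv_id]
    ext x
    change (x : F ⟶ K.X (d + 1)) ≫ g - algebraMap k (End F)ᵐᵒᵖ c • (x : F ⟶ K.X (d + 1)) = x ≫ _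
    rw [Preadditive.comp_sub, Linear.comp_smul, Category.comp_id]
    congr 1
    change (c • 𝟙 F) ≫ _ = _
    rw [Linear.smul_comp, Category.id_comp]
  have := congrArg π this
  rw [map_sub, map_smul, hπ', eq_comm, sub_eq_zero] at this
  exact this

/-- The Serre dual of the top of `Hom(F, K₀)` is the top of `Hom(F, K_{d+1})`, shifted by `d + 1`.
The cohomology of the Serre dual is computed by testing against the modules `Hom(F, G)`. -/
lemma isSerrePair_stalk_topHom (h : IsKrullSchmidt (addOf F))
    (hc : ∀ φ : K.X (d + 1) ⟶ K.X (d + 1), ∃ c : k, InRadical (φ - c • 𝟙 _)) :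
    IsSerrePair k (boundedObjects (ModuleCat.{v} (End F)ᵐᵒᵖ)) (stalk (topHom F (K.X 0)))
      ((stalk (topHom F (K.X (d + 1))))⟦(d : ℤ) + 1⟧) := by
  have := hK.isLocalRing_left
  obtain ⟨x₀, hx₀⟩ := exists_not_inRadical (hK.mem 0)
  have : Nontrivial (End F)ᵐᵒᵖ := by
    refine ⟨1, 0, fun h10 => hx₀ ?_⟩
    have : x₀ = 0 := (one_smul (End F)ᵐᵒᵖ x₀).symm.trans ((congrArg (· • x₀) h10).trans
      (zero_smul _ x₀))
    rw [this]
    exact inRadical_zero _ _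
  obtain ⟨Y, hY, hS⟩ : ∃ Y, boundedObjects _ Y ∧ IsSerrePair k
      (boundedObjects (ModuleCat.{v} (End F)ᵐᵒᵖ)) (stalk (topHom F (K.X 0))) Y :=
    exists_isSerrePair_of_resolution (k := k) hK.shortExact_syzygy (fun j => by
      obtain ⟨n, a, b, hab⟩ := exists_sum_eq_id_of_addOf (hK.mem j)
      exact exists_isSerrePair_of_dualBasis (p := b) (f := fun l => homForm (a l))
        (sum_homForm_smul hab)) (d + 2) 0 (hK.isZero_syzygy _ (by omega))
  obtain ⟨t, ht⟩ := id hS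
  let D (G : E) (n : ℤ) := (DerivedCategory.singleFunctor (ModuleCat.{v} (End F)ᵐᵒᵖ) n).obj
    (homModule F G)
  let σ (G : E) (n : ℤ) : (stalk (homModule F G))⟦-n⟧ ≅ D G n :=
    ((DerivedCategory.singleFunctors _).shiftIso (-n) n 0 (by simp)).app (homModule F G)
  have hdet {G : E} {n : ℤ} (f : D G n ⟶ Y)
      (hf : ∀ x : stalk (topHom F (K.X 0)) ⟶ D G n, t (x ≫ f) = 0) : f = 0 :=
    (injective_iff_map_eq_zero _).1 (ht _ (bounded_singleFunctor_obj _ _)).1 f (LinearMap.ext hf)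
  -- morphisms from `Hom(F, G)` to `Y` are determined by the extensions of the top of `Hom(F, K₀)`
  have hvan (G : E) (hG : addOf F G) (n : ℤ)
      (hn : -n ≠ d + 1 ∨ ∀ g : K.X (d + 1) ⟶ G, InRadical g) (f : D G n ⟶ Y) : f = 0 := by
    refine hdet f fun x => ?_
    have : x ≫ (σ G n).inv = 0 := hK.hom_stalk_topHom_eq_zero k hG (-n) hn _
    have : x = 0 := by rw [← cancel_mono (σ G n).inv, this, zero_comp]
    rw [this, zero_comp, map_zero]
  have hH (n : ℤ) (hn : n ≠ -((d : ℤ) + 1)) :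
      IsZero ((DerivedCategory.homologyFunctor (ModuleCat.{v} (End F)ᵐᵒᵖ) n).obj Y) := by
    rw [ModuleCat.isZero_iff_subsingleton]
    by_contra hnt
    rw [not_subsingleton_iff_nontrivial] at hnt
    obtain ⟨m, hm⟩ := exists_ne (0 : (DerivedCategory.homologyFunctor
      (ModuleCat.{v} (End F)ᵐᵒᵖ) n).obj Y)
    obtain ⟨G, q, hG, hG', hT⟩ := exists_evalMap_ne_zero h m hm
    have := projective_homModule hG
    obtain ⟨g, hg⟩ := exists_hom_ne_zero_of_projective Y n _ hT
    exact hg (hvan G hG n (Or.inl (by omega)) g)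
  obtain ⟨N, ⟨e⟩⟩ : ∃ N, Nonempty (Y ≅ (DerivedCategory.singleFunctor
      (ModuleCat.{v} (End F)ᵐᵒᵖ) (-((d : ℤ) + 1))).obj N) := by
    have : Y.IsGE (-((d : ℤ) + 1)) :=
      (DerivedCategory.isGE_iff _ _).2 fun i hi => hH i (by omega)
    have : Y.IsLE (-((d : ℤ) + 1)) :=
      (DerivedCategory.isLE_iff _ _).2 fun i hi => hH i (by omega)
    exact Y.exists_iso_singleFunctor_obj_of_isGE_of_isLE _
  have e' : (stalk N)⟦(d : ℤ) + 1⟧ ≅ (DerivedCategory.singleFunctor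
      (ModuleCat.{v} (End F)ᵐᵒᵖ) (-((d : ℤ) + 1))).obj N :=
    ((DerivedCategory.singleFunctors _).shiftIso ((d : ℤ) + 1) (-((d : ℤ) + 1)) 0 (by simp)).app N
  let ψ {G : E} (T : homModule F G ⟶ N) : D G (-((d : ℤ) + 1)) ⟶ Y :=
    (DerivedCategory.singleFunctor _ _).map T ≫ e.inv
  have hψ {G : E} (T T' : homModule F G ⟶ N) (hT : ψ T = ψ T') : T = T' :=
    (DerivedCategory.singleFunctor _ _).map_injective ((cancel_mono e.inv).1 hT)
  have hψ0 {G : E} : ψ (0 : homModule F G ⟶ N) = 0 :=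
    (congrArg (· ≫ e.inv) (Functor.map_zero _ _ _)).trans zero_comp
  have hψs {G : E} (c : k) (T : homModule F G ⟶ N) : ψ (c • T) = c • ψ T :=
    (congrArg (· ≫ e.inv) (Functor.map_smul _ c T)).trans (Linear.smul_comp _ _ _ _ _ _)
  have hN : Nontrivial N := by
    rw [← not_subsingleton_iff_nontrivial, ← ModuleCat.isZero_iff_subsingleton]
    intro hN
    have hY0 : IsZero Y := ((DerivedCategory.singleFunctor _ _).map_isZero hN).of_iso e
    have h1 : 𝟙 (stalk (topHom F (K.X 0))) = 0 := by
      refine (Module.forall_dual_apply_eq_zero_iff k _).1 fun φ => ?_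
      obtain ⟨f, rfl⟩ := (ht _ (bounded_singleFunctor_obj (topHom F (K.X 0)) 0)).2 φ
      rw [hY0.eq_of_tgt f 0, map_zero]
      rfl
    have h0 : 𝟙 (topHom F (K.X 0)) = 0 := by
      apply (DerivedCategory.singleFunctor (ModuleCat.{v} (End F)ᵐᵒᵖ) 0).map_injective
      exact (CategoryTheory.Functor.map_id _ _).trans (h1.trans (Functor.map_zero _ _ _).symm)
    have := isSimpleModule_topHom (hK.mem 0)
    have := IsSimpleModule.nontrivial (End F)ᵐᵒᵖ (topHom F (K.X 0))
    rw [← IsZero.iff_id_eq_zero, ModuleCat.isZero_iff_subsingleton] at h0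
    exact not_subsingleton _ h0
  obtain ⟨i⟩ := iso_topHom_of_hom k h (N := N) (hK.mem (d + 1)) (fun G hG hG' hGK T => by
    refine hψ _ _ ((hvan G hG _ (Or.inr fun g => ?_) _).trans hψ0.symm)
    by_contra hg
    obtain ⟨s, hs⟩ := (not_inRadical_iff g).1 hg
    have := isIso_of_comp_eq_id g s hs not_isZero_of_isLocalRing
    exact hGK.false (asIso g).symm) (fun T T' hT => by
    obtain ⟨f₀, hf₀⟩ : ∃ f₀ : stalk (topHom F (K.X 0)) ⟶
        (stalk (homModule F (K.X (d + 1))))⟦- -((d : ℤ) + 1)⟧, ∀ f, ∃ c : k, f = c • f₀ := by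
      rw [neg_neg]
      exact hK.exists_span_hom_stalk_topHom hc
    let v₀ := f₀ ≫ (σ (K.X (d + 1)) (-((d : ℤ) + 1))).hom
    have hv₀ (x : stalk (topHom F (K.X 0)) ⟶ D (K.X (d + 1)) (-((d : ℤ) + 1))) :
        ∃ c : k, x = c • v₀ := by
      obtain ⟨c, hc⟩ := hf₀ (x ≫ (σ (K.X (d + 1)) (-((d : ℤ) + 1))).inv)
      refine ⟨c, ?_⟩
      rw [← Linear.smul_comp, ← hc, Category.assoc, Iso.inv_hom_id, Category.comp_id]
    -- a morphism to `Y` is determined by its pairing with the spanning element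
    have hinj (f : D (K.X (d + 1)) (-((d : ℤ) + 1)) ⟶ Y) (hf : t (v₀ ≫ f) = 0) : f = 0 := by
      refine hdet f fun x => ?_
      obtain ⟨c, rfl⟩ := hv₀ x
      rw [Linear.smul_comp, map_smul, hf, smul_zero]
    have hne : t (v₀ ≫ ψ T) ≠ 0 := fun h0 => hT (hψ _ _ ((hinj _ h0).trans hψ0.symm))
    refine ⟨t (v₀ ≫ ψ T') / t (v₀ ≫ ψ T), hψ _ _ ?_⟩
    rw [hψs, ← sub_eq_zero]
    refine hinj _ ?_
    rw [Preadditive.comp_sub, Linear.comp_smul, map_sub, map_smul, smul_eq_mul,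
      div_mul_cancel₀ _ hne, sub_self])
  exact hS.of_iso (Iso.refl _) (e ≪≫ e'.symm ≪≫ (shiftFunctor _ ((d : ℤ) + 1)).mapIso
    ((DerivedCategory.singleFunctor (ModuleCat.{v} (End F)ᵐᵒᵖ) 0).mapIso i))

end IsAlmostSplit

end AlmostSplitResolution

/-! ### Serre duality on a triangulated subcategory from its generators -/

section HomFinite

variable {k : Type t} [Field k] {T : Type u} [Category.{v} T] [Preadditive T] [Linear k T]

lemma module_finite_hom_of_iso {X X' Y Y' : T} (e : X ≅ X') (e' : Y ≅ Y')
    (h : Module.Finite k (X ⟶ Y)) : Module.Finite k (X' ⟶ Y') :=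
  Module.Finite.equiv (Linear.homCongr k e e')

lemma module_finite_of_subsingleton_hom {X Y : T} (h : Subsingleton (X ⟶ Y)) :
    Module.Finite k (X ⟶ Y) := inferInstance

end HomFinite

/-- A map `τ` for which `S (τ i)` is, up to a shift, the Serre dual of `S i` is injective, since the
Serre dual determines `S i`. -/
lemma injective_of_isSerrePair {k : Type t} [Field k] {T : Type u} [Category.{v} T]
    [Preadditive T] [Linear k T] [HasShift T ℤ] {Q : ObjectProperty T} {ι : Type*} {S : ι → T}
    (hS : ∀ i, Q (S i)) {τ : ι → ι} {D : ℤ} (hτ : ∀ i, IsSerrePair k Q (S i) ((S (τ i))⟦D⟧))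
    (hfin : ∀ i j, Module.Finite k (S i ⟶ S j))
    (hinj : ∀ i j, Nonempty (S i ≅ S j) → i = j) : Function.Injective τ := by
  intro i j hij
  have hj := hτ j
  rw [← hij] at hj
  exact hinj _ _ (IsSerrePair.iso_unique_left (hτ i) hj (hS i) (hS j))

/-- The action of the powers of a Serre functor on the generators and their shifts. -/
lemma iterate_serreFunctor_obj {k : Type t} [Field k] {T : Type u} [Category.{v} T]
    [Preadditive T] [Linear k T] [HasShift T ℤ] [∀ n : ℤ, (shiftFunctor T n).Additive]
    [∀ n : ℤ, (shiftFunctor T n).Linear k] {Q : ObjectProperty T} [Q.IsStableUnderShift ℤ]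
    {ι : Type*} {S : ι → T} (hS : ∀ i, Q (S i)) {τ : ι → ι} {D : ℤ}
    (hτ : ∀ i, IsSerrePair k Q (S i) ((S (τ i))⟦D⟧)) {ν : Q.FullSubcategory ⥤ Q.FullSubcategory}
    (hν : IsSerreFunctor k ν) (n : ℕ) : ∀ (i : ι) (m : ℤ) (X : Q.FullSubcategory),
      (X.obj ≅ (S i)⟦m⟧) → Nonempty ((ν.obj^[n] X).obj ≅ (S (τ^[n] i))⟦m + D * n⟧) := by
  induction n with
  | zero =>
    intro i m X e
    exact ⟨e ≪≫ eqToIso (by simp)⟩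
  | succ n ih =>
    intro i m X e
    have hY : Q (((S (τ i))⟦D⟧)⟦m⟧) := Q.le_shift m _ (Q.le_shift D _ (hS _))
    have h : IsSerrePair k Q X.obj (((S (τ i))⟦D⟧)⟦m⟧) :=
      ((hτ i).shift m).of_iso e.symm (Iso.refl _)
    obtain ⟨e'⟩ := (hν.isSerrePair X).iso_unique
      (IsSerrePair.fullSubcategory (Y := ⟨_, hY⟩) h) trivial trivial
    obtain ⟨e''⟩ := ih (τ i) (m + D) (ν.obj X) (Q.ι.mapIso e' ≪≫
      ((shiftFunctorAdd' T D m (m + D) (add_comm D m)).symm.app _))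
    rw [Function.iterate_succ_apply, Function.iterate_succ_apply]
    exact ⟨e'' ≪≫ eqToIso (by push_cast; ring_nf)⟩

section Generators

open Pretriangulated

variable {T : Type u} [Category.{v} T] [Preadditive T]
  [HasZeroObject T] [HasShift T ℤ] [∀ n : ℤ, (shiftFunctor T n).Additive] [Pretriangulated T]

lemma isTriangulated_of_cone (Q : ObjectProperty T) [Q.IsClosedUnderIsomorphisms]
    (h0 : ∀ X, IsZero X → Q X) (hs : ∀ (X : T) (n : ℤ), Q X → Q (X⟦n⟧))
    (hc : ∀ S ∈ distTriang T, Q S.obj₁ → Q S.obj₂ → Q S.obj₃) : Q.IsTriangulated where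
  exists_zero := ⟨_, isZero_zero T, h0 _ (isZero_zero T)⟩
  isStableUnderShiftBy a := ⟨fun X hX => hs X a hX⟩
  ext₂' _ hS h₁ h₃ := ObjectProperty.le_isoClosure _ _
    (hc _ (inv_rot_of_distTriang _ hS) (hs _ (-1) h₃) h₁)

variable (k : Type t) [Field k] [Linear k T]

/-- The objects `Y` such that all `Hom(X, Y⟦n⟧)` are finite-dimensional. -/
def finiteHomTo (X : T) : ObjectProperty T := fun Y => ∀ n : ℤ, Module.Finite k (X ⟶ Y⟦n⟧)

/-- The objects `X` such that all `Hom(X⟦n⟧, Y)` are finite-dimensional. -/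
def finiteHomFrom (Y : T) : ObjectProperty T := fun X => ∀ n : ℤ, Module.Finite k (X⟦n⟧ ⟶ Y)

variable {k}

instance (X : T) : (finiteHomTo k X).IsClosedUnderIsomorphisms where
  of_iso e h n := module_finite_hom_of_iso (Iso.refl _) ((shiftFunctor T n).mapIso e) (h n)

instance (Y : T) : (finiteHomFrom k Y).IsClosedUnderIsomorphisms where
  of_iso e h n := module_finite_hom_of_iso ((shiftFunctor T n).mapIso e) (Iso.refl _) (h n)

instance (X : T) : (finiteHomTo k X).IsTriangulated where
  exists_zero := ⟨_, isZero_zero T, fun n => module_finite_of_subsingleton_hom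
    ⟨fun _ _ => ((shiftFunctor T n).map_isZero (isZero_zero T)).eq_of_tgt _ _⟩⟩
  isStableUnderShiftBy a := ⟨fun W hW n =>
    module_finite_hom_of_iso (Iso.refl _) ((shiftFunctorAdd T a n).app W) (hW (a + n))⟩
  ext₂' S hS h₁ h₃ := ObjectProperty.le_isoClosure _ _ fun n => by
    exact finite_of_function_exact
      (rightComp_exact₂ X (Triangle.shift_distinguished S hS n)) (h₁ n) (h₃ n)

instance (Y : T) : (finiteHomFrom k Y).IsTriangulated where
  exists_zero := ⟨_, isZero_zero T, fun n => module_finite_of_subsingleton_hom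
    ⟨fun _ _ => ((shiftFunctor T n).map_isZero (isZero_zero T)).eq_of_src _ _⟩⟩
  isStableUnderShiftBy a := ⟨fun W hW n =>
    module_finite_hom_of_iso ((shiftFunctorAdd T a n).app W) (Iso.refl _) (hW (a + n))⟩
  ext₂' S hS h₁ h₃ := ObjectProperty.le_isoClosure _ _ fun n => by
    exact finite_of_function_exact
      (leftComp_exact₂ Y (Triangle.shift_distinguished S hS n)) (h₃ n) (h₁ n)

variable [∀ n : ℤ, (shiftFunctor T n).Linear k]

variable {Q : ObjectProperty T} {ι : Type*} {S : ι → T}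

/-- If the objects `S i` generate `Q` as a triangulated subcategory, and the spaces
`Hom(S i, (S j)⟦n⟧)` are finite-dimensional, then `Q` is Hom-finite. -/
lemma finite_hom_of_generators
    (hgen : ∀ (Q' : ObjectProperty T) [Q'.IsTriangulated] [Q'.IsClosedUnderIsomorphisms],
      (∀ i, Q' (S i)) → Q ≤ Q')
    (hfin : ∀ i j (n : ℤ), Module.Finite k (S i ⟶ (S j)⟦n⟧)) {X Y : T} (hX : Q X) (hY : Q Y) :
    Module.Finite k (X ⟶ Y) := by
  refine module_finite_hom_of_iso ((shiftFunctorZero T ℤ).app X) (Iso.refl Y)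
    (hgen (finiteHomFrom k Y) (fun i n => ?_) X hX 0)
  have := hgen (finiteHomTo k (S i)) (fun j n => hfin i j n) Y hY (-n)
  exact module_finite_hom_of_iso (Iso.refl _) ((shiftFunctorZero T ℤ).app Y)
    (Module.Finite.equiv (shiftHomEquiv k (S i) Y (-n) n 0 (by simp)))

variable [Q.IsTriangulated] [Q.IsClosedUnderIsomorphisms] (hS : ∀ i, Q (S i))
  (hgen : ∀ (Q' : ObjectProperty T) [Q'.IsTriangulated] [Q'.IsClosedUnderIsomorphisms],
    (∀ i, Q' (S i)) → Q ≤ Q')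
  {τ : ι → ι} {D : ℤ} (hτ : ∀ i, IsSerrePair k Q (S i) ((S (τ i))⟦D⟧))

include hS hgen hτ

lemma exists_isSerrePair_of_generators {X : T} (hX : Q X) : ∃ Y, Q Y ∧ IsSerrePair k Q X Y := by
  let Q' : ObjectProperty T := fun X => ∃ Y, Q Y ∧ IsSerrePair k Q X Y
  have : Q'.IsClosedUnderIsomorphisms :=
    ⟨fun e ⟨Y, hY, h⟩ => ⟨Y, hY, h.of_iso e (Iso.refl Y)⟩⟩
  have : Q'.IsTriangulated := by
    refine isTriangulated_of_cone Q' (fun X hX => ?_) ?_ ?_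
    · exact ⟨X, Q.prop_of_isZero hX, 0, fun W _ => ⟨fun f g _ => hX.eq_of_tgt _ _,
        fun φ => ⟨0, by ext x; rw [hX.eq_of_src x 0, map_zero, map_zero]⟩⟩⟩
    · rintro X n ⟨Y, hY, h⟩
      exact ⟨Y⟦n⟧, Q.le_shift n _ hY, h.shift n⟩
    · rintro ⟨f, g, h⟩ hT ⟨Y', hY', h'⟩ ⟨Y, hY, hh⟩
      exact IsSerrePair.exists_cone hT h' hh hY' hY
  exact hgen Q' (fun i => ⟨_, Q.le_shift D _ (hS _), hτ i⟩) X hX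

lemma exists_isSerrePair_right_of_generators (hsurj : Function.Surjective τ)
    (hfin : ∀ i j (n : ℤ), Module.Finite k (S i ⟶ (S j)⟦n⟧)) {Y : T} (hY : Q Y) :
    ∃ X, Q X ∧ IsSerrePair k Q X Y := by
  let Q' : ObjectProperty T := fun Y => ∃ X, Q X ∧ IsSerrePair k Q X Y
  have : Q'.IsClosedUnderIsomorphisms :=
    ⟨fun e ⟨X, hX, h⟩ => ⟨X, hX, h.of_iso (Iso.refl X) e⟩⟩
  have : Q'.IsTriangulated := by
    refine isTriangulated_of_cone Q' (fun X hX => ?_) ?_ ?_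
    · exact ⟨X, Q.prop_of_isZero hX, 0, fun W _ => ⟨fun f g _ => hX.eq_of_tgt _ _,
        fun φ => ⟨0, by ext x; rw [hX.eq_of_src x 0, map_zero, map_zero]⟩⟩⟩
    · rintro X n ⟨Y, hY, h⟩
      exact ⟨Y⟦n⟧, Q.le_shift n _ hY, h.shift n⟩
    · rintro ⟨f, g, h⟩ hT ⟨X', hX', h'⟩ ⟨X, hX, hh⟩
      have := finite_hom_of_generators hgen hfin hX' hX
      exact IsSerrePair.exists_cone_right hT h' hh hX' hX
  refine hgen Q' (fun j => ?_) Y hY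
  obtain ⟨i, rfl⟩ := hsurj j
  exact ⟨(S i)⟦-D⟧, Q.le_shift (-D) _ (hS i), ((hτ i).shift (-D)).of_iso (Iso.refl _)
    ((shiftEquiv T D).unitIso.symm.app _)⟩

/-- If the generators `S i` of `Q` have the Serre duals `(S (τ i))⟦D⟧` with `τ` surjective, then
every object of `Q` has a Serre dual and is one, so that `Q` has a Serre functor. -/
theorem exists_isSerreFunctor_of_generators (hsurj : Function.Surjective τ)
    (hfin : ∀ i j (n : ℤ), Module.Finite k (S i ⟶ (S j)⟦n⟧)) :
    ∃ ν : Q.FullSubcategory ⥤ Q.FullSubcategory, IsSerreFunctor k ν := by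
  have (X Y : Q.FullSubcategory) : Module.Finite k (X ⟶ Y) :=
    have := finite_hom_of_generators hgen hfin X.property Y.property
    Module.Finite.equiv (fullSubcategoryHomEquiv k X Y).symm
  refine exists_isSerreFunctor (fun X => ?_) fun Y => ?_
  · obtain ⟨Y, hY, h⟩ := exists_isSerrePair_of_generators hS hgen hτ X.property
    exact ⟨⟨Y, hY⟩, IsSerrePair.fullSubcategory h⟩
  · obtain ⟨X, hX, h⟩ := exists_isSerrePair_right_of_generators hS hgen hτ hsurj hfin Y.property
    exact ⟨⟨X, hX⟩, IsSerrePair.fullSubcategory h⟩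

end Generators

/-! ### Complexes with finite-dimensional cohomology over `A / AeA` -/

section Dfd

open DerivedCategory Pretriangulated

variable {A : Type v} [Ring A] {e : A} (k : Type t) [Field k] [Algebra k A]

/-- Induction on finite-dimensional `A / AeA`-modules along short exact sequences. -/
lemma quotModule_induction (p : ModuleCat.{v} Aᵐᵒᵖ → Prop) (h0 : ∀ M, IsZero M → p M)
    (h1 : ∀ S, simpleQuotModules e S → p S)
    (h2 : ∀ S : ShortComplex (ModuleCat.{v} Aᵐᵒᵖ), S.ShortExact → p S.X₁ → p S.X₃ → p S.X₂)
    (M : ModuleCat.{v} Aᵐᵒᵖ) (hM : IsQuotModule e M) (hM' : Module.Finite k M) : p M := by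
  induction hn : Module.finrank k M using Nat.strong_induction_on generalizing M with
  | _ n ih =>
    have : IsArtinian Aᵐᵒᵖ M := isArtinian_of_tower k inferInstance
    obtain hbot | ⟨N, hN, -⟩ := IsAtomic.eq_bot_or_exists_atom_le (⊤ : Submodule Aᵐᵒᵖ M)
    · refine h0 M ?_
      rw [ModuleCat.isZero_iff_subsingleton]
      exact (Submodule.subsingleton_iff Aᵐᵒᵖ).1 (subsingleton_of_bot_eq_top hbot.symm)
    · let S : ShortComplex (ModuleCat.{v} Aᵐᵒᵖ) :=
        ShortComplex.mk (ModuleCat.ofHom N.subtype) (ModuleCat.ofHom N.mkQ) (by ext; simp)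
      have hS : S.ShortExact := ModuleCat.shortComplex_shortExact S
        (LinearMap.exact_subtype_mkQ N) N.injective_subtype N.mkQ_surjective
      have h₁ : simpleQuotModules e S.X₁ :=
        ⟨hM.of_injective S.f N.injective_subtype, isSimpleModule_iff_isAtom.2 hN⟩
      have h₃ : IsQuotModule e S.X₃ := hM.of_surjective S.g N.mkQ_surjective
      have h₃' : Module.Finite k S.X₃ := module_finite_of_surjective k S.g N.mkQ_surjective
      refine h2 S hS (h1 _ h₁) (ih _ ?_ _ h₃ h₃' rfl)
      rw [← hn]
      let f : M →ₗ[k] S.X₃ := S.g.hom.restrictScalars k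
      have hf : Function.Surjective f := N.mkQ_surjective
      have hk := LinearMap.finrank_range_add_finrank_ker f
      rw [LinearMap.range_eq_top.2 hf, finrank_top] at hk
      have : Nontrivial (LinearMap.ker f) := by
        obtain ⟨x, hx, hx0⟩ := N.ne_bot_iff.1 hN.1
        exact ⟨⟨⟨x, (Submodule.Quotient.mk_eq_zero N).2 hx⟩, 0,
          fun h => hx0 (congrArg Subtype.val h)⟩⟩
      have := Module.finrank_pos (R := k) (M := LinearMap.ker f)
      omega

variable [HasDerivedCategory.{w} (ModuleCat.{v} Aᵐᵒᵖ)]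

instance : (DfdProp k e).IsClosedUnderIsomorphisms where
  of_iso {X Y} φ h := by
    have ψ (n : ℤ) := (homologyFunctor (ModuleCat.{v} Aᵐᵒᵖ) n).mapIso φ
    refine ⟨fun n => ?_, h.2.1.subset fun n hn hn' => hn (hn'.of_iso (ψ n).symm),
      fun n => (h.2.2 n).of_iso (ψ n)⟩
    have := h.1 n
    exact module_finite_of_surjective k (ψ n).hom (ψ n).toLinearEquiv.surjective

/-- The complexes with finite-dimensional total cohomology in `Mod A / AeA` form a triangulated
subcategory, since the `A / AeA`-modules are closed under extensions. -/
lemma isTriangulated_dfdProp (he : IsIdempotentElem e) : (DfdProp k e).IsTriangulated where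
  exists_zero := by
    obtain ⟨Z, hZ⟩ := HasZeroObject.zero (C := DerivedCategory (ModuleCat.{v} Aᵐᵒᵖ))
    have h (n : ℤ) := (homologyFunctor (ModuleCat.{v} Aᵐᵒᵖ) n).map_isZero hZ
    have h' (n : ℤ) := ModuleCat.isZero_iff_subsingleton.1 (h n)
    exact ⟨Z, hZ, fun n => inferInstance,
      Set.finite_empty.subset fun n hn => hn (h n), fun n a _ m => Subsingleton.elim _ _⟩
  isStableUnderShiftBy a := ⟨fun X h => by
    have ψ (n : ℤ) : (homologyFunctor (ModuleCat.{v} Aᵐᵒᵖ) n).obj (X⟦a⟧) ≅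
        (homologyFunctor (ModuleCat.{v} Aᵐᵒᵖ) (a + n)).obj X :=
      ((homologyFunctor (ModuleCat.{v} Aᵐᵒᵖ) 0).shiftIso a n (a + n) rfl).app X
    refine ⟨fun n => ?_, ?_, fun n => (h.2.2 (a + n)).of_iso (ψ n).symm⟩
    · have := h.1 (a + n)
      exact module_finite_of_surjective k (ψ n).inv (ψ n).symm.toLinearEquiv.surjective
    · exact (h.2.1.preimage (add_right_injective a).injOn).subset
        fun n hn hn' => hn (hn'.of_iso (ψ n))⟩
  ext₂' S hS h₁ h₃ := ObjectProperty.le_isoClosure _ _ (by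
    have hex (n : ℤ) := HomologySequence.exact₂ S hS n
    refine ⟨fun n => ?_, (h₁.2.1.union h₃.2.1).subset fun n hn => ?_,
      fun n => IsQuotModule.of_exact he (hex n) (h₁.2.2 n) (h₃.2.2 n)⟩
    · have := h₁.1 n
      have := h₃.1 n
      exact module_finite_of_exact k (hex n)
    · by_contra! hn'
      simp only [Set.mem_union, Set.mem_ofPred_eq, not_or, not_not] at hn'
      exact hn ((hex n).isZero_X₂ (hn'.1.eq_of_src _ _) (hn'.2.eq_of_tgt _ _)))

lemma dfdProp_stalk {M : ModuleCat.{v} Aᵐᵒᵖ} (hM : IsQuotModule e M) (hM' : Module.Finite k M) :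
    DfdProp k e (stalk M) := by
  have h0 : (homologyFunctor (ModuleCat.{v} Aᵐᵒᵖ) 0).obj (stalk M) ≅ M :=
    (singleFunctorCompHomologyFunctorIso _ 0).app M
  have hn (n : ℤ) (hn : n ≠ 0) :
      IsZero ((homologyFunctor (ModuleCat.{v} Aᵐᵒᵖ) n).obj (stalk M)) := by
    obtain hn | hn := hn.lt_or_gt
    · exact isZero_of_isGE (stalk M) 0 n hn
    · exact isZero_of_isLE (stalk M) 0 n hn
  refine ⟨fun n => ?_, (Set.finite_singleton 0).subset fun n hn' => ?_, fun n => ?_⟩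
  · by_cases h : n = 0
    · subst h
      exact module_finite_of_surjective k h0.inv h0.symm.toLinearEquiv.surjective
    · have := ModuleCat.isZero_iff_subsingleton.1 (hn n h)
      infer_instance
  · by_contra h
    exact hn' (hn n h)
  · by_cases h : n = 0
    · subst h
      exact hM.of_iso h0.symm
    · have := ModuleCat.isZero_iff_subsingleton.1 (hn n h)
      exact fun a _ m => Subsingleton.elim _ _

variable {k}

lemma exists_isGE_isLE_of_dfdProp {X : DerivedCategory (ModuleCat.{v} Aᵐᵒᵖ)}
    (hX : DfdProp k e X) : ∃ a b : ℤ, X.IsGE a ∧ X.IsLE b := by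
  obtain ⟨a, ha⟩ := hX.2.1.bddBelow
  obtain ⟨b, hb⟩ := hX.2.1.bddAbove
  refine ⟨a, b, (isGE_iff _ _).2 fun i hi => ?_, (isLE_iff _ _).2 fun i hi => ?_⟩
  · by_contra h
    exact absurd (ha h) (by omega)
  · by_contra h
    exact absurd (hb h) (by omega)

lemma dfdProp_le_boundedObjects : DfdProp k e ≤ boundedObjects (ModuleCat.{v} Aᵐᵒᵖ) := by
  intro X hX
  obtain ⟨a, b, ha, hb⟩ := exists_isGE_isLE_of_dfdProp hX
  exact ⟨⟨a, ha⟩, ⟨b, hb⟩⟩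

/-- The category `D_{fd, A/AeA}(A)` is generated by the simple `A / AeA`-modules. -/
lemma dfdProp_le (Q : ObjectProperty (DerivedCategory (ModuleCat.{v} Aᵐᵒᵖ))) [Q.IsTriangulated]
    [Q.IsClosedUnderIsomorphisms] (hQ : ∀ S, simpleQuotModules e S → Q (stalk S)) :
    DfdProp k e ≤ Q := by
  intro X hX
  obtain ⟨a, b, ha, hb⟩ := exists_isGE_isLE_of_dfdProp hX
  refine prop_of_homology Q X a b ha hb fun n => ?_
  refine quotModule_induction k (e := e) (fun M => Q (stalk M)) (fun M hM => ?_) hQ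
    (fun S hS h₁ h₃ => ?_) _ (hX.2.2 n) (hX.1 n)
  · exact Q.prop_of_isZero ((singleFunctor _ 0).map_isZero hM)
  · exact Q.ext_of_isTriangulatedClosed₂ _ hS.singleTriangle_distinguished h₁ h₃

end Dfd

/-! ### The simple modules and their Serre duals -/

/-- The left end of an almost split sequence is not injective. -/
lemma IsAlmostSplit.not_isInjective_left {E : Type u} [Category.{v} E] [Preadditive E]
    {𝓔 : ExactStructure E} {C : ObjectProperty E} {d : ℕ}
    {K : ChainComplex E ℕ} (hK : IsAlmostSplit 𝓔 C d K) [IsLocalRing (End (K.X 0))] :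
    ¬ 𝓔.IsInjective (K.X (d + 1)) := fun h =>
  have := hK.isLocalRing_left
  not_isZero_of_isLocalRing (hK.inRadical_of_isInjective h (hK.mem _) (𝟙 _)).isZero

lemma finite_of_simpleQuotModules {E : Type u} [Category.{v} E] [Preadditive E]
    [HasBinaryBiproducts E] {P F' : E} (k : Type t) [Field k] [Linear k E]
    [Module.Finite k (QuotAeA (idemP P F'))]
    {S : ModuleCat.{v} (End (P ⊞ F'))ᵐᵒᵖ} (hS : simpleQuotModules (idemP P F') S) :
    Module.Finite k S :=
  have := hS.2
  module_finite_of_isSimpleModule k hS.1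

section

variable {E : Type u} [Category.{v} E] [Preadditive E] [HasFiniteBiproducts E]

lemma topHom_iso_of_iso {F G G' : E} (hG : addOf F G) (hG' : addOf F G') [IsLocalRing (End G)]
    [IsLocalRing (End G')] (φ : G ≅ G') : Nonempty (topHom F G ≅ topHom F G') := by
  have := isSimpleModule_topHom hG
  refine iso_topHom_of_ne_zero hG' (homModuleMap F φ.inv ≫ toTop F G) fun h => ?_
  obtain ⟨x, hx⟩ := exists_not_inRadical hG
  refine hx ((toTop_hom_apply_eq_zero_iff hG x).1 ?_)
  have h' : (toTop F G).hom ((x ≫ φ.hom) ≫ φ.inv) = 0 :=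
    congrArg (fun T => ModuleCat.Hom.hom T (x ≫ φ.hom)) h
  rwa [Category.assoc, Iso.hom_inv_id, Category.comp_id] at h'

lemma finite_hom_homModule (k : Type t) [Field k] [Linear k E] {F G : E} (hG : addOf F G)
    (N : ModuleCat.{v} (End F)ᵐᵒᵖ) [Module.Finite k N] : Module.Finite k (homModule F G ⟶ N) := by
  obtain ⟨n, a, b, hab⟩ := exists_sum_eq_id_of_addOf hG
  let ev : (homModule F G ⟶ N) →ₗ[k] (Fin n → N) :=
    { toFun := fun T l => T.hom (b l)
      map_add' := fun _ _ => rfl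
      map_smul' := fun _ _ => rfl }
  refine Module.Finite.of_injective ev fun T T' h => ?_
  ext x
  refine (hom_apply_eq_sum hab T x).trans (Eq.trans ?_ (hom_apply_eq_sum hab T' x).symm)
  exact Finset.sum_congr rfl fun l _ => congrArg _ (congrFun h l)

variable [HasBinaryBiproducts E] {P F' : E}

lemma simpleQuotModules_topHom {G : E} (hG : addOf (P ⊞ F') G) [IsLocalRing (End G)]
    (hG' : ¬ addOf P G) : simpleQuotModules (idemP P F') (topHom (P ⊞ F') G) :=
  ⟨isQuotModule_topHom hG hG', isSimpleModule_topHom hG⟩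

end

section

variable {A : Type v} [Ring A] [HasDerivedCategory.{w} (ModuleCat.{v} Aᵐᵒᵖ)]

lemma iso_of_stalk_shift_iso {M N : ModuleCat.{v} Aᵐᵒᵖ} {n : ℤ}
    (φ : (stalk M)⟦n⟧ ≅ (stalk N)⟦n⟧) : Nonempty (M ≅ N) :=
  ⟨(DerivedCategory.singleFunctor _ 0).preimageIso
    ((shiftFunctor (DerivedCategory (ModuleCat.{v} Aᵐᵒᵖ)) n).preimageIso φ)⟩

end

end FracCY

theorem theoremt
    {k : Type t} [Field k] [IsAlgClosed k]
    {E : Type u} [Category.{v} E] [Preadditive E] [Linear k E] [HasFiniteBiproducts E]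
    [HasBinaryBiproducts E]
    [IsIdempotentComplete E]
    (𝓔 : ExactStructure E) (h𝓔 : 𝓔.IsFrobenius)
    -- `proj E = add P`
    (P : E) (hP : ∀ X : E, 𝓔.IsProjective X ↔ addOf P X)
    -- `F = P ⊕ F'` where `F'` has no non-zero projective direct summands
    (F' : E) (hF' : ∀ Q : E, 𝓔.IsProjective Q → Nonempty (Retract Q F') → IsZero Q)
    (d : ℕ) (hd : HasAlmostSplitSequences 𝓔 (addOf (P ⊞ F')) d)
    -- `F_1, …, F_r` represent the indecomposable non-projective direct summands of `F`
    (r : ℕ) (Fs : Fin r → E)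
    (hFs_add : ∀ i, addOf (P ⊞ F') (Fs i))
    (hFs_indec : ∀ i, Indecomposable (Fs i))
    (hFs_proj : ∀ i, ¬ 𝓔.IsProjective (Fs i))
    (hFs_inj : ∀ i j, Nonempty (Fs i ≅ Fs j) → i = j)
    (hFs_all : ∀ X : E, addOf (P ⊞ F') X → Indecomposable X → ¬ 𝓔.IsProjective X →
      ∃ i, Nonempty (X ≅ Fs i))
    -- `A / AeA` is finite-dimensional
    (hfin : Module.Finite k (QuotAeA (idemP P F')))
    [HasDerivedCategory.{w} (ModuleCat.{v} (End (P ⊞ F'))ᵐᵒᵖ)] :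
    -- (a)
    (∀ M : ModuleCat.{v} (End (P ⊞ F'))ᵐᵒᵖ, IsQuotModule (idemP P F') M →
      Module.Finite k M → ∃ n : ℕ, HasProjectiveDimensionLE M n) ∧
    -- (b)
    (∃ ν : Dfd k (idemP P F') ⥤ Dfd k (idemP P F'),
      IsSerreFunctor k ν) ∧
    -- the tops `S_i` of `Hom(F, F_i)` are the simple `A / AeA`-modules, without repetition
    ((∀ i, simpleQuotModules (idemP P F') (topHom (P ⊞ F') (Fs i))) ∧
      (∀ i j, Nonempty (topHom (P ⊞ F') (Fs i) ≅ topHom (P ⊞ F') (Fs j)) → i = j) ∧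
      (∀ S, simpleQuotModules (idemP P F') S →
        ∃ i, Nonempty (S ≅ topHom (P ⊞ F') (Fs i)))) ∧
    -- (c)
    (∀ i, ∃ n : ℕ,
      IsLeast {m : ℕ | 0 < m ∧
        IsTauIter 𝓔 (addOf (P ⊞ F')) d m (Fs i) (Fs i)} n ∧
      ∃ hS : DfdProp k (idemP P F')
          (stalk (topHom (P ⊞ F') (Fs i))),
        ∀ ν : Dfd k (idemP P F') ⥤ Dfd k (idemP P F'),
          IsSerreFunctor k ν →
          Nonempty ((ν.obj^[n] ⟨stalk (topHom (P ⊞ F') (Fs i)), hS⟩).obj ≅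
            (stalk (topHom (P ⊞ F') (Fs i)))⟦((d : ℤ) + 1) * (n : ℤ)⟧)) ∧
    -- (d)
    (∃ π : Equiv.Perm (SimpleIsoClasses (idemP P F')),
      ∀ S S' T : (simpleQuotModules (idemP P F')).FullSubcategory,
        π (Quotient.mk _ S) = Quotient.mk _ T →
        ∀ l : ℤ, Nonempty (Module.Dual k (ExtInt S.obj S'.obj l) ≃ₗ[k]
          ExtInt S'.obj T.obj ((d : ℤ) + 1 - l))) := by
  have he : IsIdempotentElem (idemP P F') := isIdempotentElem_idemP
  have hKS := hd.krullSchmidt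
  have hT := isTriangulated_dfdProp.{w} k he
  have hloc (i : Fin r) : IsLocalRing (End (Fs i)) :=
    isLocalRing_of_indecomposable hKS (hFs_add i) (hFs_indec i)
  have hsimple (i : Fin r) : simpleQuotModules (idemP P F') (topHom (P ⊞ F') (Fs i)) :=
    simpleQuotModules_topHom (hFs_add i) fun h => hFs_proj i ((hP _).2 h)
  have hinj (i j : Fin r) (h : Nonempty (topHom (P ⊞ F') (Fs i) ≅ topHom (P ⊞ F') (Fs j))) :
      i = j :=
    hFs_inj i j (iso_of_topHom_iso (hFs_add i) (hFs_add j) h.some)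
  have hall (S) (hS : simpleQuotModules (idemP P F') S) :
      ∃ i, Nonempty (S ≅ topHom (P ⊞ F') (Fs i)) := by
    obtain ⟨G, hG, hG', hGP, ⟨φ⟩⟩ := exists_iso_topHom hKS hS
    obtain ⟨i, ⟨ψ⟩⟩ := hFs_all G hG indecomposable_of_isLocalRing fun h => hGP ((hP _).1 h)
    exact ⟨i, ⟨φ ≪≫ (topHom_iso_of_iso hG (hFs_add i) ψ).some⟩⟩
  have hQ {S} (hS : simpleQuotModules (idemP P F') S) : DfdProp k (idemP P F') (stalk S) :=
    dfdProp_stalk k hS.1 (finite_of_simpleQuotModules k hS)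
  -- the two ends of an almost split sequence define a Serre pair
  have hstep (i : Fin r) (K : ChainComplex E ℕ) (hK : IsAlmostSplit 𝓔 (addOf (P ⊞ F')) d K)
      (hK₀ : Nonempty (K.X 0 ≅ Fs i)) : ∃ j, Nonempty (K.X (d + 1) ≅ Fs j) ∧
        IsSerrePair k (DfdProp k (idemP P F')) (stalk (topHom (P ⊞ F') (Fs i)))
          ((stalk (topHom (P ⊞ F') (Fs j)))⟦(d : ℤ) + 1⟧) := by
    obtain ⟨φ⟩ := hK₀
    have := isLocalRing_of_iso φ.symm
    have := hK.isLocalRing_left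
    have hproj : ¬ 𝓔.IsProjective (K.X (d + 1)) := fun h =>
      hK.not_isInjective_left ((h𝓔.projective_iff_injective _).1 h)
    obtain ⟨j, ⟨ψ⟩⟩ := hFs_all _ (hK.mem _) indecomposable_of_isLocalRing hproj
    have hs : simpleQuotModules (idemP P F') (topHom (P ⊞ F') (K.X (d + 1))) :=
      simpleQuotModules_topHom (hK.mem _) fun h => hproj ((hP _).2 h)
    have h := hK.isSerrePair_stalk_topHom (k := k) hKS fun f =>
      have := finite_of_simpleQuotModules k hs
      exists_inRadical_sub_smul k (hK.mem _) (Iso.refl _) f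
    -- the Serre pair of the bounded derived category restricts to `D_{fd, A/AeA}(A)`
    exact ⟨j, ⟨ψ⟩, (h.mono dfdProp_le_boundedObjects).of_iso
      ((DerivedCategory.singleFunctor _ 0).mapIso (topHom_iso_of_iso (hK.mem 0) (hFs_add i) φ).some)
      ((shiftFunctor _ ((d : ℤ) + 1)).mapIso ((DerivedCategory.singleFunctor _ 0).mapIso
        (topHom_iso_of_iso (hK.mem _) (hFs_add j) ψ).some))⟩
  choose K hK hK₀ using fun i => hd.exists_right (Fs i) (hFs_add i) (hFs_indec i) (hFs_proj i)
  choose τ hKτ hτ using fun i => hstep i (K i) (hK i) (hK₀ i)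
  have hlocK (i : Fin r) : IsLocalRing (End ((K i).X 0)) := isLocalRing_of_iso (hK₀ i).some.symm
  have hKtop (i : Fin r) : Nonempty (topHom (P ⊞ F') ((K i).X 0) ≅ topHom (P ⊞ F') (Fs i)) :=
    topHom_iso_of_iso ((hK i).mem 0) (hFs_add i) (hK₀ i).some
  have hfinHom (i j : Fin r) (n : ℤ) : Module.Finite k (stalk (topHom (P ⊞ F') (Fs i)) ⟶
      (stalk (topHom (P ⊞ F') (Fs j)))⟦n⟧) := by
    have (l : ℕ) : Projective (homModule (P ⊞ F') ((K i).X l)) :=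
      projective_homModule ((hK i).mem l)
    have := finite_of_simpleQuotModules k (hsimple j)
    have (l : ℕ) : Module.Finite k (homModule (P ⊞ F') ((K i).X l) ⟶
        topHom (P ⊞ F') (Fs j)) := finite_hom_homModule k ((hK i).mem l) _
    exact module_finite_hom_of_iso ((DerivedCategory.singleFunctor _ 0).mapIso (hKtop i).some)
      (Iso.refl _) (finite_hom_shift_of_resolution (hK i).shortExact_syzygy _ n)
  have hstalk (i j : Fin r) (h : Nonempty (stalk (topHom (P ⊞ F') (Fs i)) ≅
      stalk (topHom (P ⊞ F') (Fs j)))) : i = j :=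
    hinj i j ⟨(DerivedCategory.singleFunctor _ 0).preimageIso h.some⟩
  have hτinj : Function.Injective τ := injective_of_isSerrePair (fun i => hQ (hsimple i)) hτ
    (fun i j => module_finite_hom_of_iso (Iso.refl _) ((shiftFunctorZero _ ℤ).app _)
      (hfinHom i j 0)) hstalk
  have hτbij : Function.Bijective τ := Finite.injective_iff_bijective.1 hτinj
  have hgen (Q : ObjectProperty (DerivedCategory (ModuleCat.{v} (End (P ⊞ F'))ᵐᵒᵖ)))
      [Q.IsTriangulated] [Q.IsClosedUnderIsomorphisms]
      (hQ' : ∀ i, Q (stalk (topHom (P ⊞ F') (Fs i)))) : DfdProp k (idemP P F') ≤ Q := by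
    refine dfdProp_le Q fun S hS => ?_
    obtain ⟨i, ⟨φ⟩⟩ := hall S hS
    exact Q.prop_of_iso ((DerivedCategory.singleFunctor _ 0).mapIso φ.symm) (hQ' i)
  -- by uniqueness of Serre duals, `τ` computes `τ_d`
  have hTau (i : Fin r) (X Z : E) (φ : X ≅ Fs i) : IsTau 𝓔 (addOf (P ⊞ F')) d X Z ↔
      Nonempty (Z ≅ Fs (τ i)) := by
    constructor
    · rintro ⟨L, hL, ⟨α⟩, ⟨β⟩⟩
      obtain ⟨j, ⟨ψ⟩, hj⟩ := hstep i L hL ⟨α ≪≫ φ⟩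
      obtain ⟨γ⟩ := hj.iso_unique (hτ i)
        ((DfdProp k (idemP P F')).le_shift _ _ (hQ (hsimple j)))
        ((DfdProp k (idemP P F')).le_shift _ _ (hQ (hsimple (τ i))))
      obtain rfl := hinj _ _ (iso_of_stalk_shift_iso γ)
      exact ⟨β.symm ≪≫ ψ⟩
    · rintro ⟨ψ⟩
      exact ⟨K i, hK i, ⟨(hK₀ i).some ≪≫ φ.symm⟩, ⟨(hKτ i).some ≪≫ ψ.symm⟩⟩
  have hTauIter (m : ℕ) : ∀ (i : Fin r) (X Z : E), (X ≅ Fs i) →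
      (IsTauIter 𝓔 (addOf (P ⊞ F')) d m X Z ↔ Nonempty (Z ≅ Fs (τ^[m] i))) := by
    induction m with
    | zero => exact fun i X Z φ => ⟨fun ⟨ψ⟩ => ⟨ψ.symm ≪≫ φ⟩, fun ⟨ψ⟩ => ⟨φ ≪≫ ψ.symm⟩⟩
    | succ m ih =>
      intro i X Z φ
      rw [Function.iterate_succ_apply]
      constructor
      · rintro ⟨W, hW, hW'⟩
        obtain ⟨ψ⟩ := (hTau i X W φ).1 hW
        exact (ih (τ i) W Z ψ).1 hW'
      · intro h
        exact ⟨Fs (τ i), (hTau i X _ φ).2 ⟨Iso.refl _⟩, (ih (τ i) _ Z (Iso.refl _)).2 h⟩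
  refine ⟨fun M hM hM' => ⟨d + 1, ?_⟩, ?_, ⟨hsimple, hinj, hall⟩, fun i => ?_, ?_⟩
  · refine quotModule_induction k (fun M => HasProjectiveDimensionLT M (d + 2)) (fun M hM => ?_)
      (fun S hS => ?_) (fun S hS h₁ h₃ => hS.hasProjectiveDimensionLT_X₂ _ h₁ h₃) M hM hM'
    · have := hM.hasProjectiveDimensionLT_zero
      exact hasProjectiveDimensionLT_of_ge M 0 _ (Nat.zero_le _)
    · obtain ⟨i, ⟨φ⟩⟩ := hall S hS
      have := (hK i).hasProjectiveDimensionLT_topHom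
      exact hasProjectiveDimensionLT_of_iso ((hKtop i).some ≪≫ φ.symm) _
  · exact exists_isSerreFunctor_of_generators (fun i => hQ (hsimple i)) hgen hτ hτbij.2 hfinHom
  · have hiter (m : ℕ) : IsTauIter 𝓔 (addOf (P ⊞ F')) d m (Fs i) (Fs i) ↔ τ^[m] i = i := by
      rw [hTauIter m i _ _ (Iso.refl _)]
      exact ⟨fun h => (hFs_inj _ _ h).symm, fun h => by rw [h]; exact ⟨Iso.refl _⟩⟩
    refine ⟨Function.minimalPeriod τ i, ⟨⟨?_, ?_⟩, ?_⟩, hQ (hsimple i), fun ν hν => ?_⟩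
    · exact Function.minimalPeriod_pos_of_mem_periodicPts
        (hτinj.mem_periodicPts i)
    · exact (hiter _).2 (Function.iterate_minimalPeriod)
    · rintro m ⟨hm, hm'⟩
      exact Function.IsPeriodicPt.minimalPeriod_le hm ((hiter m).1 hm')
    · obtain ⟨φ⟩ := iterate_serreFunctor_obj (fun i => hQ (hsimple i)) hτ hν
        (Function.minimalPeriod τ i) i 0 ⟨_, hQ (hsimple i)⟩ ((shiftFunctorZero _ ℤ).symm.app _)
      rw [zero_add, Function.iterate_minimalPeriod] at φ
      exact ⟨φ⟩
  · let ob (i : Fin r) : (simpleQuotModules (idemP P F')).FullSubcategory := ⟨_, hsimple i⟩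
    let cl (i : Fin r) : SimpleIsoClasses (idemP P F') := Quotient.mk _ (ob i)
    have hcl : Function.Bijective cl := by
      constructor
      · intro i j hij
        obtain ⟨φ⟩ := Quotient.exact hij
        exact hinj i j ⟨(ObjectProperty.ι _).mapIso φ⟩
      · rintro ⟨S⟩
        obtain ⟨i, ⟨φ⟩⟩ := hall S.obj S.property
        refine ⟨i, Quotient.sound ⟨(ObjectProperty.ι _).preimageIso ?_⟩⟩
        exact φ.symm
    let c := Equiv.ofBijective cl hcl
    refine ⟨c.symm.trans ((Equiv.ofBijective τ hτbij).trans c), fun S S' T hST l => ?_⟩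
    obtain ⟨i, hi⟩ := hcl.2 (Quotient.mk _ S)
    have hci : c.symm (Quotient.mk _ S) = i := by rw [← hi]; exact c.symm_apply_apply i
    rw [Equiv.trans_apply, hci] at hST
    obtain ⟨φ⟩ := Quotient.exact hi
    obtain ⟨ψ⟩ := Quotient.exact (show cl (τ i) = Quotient.mk _ T from hST)
    obtain ⟨t, ht⟩ := (hτ i).of_iso
      ((DerivedCategory.singleFunctor _ 0).mapIso ((ObjectProperty.ι _).mapIso φ))
      ((shiftFunctor _ ((d : ℤ) + 1)).mapIso ((DerivedCategory.singleFunctor _ 0).mapIso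
        ((ObjectProperty.ι _).mapIso ψ)))
    have hb := ht ((stalk S'.obj)⟦l⟧)
      ((DfdProp k (idemP P F')).le_shift l _ (hQ S'.property))
    exact ⟨(LinearEquiv.ofBijective _ hb).symm.trans
      (shiftHomEquiv k _ _ ((d : ℤ) + 1 - l) l ((d : ℤ) + 1) (by omega)).symm⟩
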